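/- Let $\Phi(z)=z+P_{k+1}(z)+O(\|z\|^{k+2})$ be a germ of biholomorphism of $(\mathbb C^p,0)$, tangent to the identity of order $k+1\ge 2$, i.e. $P_{k+1}\not\equiv 0$ is the first non-linear term of its expansion in homogeneous polynomials. Let $[V]$ be a non-degenerate characteristic direction, i.e. $V\neq 0$ and $P_{k+1}(V)=cV$ with $c\ne 0$. Reorder the coordinates $z=(x,y)\in\mathbb C\times\mathbb C^{p-1}$ so that $[V]=[1:u_0]$, write $P_{k+1}=(p_{k+1},q_{k+1})$ and $r(u)=q_{k+1}(1,u)-p_{k+1}(1,u)\,u$, and let $A(V)=\frac{1}{k\,p_{k+1}(1,u_0)}\,r'(u_0)$. The eigenvalues of this $(p-1)\times(p-1)$ matrix are the directors of $[V]$; for a director $\lambda$ let $m_{\rm alg}(\lambda)$ be its algebraic multiplicity and $E_\lambda\subset\mathbb C^{p-1}=\{0\}\times\mathbb C^{p-1}$ its generalized eigenspace. A set $M\subset\mathbb C^p$ is called a parabolic manifold of dimension $d$ (at the origin, tangent to $[V]$) if $M=\psi(S)$, where $S\subset\mathbb C^d$ is a domain with $0\in\partial S$ and $\psi:S\to\mathbb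 C^p$ is an injective holomorphic immersion which is a homeomorphism onto its image, such that $\psi(z)\to 0$ and $[\psi(z)]\to[V]$ as $z\to 0$ in $S$, and if $\Phi(M)\subset M$ and $\Phi^n(X)\to 0$ for every $X\in M$. It is attracted to the origin along $[V]$ if moreover $[\Phi^n(X)]\to[V]$ for every $X\in M$. It is tangent at the origin to a linear subspace $W$ of dimension $d$ if, as $X\in M$ tends to $0$, the direction of $X$ and the tangent space $T_XM$ tend to $W$. Let $\lambda_1,\dots,\lambda_h$ be the distinct directors of $[V]$ with strictly positive real part, put $\alpha_j={\rm Re}\,\lambda_j$, and assume $\alpha_1>\alpha_2>\cdots>\alpha_h>0$. Then, in any given neighbourhood of the origin on which $\Phi$ is holomorphic, there is a strictly increasing sequence $$M_1\subset M_2\subset\cdots\subset M_h$$ of parabolic manifolds, attracted to the origin along $[V]$, such that for every $1\le i\le h$ the dimension of $M_i$ is $1+\sum_{{\rm Re}\,\lambda_j\ge\alpha_i}m_{\rm alg}(\lambda_j)$ and $M_i$ is tangent at the origin to $\mathbb C V\oplus\bigoplus_{{\rm Re}\,\lambda_j\ge\alpha_i}E_{\lambda_j}$. They are defined in a sector: there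 are $\gamma,s,\rho>0$ such that every $M_i$ is contained in the set of points $(x,y)$, $x\ne0$, for which $\tau=-k\,p_{k+1}(1,u_0)\,x^k$ satisfies $|{\rm Im}\,\tau|<\gamma\,{\rm Re}\,\tau$, $|\tau|<s$, and $\|y/x-u_0\|<\rho$; and the domain of the parametrization of each $M_i$ can be taken to be a sector $\{(x,u)\in\mathbb C\times\mathbb C^{d-1}: x\neq0,\ |\arg x|<\theta,\ |x|<s',\ \|u\|<\rho'\}$ with $d=\dim M_i$, $0<k\theta<\pi/2$ and $s',\rho'>0$. -/

import Mathlib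

open Filter Topology

noncomputable section

namespace ParabolicManifolds

/-- `ℂ^p` with its Euclidean norm. -/
abbrev Cn (p : ℕ) : Type := EuclideanSpace ℂ (Fin p)

/-- The homogeneous part `P_j` of degree `j` in the expansion `Φ(z) = ∑_j P_j(z)` at the origin,
that is `P_j(z) = (1 / j!) D^j Φ(0)(z, …, z)`. -/
def homogeneousPart {p : ℕ} (Φ : Cn p → Cn p) (j : ℕ) (z : Cn p) : Cn p :=
  ((j.factorial : ℂ)⁻¹) • iteratedFDeriv ℂ j Φ 0 (fun _ => z)

/-- `Φ`, holomorphic on the open neighbourhood `U` of the origin, represents a germ of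
biholomorphism of `(ℂ^p, 0)` which is tangent to the identity. (Local invertibility at the origin is
automatic, because the differential there is the identity.) -/
structure IsTangentToIdentity {p : ℕ} (Φ : Cn p → Cn p) (U : Set (Cn p)) : Prop where
  isOpen : IsOpen U
  zero_mem : (0 : Cn p) ∈ U
  holomorphic : DifferentiableOn ℂ Φ U
  map_zero : Φ 0 = 0
  fderiv_zero : fderiv ℂ Φ 0 = ContinuousLinearMap.id ℂ (Cn p)

/-- `ν` is the order of the germ `Φ` tangent to the identity: the least `ν ≥ 2` such that `P_ν` does
not vanish identically. -/
def HasOrder {p : ℕ} (Φ : Cn p → Cn p) (ν : ℕ) : Prop :=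
  2 ≤ ν ∧ (∃ z, homogeneousPart Φ ν z ≠ 0) ∧
    ∀ j, 2 ≤ j → j < ν → ∀ z, homogeneousPart Φ j z = 0

/-- `V` is a non-degenerate characteristic direction of the germ `Φ` of order `k + 1`. -/
def IsNondegenerateCharacteristicDirection {p : ℕ} (Φ : Cn p → Cn p) (k : ℕ) (V : Cn p) : Prop :=
  V ≠ 0 ∧ (∃ c : ℂ, homogeneousPart Φ (k + 1) V = c • V) ∧ homogeneousPart Φ (k + 1) V ≠ 0

/-- Convergence `[X a] → [V]` in projective space along the filter `l` (for `V ≠ 0`): suitable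
multiples of `X a` converge to `V`. In particular `X a ≠ 0` eventually. -/
def TendstoDirection {α : Type*} {p : ℕ} (X : α → Cn p) (l : Filter α) (V : Cn p) : Prop :=
  ∃ c : α → ℂ, Tendsto (fun a => c a • X a) l (𝓝 V)

/-! ### The matrix associated to a characteristic direction

In `ℂ^(m+1)` we single out a coordinate `x = z_j` with `V_j ≠ 0`; the other coordinates form
`y ∈ ℂ^m`, so that `[V] = [1 : u₀]`. -/

/-- The point `(x, y)`: the `j`-th coordinate is `x`, the other ones form `y`. -/
def point {m : ℕ} (j : Fin (m + 1)) (x : ℂ) (y : Fin m → ℂ) : Cn (m + 1) :=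
  WithLp.toLp 2 (j.insertNth (α := fun _ => ℂ) x y)

/-- The affine coordinate `u = y / x` of a point `z = (x, y)`. -/
def affineCoord {m : ℕ} (j : Fin (m + 1)) (z : Cn (m + 1)) : Fin m → ℂ :=
  fun i => z (j.succAbove i) / z j

/-- The inclusion `y ↦ (0, y)` of `ℂ^m` in `ℂ^(m+1)`. -/
def inclusion {m : ℕ} (j : Fin (m + 1)) : (Fin m → ℂ) →ₗ[ℂ] Cn (m + 1) where
  toFun y := point j 0 y
  map_add' y y' := by
    ext i
    refine Fin.succAboveCases j ?_ (fun i => ?_) i <;> simp [point]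
  map_smul' c y := by
    ext i
    refine Fin.succAboveCases j ?_ (fun i => ?_) i <;> simp [point]

/-- The component `p_{k+1}` of `P_{k+1} = (p_{k+1}, q_{k+1})`, at `(1, u)`. -/
def pPart {m : ℕ} (Φ : Cn (m + 1) → Cn (m + 1)) (k : ℕ) (j : Fin (m + 1)) (u : Fin m → ℂ) : ℂ :=
  homogeneousPart Φ (k + 1) (point j 1 u) j

/-- The component `q_{k+1}` of `P_{k+1} = (p_{k+1}, q_{k+1})`, at `(1, u)`. -/
def qPart {m : ℕ} (Φ : Cn (m + 1) → Cn (m + 1)) (k : ℕ) (j : Fin (m + 1)) (u : Fin m → ℂ) :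
    Fin m → ℂ :=
  fun i => homogeneousPart Φ (k + 1) (point j 1 u) (j.succAbove i)

/-- The map `r(u) = q_{k+1}(1, u) - p_{k+1}(1, u) u`. -/
def rMap {m : ℕ} (Φ : Cn (m + 1) → Cn (m + 1)) (k : ℕ) (j : Fin (m + 1)) (u : Fin m → ℂ) :
    Fin m → ℂ :=
  qPart Φ k j u - pPart Φ k j u • u

/-- The matrix `A(V) = r'(u₀) / (k p_{k+1}(1, u₀))` associated to `[V] = [1 : u₀]`. -/
def associatedMatrix {m : ℕ} (Φ : Cn (m + 1) → Cn (m + 1)) (k : ℕ) (j : Fin (m + 1))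
    (V : Cn (m + 1)) : Matrix (Fin m) (Fin m) ℂ :=
  ((k : ℂ) * pPart Φ k j (affineCoord j V))⁻¹ •
    LinearMap.toMatrix' (fderiv ℂ (rMap Φ k j) (affineCoord j V) : (Fin m → ℂ) →ₗ[ℂ] (Fin m → ℂ))

/-- The directors of `[V]`: the eigenvalues of `A(V)`. -/
def IsDirector {m : ℕ} (Φ : Cn (m + 1) → Cn (m + 1)) (k : ℕ) (j : Fin (m + 1))
    (V : Cn (m + 1)) (μ : ℂ) : Prop :=
  Module.End.HasEigenvalue (Matrix.toLin' (associatedMatrix Φ k j V)) μ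

/-- The algebraic multiplicity of `μ` as an eigenvalue of `A(V)`. -/
def algMult {m : ℕ} (Φ : Cn (m + 1) → Cn (m + 1)) (k : ℕ) (j : Fin (m + 1))
    (V : Cn (m + 1)) (μ : ℂ) : ℕ :=
  (associatedMatrix Φ k j V).charpoly.rootMultiplicity μ

/-- The (generalized) eigenspace `E_μ` of `A(V)`, a subspace of `ℂ^m = {0} × ℂ^m ⊆ ℂ^(m+1)`. -/
def directorSpace {m : ℕ} (Φ : Cn (m + 1) → Cn (m + 1)) (k : ℕ) (j : Fin (m + 1))
    (V : Cn (m + 1)) (μ : ℂ) : Submodule ℂ (Cn (m + 1)) :=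
  (Module.End.maxGenEigenspace (Matrix.toLin' (associatedMatrix Φ k j V)) μ).map (inclusion j)

/-! ### Parabolic manifolds -/

/-- `ψ : S → ℂ^p` parametrizes the set `M` as a parabolic manifold of dimension `d` for `Φ`, at the
origin and tangent to the direction `[V]`. -/
structure IsParabolicManifold {p : ℕ} (Φ : Cn p → Cn p) (V : Cn p) (d : ℕ)
    (S : Set (Cn d)) (ψ : Cn d → Cn p) (M : Set (Cn p)) : Prop where
  isOpen : IsOpen S
  isConnected : IsConnected S
  zero_mem_frontier : (0 : Cn d) ∈ frontier S
  holomorphic : DifferentiableOn ℂ ψ S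
  immersion : ∀ z ∈ S, Function.Injective (fderiv ℂ ψ z)
  embedding : IsEmbedding (S.domRestrict ψ)
  image_eq : ψ '' S = M
  tendsto_zero : Tendsto ψ (𝓝[S] 0) (𝓝 0)
  tendsto_direction : TendstoDirection ψ (𝓝[S] 0) V
  invariant : Set.MapsTo Φ M M
  orbit_tendsto : ∀ X ∈ M, Tendsto (fun n => Φ^[n] X) atTop (𝓝 0)

/-- Every point of `M` is attracted to the origin along the direction `[V]`. -/
def AttractedAlong {p : ℕ} (Φ : Cn p → Cn p) (V : Cn p) (M : Set (Cn p)) : Prop :=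
  ∀ X ∈ M, Tendsto (fun n => Φ^[n] X) atTop (𝓝 0) ∧
    TendstoDirection (fun n => Φ^[n] X) atTop V

/-- The manifold `ψ(S)` is tangent to the linear subspace `W` at the origin (`dim W = d`): when the
point `ψ(z)` of the manifold tends to the origin, the direction of `ψ(z)` and the tangent space of
the manifold at `ψ(z)`, which is the range of `Dψ(z)`, tend to `W`. -/
def IsTangentAtOrigin {p d : ℕ} (S : Set (Cn d)) (ψ : Cn d → Cn p)
    (W : Submodule ℂ (Cn p)) : Prop :=
  Module.finrank ℂ W = d ∧
  ∀ ε > 0, ∃ δ > 0, ∀ z ∈ S, ‖ψ z‖ < δ →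
    Metric.infDist (ψ z) W ≤ ε * ‖ψ z‖ ∧
    ∀ t : Cn d, Metric.infDist (fderiv ℂ ψ z t) W ≤ ε * ‖fderiv ℂ ψ z t‖

/-- A sector of `ℂ × ℂ^n`: points `(x, u)` with `x` in a plane sector of vertex `0`, radius `s` and
half-opening `θ` around the positive half-line, and `‖u‖ < ρ`. For `θ = arctan γ / k` this is a
connected component of `|Im x^k| < γ Re x^k`, `|x| < s`, `‖u‖ < ρ`. -/
def coordSector (n : ℕ) (θ s ρ : ℝ) : Set (Cn (n + 1)) :=
  {z | z 0 ≠ 0 ∧ |(z 0).arg| < θ ∧ ‖z 0‖ < s ∧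
    ‖(WithLp.toLp 2 (fun i : Fin n => z i.succ) : Cn n)‖ < ρ}

/-- The sector `|Im ξ^k| < γ Re ξ^k`, `|ξ^k| < s`, `‖U‖ < ρ` around the direction `[V] = [1 : u₀]`.
Here `U = y / x - u₀`, and `ξ` is the multiple of the coordinate `x` which brings the first component
of `Φ` on the line `ℂ V` to the form `ξ - ξ^(k+1) / k + ⋯`, so that `ξ^k = -k p_{k+1}(1, u₀) x^k`. -/
def sector {m : ℕ} (Φ : Cn (m + 1) → Cn (m + 1)) (k : ℕ) (j : Fin (m + 1)) (V : Cn (m + 1))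
    (γ s ρ : ℝ) : Set (Cn (m + 1)) :=
  {z | |(-(k : ℂ) * pPart Φ k j (affineCoord j V) * z j ^ k).im| <
        γ * (-(k : ℂ) * pPart Φ k j (affineCoord j V) * z j ^ k).re ∧
      ‖-(k : ℂ) * pPart Φ k j (affineCoord j V) * z j ^ k‖ < s ∧
      ‖(WithLp.toLp 2 (affineCoord j z - affineCoord j V) : Cn m)‖ < ρ}

end ParabolicManifolds

end

/-! Near [V] the map is one small time step of a flow with known linear part. Put x = κ e^{-t/k}
with -k p_{k+1}(1,u₀) κ^k = 1, and y/x = u₀ + e^{-ηt} w with a small η > 0. Since u₀ is a zero of r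
and r'(u₀) = k p_{k+1}(1,u₀) A(V), the map becomes (t, w) ↦ (t + e^{-t}(1 + a), w - e^{-t}(Bw + b))
with B = A(V) - η and a, b = O(e^{-η Re t}) on a half strip Re t > T, |Im t| < 1
(`exists_local_form`). Up to a and b this is Euler's method with step e^{-t} for dw/dt = -Bw, so
along a director λ the quantity y/x - u₀ behaves like e^{-λt}. Orbits go to Re t = ∞ slowly: e^{Re
t} grows by at most 2 at each step. Contraction factors 1 - μe^{-t} thus tend to 1 along an orbit,
but their product still tends to 0.

Fix i and β > 0 with β + η in the spectral gap just below Re λ_i. The manifold M_i is made of orbits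
that stay within a multiple of e^{-βt} of a curve w = c(t). In the coordinate W given by w = c(t) +
e^{-βt} J W the linear part is B - β, which is hyperbolic: the directors with real part at least Re
λ_i are contracted, all others are expanded (`exists_splitting` supplies J,
`SlowSystem.exists_chart` the new system). The manifold is the graph of a function over the
contracted directions, found as the fixed point of a graph transform
(`HyperbolicSystem.exists_graph`).

The new coordinate multiplies the defect of invariance of c by e^{βt}, so c must be invariant to an
order beyond e^{-βt}. Such curves come from successive corrections (`SlowSystem.exists_curve`), each
of them a solution of d' = -Bd + residual (`exists_solution`). No non-resonance condition is needed,
because an arbitrarily small loss in the rate of decay is allowed at each correction.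

The inclusions come from uniqueness: a point whose whole orbit stays in the domain of a chart lies
on the invariant graph there (`HyperbolicSystem.eq_graph_of_orbit`). All charts use the same curve
c, so the graph with the larger β is small in the chart with the smaller β and stays there, hence
lies on the other graph (`InvariantGraph.exists_graphChart_eq`). For the tangency
(`InvariantGraph.isTangentAtOrigin`), the part of the differential outside the limit space carries
either a factor e^{-ηt} or the decaying fibre derivative of the graph function. -/

noncomputable section
namespace ParabolicManifolds
open Metric Set

/-! ### Holomorphic maps on normed spaces: Cauchy estimates, uniform limits, Taylor remainders. -/

variable {E F : Type*} [NormedAddCommGroup E] [NormedSpace ℂ E]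
  [NormedAddCommGroup F] [NormedSpace ℂ F]

/-- Cauchy's estimate for the Fréchet derivative. -/
theorem norm_fderiv_le_of_forall_norm_le {f : E → F} {x : E} {r C : ℝ} (hr : 0 < r)
    (hd : DifferentiableOn ℂ f (ball x r)) (hC : ∀ y ∈ ball x r, ‖f y‖ ≤ C) :
    ‖fderiv ℂ f x‖ ≤ 2 * C / r := by
  refine Complex.norm_fderiv_le_div_of_mapsTo_ball hd (fun y hy => ?_) hr
  rw [mem_closedBall, dist_eq_norm]
  have := norm_sub_le (f y) (f x)
  linarith [hC y hy, hC x (mem_ball_self hr)]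

theorem fderiv_sub_le_of_forall_norm_sub_le {f g : E → F} {x : E} {r C : ℝ} (hr : 0 < r)
    (hf : DifferentiableOn ℂ f (ball x r)) (hg : DifferentiableOn ℂ g (ball x r))
    (hC : ∀ y ∈ ball x r, ‖f y - g y‖ ≤ C) :
    ‖fderiv ℂ f x - fderiv ℂ g x‖ ≤ 2 * C / r := by
  have h1 := norm_fderiv_le_of_forall_norm_le hr (hf.sub hg) hC
  have hx : ball x r ∈ 𝓝 x := ball_mem_nhds x hr
  have h2 : fderiv ℂ (f - g) x = fderiv ℂ f x - fderiv ℂ g x :=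
    fderiv_sub (hf.differentiableAt hx) (hg.differentiableAt hx)
  rwa [h2] at h1

/-- A uniform limit of holomorphic maps on a ball is holomorphic at the centre. -/
theorem differentiableAt_of_tendstoUniformlyOn [CompleteSpace F] {f : ℕ → E → F} {g : E → F}
    {x : E} {r : ℝ} (hr : 0 < r) (hf : ∀ n, DifferentiableOn ℂ (f n) (ball x r))
    (hfg : TendstoUniformlyOn f g atTop (ball x r)) : DifferentiableAt ℂ g x := by
  have hsub : ∀ y ∈ ball x (r / 2), ball y (r / 2) ⊆ ball x r := fun y hy z hz => by
    rw [mem_ball] at *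
    linarith [dist_triangle z y x]
  have hC : UniformCauchySeqOn (fun n => fderiv ℂ (f n)) atTop (ball x (r / 2)) := by
    rw [Metric.uniformCauchySeqOn_iff]
    intro ε hε
    obtain ⟨N, hN⟩ := Metric.uniformCauchySeqOn_iff.1 hfg.uniformCauchySeqOn (ε * r / 8)
      (by positivity)
    refine ⟨N, fun m hm n hn y hy => ?_⟩
    rw [dist_eq_norm]
    have := fderiv_sub_le_of_forall_norm_sub_le (half_pos hr) ((hf m).mono (hsub y hy))
      ((hf n).mono (hsub y hy)) (C := ε * r / 8)
      (fun z hz => by rw [← dist_eq_norm]; exact (hN m hm n hn z (hsub y hy hz)).le)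
    have h2 : 2 * (ε * r / 8) / (r / 2) = ε / 2 := by field_simp; ring
    linarith
  have hlim : ∀ y ∈ ball x (r / 2), ∃ l, Tendsto (fun n => fderiv ℂ (f n) y) atTop (𝓝 l) :=
    fun y hy => cauchySeq_tendsto_of_complete (hC.cauchySeq hy)
  choose! l hl using hlim
  refine (hasFDerivAt_of_tendstoUniformlyOn (f := f) isOpen_ball
    (hC.tendstoUniformlyOn_of_tendsto hl) (fun n y hy => ?_) (fun y hy => ?_)
    (mem_ball_self (half_pos hr))).differentiableAt
  · have hy' : y ∈ ball x r := ball_subset_ball (by linarith) hy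
    exact ((hf n).differentiableAt (isOpen_ball.mem_nhds hy')).hasFDerivAt
  · exact hfg.tendsto_at (ball_subset_ball (by linarith) hy)

/-- Second order bound of the Taylor remainder of a bounded holomorphic map. -/
theorem norm_sub_sub_fderiv_le {f : E → F} {x : E} {r C : ℝ} (hr : 0 < r)
    (hd : DifferentiableOn ℂ f (ball x r)) (hC : ∀ y ∈ ball x r, ‖f y‖ ≤ C) {y : E}
    (hy : y ∈ ball x r) :
    ‖f y - f x - fderiv ℂ f x (y - x)‖ ≤ 4 * C * (‖y - x‖ / r) ^ 2 := by
  have hfx := (hd.differentiableAt (ball_mem_nhds x hr))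
  have hder := norm_fderiv_le_of_forall_norm_le hr hd hC
  have hC0 : 0 ≤ C := (norm_nonneg _).trans (hC x (mem_ball_self hr))
  set g : E → F := fun y => f y - f x - fderiv ℂ f x (y - x) with hg
  have hgx : g x = 0 := by simp [hg]
  have hgd : DifferentiableOn ℂ g (ball x r) :=
    (hd.sub_const _).sub ((fderiv ℂ f x).differentiable.comp
      (differentiable_id.sub_const x)).differentiableOn
  -- 4C = C + C + 2C: the two values of f, and Cauchy's bound (2C / r) · r for the linear term.
  have hmaps : MapsTo g (ball x r) (closedBall (g x) (4 * C)) := fun z hz => by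
    rw [hgx, mem_closedBall_zero_iff]
    have h1 : ‖fderiv ℂ f x (z - x)‖ ≤ 2 * C / r * r := by
      refine (ContinuousLinearMap.le_opNorm _ _).trans ?_
      have : ‖z - x‖ ≤ r := by rw [← dist_eq_norm]; exact (mem_ball.1 hz).le
      gcongr
    rw [div_mul_cancel₀ _ hr.ne'] at h1
    have h2 := norm_sub_le (f z - f x) (fderiv ℂ f x (z - x))
    have h3 := norm_sub_le (f z) (f x)
    show ‖f z - f x - fderiv ℂ f x (z - x)‖ ≤ _
    linarith [hC z hz, hC x (mem_ball_self hr)]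
  -- Schwarz lemma of higher order: vanishing as o(‖w - x‖) yields the second power of ‖y - x‖ / r.
  have ho : (g · - g x) =o[𝓝 x] (fun w ↦ ‖w - x‖ ^ 1) := by
    simp only [hgx, sub_zero, pow_one]
    exact hfx.hasFDerivAt.isLittleO.norm_right
  have := Complex.dist_le_mul_div_pow_of_mapsTo_ball_of_isLittleO hgd hmaps ho hy
  rwa [hgx, dist_zero_right, dist_eq_norm] at this

/-- The directional derivative is a locally uniform limit of difference quotients, which are
holomorphic; the uniformity is the second order bound `norm_sub_sub_fderiv_le`. Iterating this makes
holomorphic maps smooth. -/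
theorem differentiableOn_fderiv_apply [FiniteDimensional ℂ E] [CompleteSpace F] {f : E → F} {U : Set E}
    (hU : IsOpen U) (hf : DifferentiableOn ℂ f U) (v : E) :
    DifferentiableOn ℂ (fun x => fderiv ℂ f x v) U := by
  intro x hx
  apply DifferentiableAt.differentiableWithinAt
  have hcont : ContinuousAt f x := (hf.differentiableAt (hU.mem_nhds hx)).continuousAt
  obtain ⟨r, hr, hrU⟩ : ∃ r > 0, ball x (3 * r) ⊆ U ∩ {y | ‖f y‖ ≤ ‖f x‖ + 1} := by
    have : U ∩ {y | ‖f y‖ ≤ ‖f x‖ + 1} ∈ 𝓝 x := by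
      refine inter_mem (hU.mem_nhds hx) ?_
      have := hcont.norm.eventually (gt_mem_nhds (lt_add_one ‖f x‖))
      filter_upwards [this] with y hy using hy.le
    obtain ⟨r, hr, h⟩ := Metric.mem_nhds_iff.1 this
    exact ⟨r / 3, by positivity, by rwa [mul_div_cancel₀ _ (by norm_num : (3 : ℝ) ≠ 0)]⟩
  set C := ‖f x‖ + 1 with hCdef
  have hC0 : 0 ≤ C := by positivity
  have hsub : ∀ y ∈ ball x r, ball y r ⊆ U ∩ {y | ‖f y‖ ≤ C} := fun y hy z hz => by
    apply hrU
    rw [mem_ball] at *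
    linarith [dist_triangle z y x]
  -- The shift by N makes v / (n + N + 1) shorter than r for every n, so that all the quotients are
  -- defined on the whole ball.
  obtain ⟨N, hN⟩ : ∃ N : ℕ, ‖v‖ / r < N := exists_nat_gt _
  have hsmall : ∀ n : ℕ, ‖((n + N + 1 : ℂ))⁻¹ • v‖ < r := fun n => by
    have h1 : ‖(n + N + 1 : ℂ)‖ = n + N + 1 := by
      have : (n + N + 1 : ℂ) = ((n + N + 1 : ℕ) : ℂ) := by push_cast; ring
      rw [this, Complex.norm_natCast]; push_cast; ring
    rw [norm_smul, norm_inv, h1, inv_mul_lt_iff₀ (by positivity)]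
    rw [div_lt_iff₀ hr] at hN
    nlinarith [(Nat.cast_nonneg n : (0 : ℝ) ≤ n)]
  let q : ℕ → E → F := fun n y => (n + N + 1 : ℂ) • (f (y + (n + N + 1 : ℂ)⁻¹ • v) - f y)
  have hne : ∀ n : ℕ, (n + N + 1 : ℂ) ≠ 0 := fun n => by
    exact_mod_cast (Nat.succ_ne_zero (n + N))
  refine differentiableAt_of_tendstoUniformlyOn (f := q) hr (fun n => ?_) ?_
  · have h0 : DifferentiableOn ℂ f (ball x r) := hf.mono
      (fun y hy => (hsub y hy (mem_ball_self hr)).1)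
    refine DifferentiableOn.const_smul (DifferentiableOn.sub ?_ h0) _
    refine hf.comp (differentiable_id.add_const _).differentiableOn fun y hy => ?_
    refine (hsub y hy ?_).1
    rw [mem_ball, dist_eq_norm]
    simpa using hsmall n
  · rw [Metric.tendstoUniformlyOn_iff]
    intro ε hε
    obtain ⟨M, hM⟩ : ∃ M : ℕ, 4 * C * ‖v‖ ^ 2 / r ^ 2 / ε < M := exists_nat_gt _
    filter_upwards [eventually_ge_atTop M] with n hn y hy
    have hb := norm_sub_sub_fderiv_le (C := C) hr (hf.mono fun z hz => (hsub y hy hz).1)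
      (fun z hz => (hsub y hy hz).2) (y := y + (n + N + 1 : ℂ)⁻¹ • v)
      (by rw [mem_ball, dist_eq_norm]; simpa using hsmall n)
    rw [add_sub_cancel_left, map_smul] at hb
    have h1 : ‖(n + N + 1 : ℂ)‖ = n + N + 1 := by
      have : (n + N + 1 : ℂ) = ((n + N + 1 : ℕ) : ℂ) := by push_cast; ring
      rw [this, Complex.norm_natCast]; push_cast; ring
    have h2 : q n y - fderiv ℂ f y v = (n + N + 1 : ℂ) •
        (f (y + (n + N + 1 : ℂ)⁻¹ • v) - f y - (n + N + 1 : ℂ)⁻¹ • fderiv ℂ f y v) := by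
      rw [smul_sub, smul_inv_smul₀ (hne n)]
    rw [dist_comm, dist_eq_norm, h2, norm_smul, h1]
    rw [norm_smul, norm_inv, h1] at hb
    have hpos : (0 : ℝ) < n + N + 1 := by positivity
    have hMn : (M : ℝ) ≤ n := by exact_mod_cast hn
    calc ((n : ℝ) + N + 1) * _ ≤ (n + N + 1) * (4 * C * ((n + N + 1 : ℝ)⁻¹ * ‖v‖ / r) ^ 2) := by
          gcongr
      _ = 4 * C * ‖v‖ ^ 2 / r ^ 2 / (n + N + 1) := by field_simp
      _ < ε := by
          rw [div_lt_iff₀ hε] at hM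
          rw [div_lt_iff₀ hpos]
          nlinarith [(Nat.cast_nonneg N : (0 : ℝ) ≤ N)]

/-- Holomorphic maps on finite-dimensional spaces are smooth. -/
theorem contDiffOn_of_differentiableOn [FiniteDimensional ℂ E] [CompleteSpace F] {f : E → F}
    {U : Set E} (hU : IsOpen U) (hf : DifferentiableOn ℂ f U) (n : ℕ) : ContDiffOn ℂ n f U := by
  induction n generalizing f with
  | zero => exact contDiffOn_zero.2 hf.continuousOn
  | succ n ih =>
    rw [show ((n + 1 : ℕ) : WithTop ℕ∞) = (n : WithTop ℕ∞) + 1 by push_cast; rfl,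
      contDiffOn_succ_iff_fderiv_of_isOpen hU]
    refine ⟨hf, fun h => absurd h (by simp), ?_⟩
    rw [contDiffOn_clm_apply]
    exact fun v => ih (differentiableOn_fderiv_apply hU hf v)

/-- Taylor's formula in one complex variable, with a uniform bound of the remainder. -/
theorem norm_sub_taylor_le [CompleteSpace F] {h : ℂ → F} {R M : ℝ} (hR : 0 < R) (n : ℕ)
    (hd : DifferentiableOn ℂ h (ball 0 R)) (hM : ∀ s ∈ ball (0 : ℂ) R, ‖h s -
      ∑ j ∈ Finset.range (n + 1), s ^ j • ((j.factorial : ℂ)⁻¹ • iteratedDeriv j h 0)‖ ≤ M)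
    {s : ℂ} (hs : s ∈ ball (0 : ℂ) R) :
    ‖h s - ∑ j ∈ Finset.range (n + 1), s ^ j • ((j.factorial : ℂ)⁻¹ • iteratedDeriv j h 0)‖
      ≤ M * (‖s‖ / R) ^ (n + 1) := by
  set g : ℂ → F := fun s => h s -
    ∑ j ∈ Finset.range (n + 1), s ^ j • ((j.factorial : ℂ)⁻¹ • iteratedDeriv j h 0) with hg
  obtain ⟨p, hp⟩ := hd.analyticAt (ball_mem_nhds 0 hR)
  have hbig : g =O[𝓝 0] fun s => ‖s‖ ^ (n + 1) := by
    have := hp.isBigO_sub_partialSum_pow (n + 1)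
    refine this.congr_left fun s => ?_
    obtain ⟨r, hr⟩ := hp
    simp only [hg, zero_add, FormalMultilinearSeries.partialSum]
    congr 1
    refine Finset.sum_congr rfl fun j _ => ?_
    have h3 := hr.factorial_smul s j
    rw [iteratedFDeriv_apply_eq_iteratedDeriv_mul_prod] at h3
    rw [Finset.prod_const, Finset.card_univ, Fintype.card_fin] at h3
    rw [smul_comm, ← h3, ← Nat.cast_smul_eq_nsmul ℂ, inv_smul_smul₀]
    exact_mod_cast j.factorial_ne_zero
  have hg0 : g 0 = 0 := by
    have := hbig.eq_zero_imp
    have h4 := this.self_of_nhds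
    exact h4 (by simp)
  have ho : (g · - g 0) =o[𝓝 0] (fun w ↦ ‖w - 0‖ ^ n) := by
    simp only [hg0, sub_zero]
    refine hbig.trans_isLittleO ?_
    have : (fun w : ℂ => ‖w‖ ^ (n + 1)) = fun w => ‖w‖ * ‖w‖ ^ n := by ext; ring
    rw [this]
    have h5 : (fun w : ℂ => ‖w‖) =o[𝓝 0] fun _ => (1 : ℝ) := by
      rw [Asymptotics.isLittleO_one_iff]; simpa using (continuous_norm (E := ℂ)).tendsto 0
    simpa using h5.mul_isBigO (Asymptotics.isBigO_refl (fun w : ℂ => ‖w‖ ^ n) (𝓝 0))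
  have hgd : DifferentiableOn ℂ g (ball 0 R) := by
    refine hd.sub ?_
    exact (Differentiable.fun_sum fun j _ => (differentiable_id.pow j).smul_const _).differentiableOn
  have := Complex.dist_le_mul_div_pow_of_mapsTo_ball_of_isLittleO hgd
    (fun z hz => by rw [hg0, mem_closedBall_zero_iff]; exact hM z hz) ho hs
  simpa [hg0] using this

/-- Links the one-variable Taylor coefficients along a complex line to the homogeneous parts of the
map. -/
theorem iteratedDeriv_comp_smul_eq [FiniteDimensional ℂ E] [CompleteSpace F] {f : E → F} {U : Set E}
    (hU : IsOpen U) (hf : DifferentiableOn ℂ f U) (v : E) (n : ℕ) {s : ℂ} (hs : s • v ∈ U) :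
    iteratedDeriv n (fun s : ℂ => f (s • v)) s = iteratedFDeriv ℂ n f (s • v) fun _ => v := by
  induction n generalizing s with
  | zero => simp
  | succ n ih =>
    rw [iteratedDeriv_succ]
    have hev : iteratedDeriv n (fun s : ℂ => f (s • v)) =ᶠ[𝓝 s]
        fun s => iteratedFDeriv ℂ n f (0 + s • v) fun _ => v := by
      have hc : Continuous fun s : ℂ => s • v := continuous_id.smul continuous_const
      filter_upwards [hc.continuousAt.preimage_mem_nhds (hU.mem_nhds hs)] with z hz
      rw [zero_add]
      exact ih hz
    rw [hev.deriv_eq, ContDiffAt.deriv_fderiv_add_smul, zero_add]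
    rw [zero_add]
    exact_mod_cast (contDiffOn_of_differentiableOn hU hf (n + 1)).contDiffAt (hU.mem_nhds hs)

end ParabolicManifolds
end
-- The step t ↦ t + e^{-t}(1 + c) on half strips, and the comparison sequence for slow contraction.
noncomputable section
namespace ParabolicManifolds
open Metric Set

/-- The half strip `Re t > T`, `|Im t| < θ`. -/
def strip (T θ : ℝ) : Set ℂ := {t | T < t.re ∧ |t.im| < θ}

theorem isOpen_strip (T θ : ℝ) : IsOpen (strip T θ) :=
  (isOpen_lt continuous_const Complex.continuous_re).inter
    (isOpen_lt Complex.continuous_im.abs continuous_const)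

theorem convex_strip (T θ : ℝ) : Convex ℝ (strip T θ) := by
  intro x hx y hy s t hs ht hst
  have h1 : s * T + t * T < s * x.re + t * y.re := by
    rcases hs.eq_or_lt with rfl | hs'
    · have : t = 1 := by linarith
      subst this
      linarith [hy.1]
    · nlinarith [mul_lt_mul_of_pos_left hx.1 hs', mul_le_mul_of_nonneg_left hy.1.le ht]
  have h2 : s * |x.im| + t * |y.im| < s * θ + t * θ := by
    rcases hs.eq_or_lt with rfl | hs'
    · have : t = 1 := by linarith
      subst this
      linarith [hy.2]
    · nlinarith [mul_lt_mul_of_pos_left hx.2 hs', mul_le_mul_of_nonneg_left hy.2.le ht]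
  rw [← add_mul, hst, one_mul] at h1 h2
  refine ⟨by simpa using h1, lt_of_le_of_lt ?_ h2⟩
  have h3 := abs_add_le (s * x.im) (t * y.im)
  rw [abs_mul, abs_mul, abs_of_nonneg hs, abs_of_nonneg ht] at h3
  simpa using h3

theorem strip_subset_strip {T T' θ θ' : ℝ} (hT : T ≤ T') (hθ : θ' ≤ θ) :
    strip T' θ' ⊆ strip T θ := fun _ ht => ⟨hT.trans_lt ht.1, ht.2.trans_le hθ⟩

theorem norm_exp_neg (t : ℂ) : ‖Complex.exp (-t)‖ = Real.exp (-t.re) := by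
  simp [Complex.norm_exp]

theorem norm_exp_neg_sub_le {t t' : ℂ} (h : t.re ≤ t'.re) :
    ‖Complex.exp (-t) - Complex.exp (-t')‖ ≤ ‖Complex.exp (-t)‖ * ‖t - t'‖ := by
  have hc : Convex ℝ {z : ℂ | t.re ≤ z.re} := convex_halfSpace_re_ge t.re
  refine hc.norm_image_sub_le_of_norm_hasDerivWithin_le (f := fun z => Complex.exp (-z))
    (f' := fun z => Complex.exp (-z) * (-1)) (fun z _ => ?_) (fun z hz => ?_) h
    (show t.re ≤ t.re from le_rfl)
  · exact ((hasDerivAt_neg z).cexp).hasDerivWithinAt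
  · rw [norm_mul, norm_neg, norm_one, mul_one, norm_exp_neg, norm_exp_neg]
    exact Real.exp_le_exp.2 (neg_le_neg hz)

theorem re_exp_neg (t : ℂ) : (Complex.exp (-t)).re = Real.exp (-t.re) * Real.cos t.im := by
  simp [Complex.exp_re]

theorem im_exp_neg (t : ℂ) : (Complex.exp (-t)).im = -(Real.exp (-t.re) * Real.sin t.im) := by
  simp [Complex.exp_im]

theorem half_le_cos {y : ℝ} (hy : |y| ≤ 1) : 1 / 2 ≤ Real.cos y := by
  have h := Real.one_sub_sq_div_two_le_cos (x := y)
  have : y ^ 2 ≤ 1 := by rw [← sq_abs]; exact pow_le_one₀ (abs_nonneg _) hy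
  linarith

/-- The derivative 1 - e^{-z} has squared modulus 1 - 2e cos(Im z) + e² with e = e^{-Re z} ≤ 1, and
this is at most 1 because cos(Im z) ≥ 1/2. Having constant exactly 1 matters: no growth in the time
direction has to be compensated when Lipschitz bounds are propagated. -/
theorem norm_add_exp_neg_sub_le {T θ : ℝ} (hT : Real.exp (-T) ≤ 1) (hθ : θ ≤ 1) {t t' : ℂ}
    (ht : t ∈ strip T θ) (ht' : t' ∈ strip T θ) :
    ‖(t + Complex.exp (-t)) - (t' + Complex.exp (-t'))‖ ≤ ‖t - t'‖ := by
  have := (convex_strip T θ).norm_image_sub_le_of_norm_hasDerivWithin_le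
    (f := fun z => z + Complex.exp (-z)) (f' := fun z => 1 + Complex.exp (-z) * (-1)) (C := 1)
    (fun z _ => ((hasDerivAt_id z).add ((hasDerivAt_neg z).cexp)).hasDerivWithinAt)
    (fun z hz => ?_) ht' ht
  · simpa using this
  · have h1 := half_le_cos (hz.2.le.trans hθ)
    have h2 : Real.exp (-z.re) ≤ 1 :=
      (Real.exp_le_exp.2 (neg_le_neg hz.1.le)).trans hT
    have h0 := Real.exp_pos (-z.re)
    refine (sq_le_sq₀ (norm_nonneg _) zero_le_one).1 ?_
    rw [← Complex.normSq_eq_norm_sq, Complex.normSq_apply]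
    simp only [Complex.add_re, Complex.add_im, Complex.mul_re, Complex.mul_im, re_exp_neg,
      im_exp_neg, Complex.one_re, Complex.one_im, Complex.neg_re, Complex.neg_im]
    have h3 := Real.sin_sq_add_cos_sq z.im
    set e := Real.exp (-z.re)
    have h4 : (e * Real.cos z.im) ^ 2 + (e * Real.sin z.im) ^ 2 = e ^ 2 := by
      rw [mul_pow, mul_pow, ← mul_add, add_comm (Real.cos z.im ^ 2), h3, mul_one]
    nlinarith [mul_le_mul_of_nonneg_left h1 h0.le, mul_le_mul_of_nonneg_left h2 h0.le]

theorem sin_bound {y : ℝ} (h0 : 0 ≤ y) (h1 : y ≤ 1) : y / 2 ≤ Real.sin y ∧ Real.sin y ≤ y := by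
  refine ⟨?_, Real.sin_le h0⟩
  have := Real.mul_le_sin h0 (by linarith [Real.pi_gt_three])
  have hpi : 1 / 2 ≤ 2 / Real.pi := by
    rw [div_le_div_iff₀ (by norm_num) Real.pi_pos]; linarith [Real.pi_le_four]
  nlinarith

theorem abs_sub_mul_sin_le {y τ : ℝ} (hy : |y| ≤ 1) (h0 : 0 ≤ τ) (h1 : τ ≤ 1) :
    |y - τ * Real.sin y| ≤ |y| * (1 - τ / 2) := by
  rcases le_total 0 y with h | h
  · rw [abs_of_nonneg h] at *
    obtain ⟨h2, h3⟩ := sin_bound h hy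
    rw [abs_of_nonneg (by nlinarith)]
    nlinarith
  · rw [abs_of_nonpos h] at *
    obtain ⟨h2, h3⟩ := sin_bound (y := -y) (by linarith) hy
    rw [Real.sin_neg] at h2 h3
    rw [abs_of_nonpos (by nlinarith)]
    nlinarith

theorem re_step_ge {T θ κ : ℝ} (hθ1 : θ ≤ 1) (hκ : κ ≤ θ / 4) {t c : ℂ}
    (ht : t ∈ strip T θ) (hc : ‖c‖ ≤ κ) :
    t.re + Real.exp (-t.re) / 4 ≤ (t + Complex.exp (-t) * (1 + c)).re := by
  have h1 := half_le_cos (ht.2.le.trans hθ1)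
  have h2 : |(Complex.exp (-t) * c).re| ≤ Real.exp (-t.re) * κ := by
    refine (Complex.abs_re_le_norm _).trans ?_
    rw [norm_mul, norm_exp_neg]
    gcongr
  have h0 := Real.exp_pos (-t.re)
  rw [mul_add, mul_one, Complex.add_re, Complex.add_re, re_exp_neg]
  have := neg_abs_le (Complex.exp (-t) * c).re
  nlinarith

/-- The imaginary part moves by -τ sin(Im t), τ = e^{-Re t}, which shrinks it by the factor 1 - τ/2;
the perturbation adds at most κτ ≤ θτ/4. -/
theorem step_mem_strip {T θ κ : ℝ} (hT : Real.exp (-T) ≤ 1) (hθ0 : 0 < θ) (hθ1 : θ ≤ 1)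
    (hκ : κ ≤ θ / 4) {t c : ℂ} (ht : t ∈ strip T θ) (hc : ‖c‖ ≤ κ) :
    t + Complex.exp (-t) * (1 + c) ∈ strip T θ := by
  have h0 := Real.exp_pos (-t.re)
  refine ⟨ht.1.trans_le (by linarith [re_step_ge hθ1 hκ ht hc]), ?_⟩
  have h2 : |(Complex.exp (-t) * c).im| ≤ Real.exp (-t.re) * κ := by
    refine (Complex.abs_im_le_norm _).trans ?_
    rw [norm_mul, norm_exp_neg]
    gcongr
  have hτ : Real.exp (-t.re) ≤ 1 := (Real.exp_le_exp.2 (neg_le_neg ht.1.le)).trans hT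
  have h3 := abs_sub_mul_sin_le (ht.2.le.trans hθ1) h0.le hτ
  rw [mul_add, mul_one, Complex.add_im, Complex.add_im, im_exp_neg, ← add_assoc, ← sub_eq_add_neg]
  refine (abs_add_le _ _).trans_lt ?_
  have h4 := ht.2
  have : |t.im| * (1 - Real.exp (-t.re) / 2) < θ * (1 - Real.exp (-t.re) / 2) :=
    mul_lt_mul_of_pos_right h4 (by linarith)
  nlinarith

/-- In the variable e^{Re t} the step is nearly a translation by 1. The bound by 2 keeps orbits from
escaping too fast for the accumulated contraction to reach 0. -/
theorem norm_exp_step_le {T θ κ : ℝ} (hT : Real.exp (-T) ≤ 1 / 4) (hθ1 : θ ≤ 1)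
    (hκ : κ ≤ θ / 4) {t c : ℂ} (ht : t ∈ strip T θ) (hc : ‖c‖ ≤ κ) :
    Real.exp (t + Complex.exp (-t) * (1 + c)).re ≤ Real.exp t.re + 2 := by
  have h0 := Real.exp_pos (-t.re)
  have hτ : Real.exp (-t.re) ≤ 1 / 4 := (Real.exp_le_exp.2 (neg_le_neg ht.1.le)).trans hT
  have h1 : (Complex.exp (-t) * (1 + c)).re ≤ Real.exp (-t.re) * (5 / 4) := by
    refine (Complex.re_le_norm _).trans ?_
    rw [norm_mul, norm_exp_neg]
    have := norm_add_le 1 c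
    rw [norm_one] at this
    gcongr
    linarith
  have h2 : Real.exp (Real.exp (-t.re) * (5 / 4)) ≤ 1 + 2 * Real.exp (-t.re) := by
    have := Real.abs_exp_sub_one_sub_id_le (x := Real.exp (-t.re) * (5 / 4))
      (by rw [abs_of_pos (by positivity)]; linarith)
    have := (abs_le.1 this).2
    nlinarith
  rw [Complex.add_re, Real.exp_add]
  have h3 : Real.exp t.re * Real.exp (-t.re) = 1 := by rw [← Real.exp_add]; simp
  have h4 := Real.exp_le_exp.2 h1
  have h5 := Real.exp_pos t.re
  nlinarith [mul_le_mul_of_nonneg_left (h4.trans h2) h5.le]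

/-- A comparison sequence, decreasing to `0`, for the rate of contraction along orbits. -/
def decay (q : ℝ) (n : ℕ) (x : ℝ) : ℝ := (x / (x + 2 * n)) ^ q

theorem decay_zero (q : ℝ) {x : ℝ} (hx : 0 < x) : decay q 0 x = 1 := by
  simp [decay, div_self hx.ne']

theorem decay_nonneg (q : ℝ) (n : ℕ) {x : ℝ} (hx : 0 < x) : 0 ≤ decay q n x :=
  Real.rpow_nonneg (by positivity) q

theorem decay_mono {q : ℝ} (hq : 0 ≤ q) (n : ℕ) {x y : ℝ} (hx : 0 < x) (hxy : x ≤ y) :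
    decay q n x ≤ decay q n y := by
  have hy : 0 < y := hx.trans_le hxy
  refine Real.rpow_le_rpow (by positivity) ?_ hq
  rw [div_le_div_iff₀ (by positivity) (by positivity)]
  have : (0 : ℝ) ≤ 2 * n := by positivity
  nlinarith

/-- The base of the power at (n, x + 2) is exactly 1 + 2/x times the base at (n + 1, x); Bernoulli's
inequality for the exponent q ≤ 1 bounds the q-th power of that factor. -/
theorem decay_add_two_le {q : ℝ} (hq0 : 0 ≤ q) (hq1 : q ≤ 1) (n : ℕ) {x : ℝ} (hx : 0 < x) :
    decay q n (x + 2) ≤ (1 + 2 * q * x⁻¹) * decay q (n + 1) x := by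
  have h1 : (x + 2) / (x + 2 + 2 * n) = (1 + 2 * x⁻¹) * (x / (x + 2 * ((n + 1 : ℕ) : ℝ))) := by
    push_cast
    field_simp
    ring
  rw [decay, h1, Real.mul_rpow (by positivity) (by positivity)]
  refine mul_le_mul_of_nonneg_right ?_ (decay_nonneg q (n + 1) hx)
  have := rpow_one_add_le_one_add_mul_self (s := 2 * x⁻¹) (by
    have : 0 ≤ 2 * x⁻¹ := by positivity
    linarith) hq0 hq1
  linarith

theorem tendsto_decay {q : ℝ} (hq : 0 < q) (x : ℝ) :
    Tendsto (fun n => decay q n x) atTop (𝓝 0) := by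
  have h1 : Tendsto (fun n : ℕ => x / (x + 2 * (n : ℝ))) atTop (𝓝 0) := by
    refine Tendsto.const_div_atTop ?_ _
    exact tendsto_atTop_add_const_left _ _
      (Tendsto.const_mul_atTop (by norm_num) tendsto_natCast_atTop_atTop)
  have := h1.rpow_const (p := q) (Or.inr hq.le)
  rwa [Real.zero_rpow hq.ne'] at this

/-- One step of contraction. -/
theorem le_decay_succ {μ q τ x y M e : ℝ} {n : ℕ} (hq0 : 0 ≤ q) (hq1 : q ≤ 1)
    (hqμ : 2 * q ≤ μ) (hx : 0 < x) (hτ : τ = x⁻¹) (hy0 : 0 < y) (hy : y ≤ x + 2) (hM : 0 ≤ M)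
    (he : (1 + μ * τ) * e ≤ M * decay q n y) : e ≤ M * decay q (n + 1) x := by
  have h1 := (decay_mono hq0 n hy0 hy).trans (decay_add_two_le hq0 hq1 n hx)
  have h2 := mul_le_mul_of_nonneg_left h1 hM
  have h3 := decay_nonneg q (n + 1) hx
  have hτ0 : 0 < τ := hτ ▸ inv_pos.2 hx
  rw [← hτ] at h2
  have h4 : (1 + μ * τ) * e ≤ (1 + μ * τ) * (M * decay q (n + 1) x) := by
    refine (he.trans h2).trans ?_
    have : (1 + 2 * q * τ) ≤ 1 + μ * τ := by nlinarith
    calc _ = (1 + 2 * q * τ) * (M * decay q (n + 1) x) := by ring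
      _ ≤ _ := mul_le_mul_of_nonneg_right this (by positivity)
  exact le_of_mul_le_mul_left h4 (by nlinarith)

end ParabolicManifolds
end
-- Hyperbolic slow systems and the graph transform.
noncomputable section
namespace ParabolicManifolds
open Metric Set

section Step

variable {E : Type*} [NormedAddCommGroup E] [NormedSpace ℂ E]

/-- The map `(t, u) ↦ (t + e^{-t} (1 + a), u - e^{-t} (B u + b))`. -/
def slowStep (B : E →L[ℂ] E) (a : ℂ × E → ℂ) (b : ℂ × E → E) (p : ℂ × E) : ℂ × E :=
  (p.1 + Complex.exp (-p.1) * (1 + a p), p.2 - Complex.exp (-p.1) • (B p.2 + b p))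

end Step

section Graph

variable {Es Ec : Type*} [NormedAddCommGroup Es] [NormedSpace ℂ Es]
  [NormedAddCommGroup Ec] [NormedSpace ℂ Ec]

/-- A hyperbolic slow system: `Bs` is contracted, `Bc` is expanded. -/
structure HyperbolicSystem (T θ η κ μ ρ N : ℝ) (Bs : Es →L[ℂ] Es) (Bc : Ec →L[ℂ] Ec)
    (a : ℂ × (Es × Ec) → ℂ) (b : ℂ × (Es × Ec) → Es × Ec) : Prop where
  exp_T : Real.exp (-T) ≤ 1 / 4
  exp_T_mul : Real.exp (-T) * N < 1
  θ_pos : 0 < θ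
  θ_le : θ ≤ 1
  η_nonneg : 0 ≤ η
  κ_nonneg : 0 ≤ κ
  κ_le_θ : κ ≤ θ / 4
  κ_le_μ : κ ≤ μ / 8
  κ_le_ρ : κ ≤ μ * ρ / 4
  μ_pos : 0 < μ
  μ_le : μ ≤ 1
  ρ_pos : 0 < ρ
  norm_Bs : ‖Bs‖ ≤ N
  norm_Bc : ‖Bc‖ ≤ N
  small : 2 * N * ρ + 4 * κ ≤ μ
  diff_a : DifferentiableOn ℂ a (strip T θ ×ˢ ball 0 ρ)
  diff_b : DifferentiableOn ℂ b (strip T θ ×ˢ ball 0 ρ)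
  bound_a : ∀ p ∈ strip T θ ×ˢ ball 0 ρ, ‖a p‖ ≤ κ
  bound_b : ∀ p ∈ strip T θ ×ˢ ball 0 ρ, ‖b p‖ ≤ κ * Real.exp (-η * (p.1.re - T))
  lip_a : ∀ p ∈ strip T θ ×ˢ ball 0 ρ, ∀ q ∈ strip T θ ×ˢ ball 0 ρ, ‖a p - a q‖ ≤ κ * ‖p - q‖
  lip_b : ∀ p ∈ strip T θ ×ˢ ball 0 ρ, ∀ q ∈ strip T θ ×ˢ ball 0 ρ, ‖b p - b q‖ ≤ κ * ‖p - q‖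
  contract : ∀ t ∈ strip T θ, ∀ w,
    ‖w - Complex.exp (-t) • Bs w‖ ≤ (1 - μ * Real.exp (-t.re)) * ‖w‖
  expand : ∀ t ∈ strip T θ, ∀ v,
    (1 + μ * Real.exp (-t.re)) * ‖v‖ ≤ ‖v - Complex.exp (-t) • Bc v‖

/-- Lift of a base point to the graph of `g`. -/
def graphPoint (g : ℂ × Es → Ec) (p : ℂ × Es) : ℂ × (Es × Ec) := (p.1, (p.2, g p))

/-- The candidates for the graph. -/
structure IsAdmissible (T θ η ρ : ℝ) (g : ℂ × Es → Ec) : Prop where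
  diff : DifferentiableOn ℂ g (strip T θ ×ˢ ball 0 ρ)
  bound : ∀ p ∈ strip T θ ×ˢ ball 0 ρ, ‖g p‖ ≤ ρ / 2 * Real.exp (-η * (p.1.re - T))
  lip : ∀ p ∈ strip T θ ×ˢ ball 0 ρ, ∀ q ∈ strip T θ ×ˢ ball 0 ρ, ‖g p - g q‖ ≤ ‖p - q‖

/-- The base component of the image of a point of the graph. -/
def baseStep (Bs : Es →L[ℂ] Es) (Bc : Ec →L[ℂ] Ec) (a : ℂ × (Es × Ec) → ℂ)
    (b : ℂ × (Es × Ec) → Es × Ec) (P : ℂ × (Es × Ec)) : ℂ × Es :=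
  ((slowStep (Bs.prodMap Bc) a b P).1, (slowStep (Bs.prodMap Bc) a b P).2.1)

/-- The graph transform. -/
def graphTransform (Bs : Es →L[ℂ] Es) (Bc : Ec →L[ℂ] Ec) (a : ℂ × (Es × Ec) → ℂ)
    (b : ℂ × (Es × Ec) → Es × Ec) (g : ℂ × Es → Ec) (p : ℂ × Es) : Ec :=
  Ring.inverse (1 - Complex.exp (-p.1) • Bc)
    (g (baseStep Bs Bc a b (graphPoint g p)) + Complex.exp (-p.1) • (b (graphPoint g p)).2)

namespace HyperbolicSystem

variable {T θ η κ μ ρ N : ℝ} {Bs : Es →L[ℂ] Es} {Bc : Ec →L[ℂ] Ec}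
  {a : ℂ × (Es × Ec) → ℂ} {b : ℂ × (Es × Ec) → Es × Ec}

theorem exp_le (H : HyperbolicSystem T θ η κ μ ρ N Bs Bc a b) {t : ℂ} (ht : t ∈ strip T θ) :
    Real.exp (-t.re) ≤ 1 / 4 :=
  (Real.exp_le_exp.2 (neg_le_neg ht.1.le)).trans H.exp_T

theorem bound_b' (H : HyperbolicSystem T θ η κ μ ρ N Bs Bc a b) {p : ℂ × (Es × Ec)}
    (hp : p ∈ strip T θ ×ˢ ball 0 ρ) : ‖b p‖ ≤ κ := by
  refine (H.bound_b p hp).trans ?_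
  have : Real.exp (-η * (p.1.re - T)) ≤ 1 := by
    rw [Real.exp_le_one_iff]
    nlinarith [H.η_nonneg, hp.1.1]
  nlinarith [H.κ_nonneg]

theorem decay_le_one (H : HyperbolicSystem T θ η κ μ ρ N Bs Bc a b) {t : ℂ}
    (ht : t ∈ strip T θ) : Real.exp (-η * (t.re - T)) ≤ 1 := by
  rw [Real.exp_le_one_iff]
  nlinarith [H.η_nonneg, ht.1]

theorem graphPoint_mem (H : HyperbolicSystem T θ η κ μ ρ N Bs Bc a b) {g : ℂ × Es → Ec}
    (hg : IsAdmissible T θ η ρ g) {p : ℂ × Es} (hp : p ∈ strip T θ ×ˢ ball 0 ρ) :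
    graphPoint g p ∈ strip T θ ×ˢ ball (0 : Es × Ec) ρ := by
  refine ⟨hp.1, ?_⟩
  rw [mem_ball_zero_iff]
  have h1 := hg.bound p hp
  have h2 := H.decay_le_one hp.1
  have h3 := H.ρ_pos
  have h4 : ‖g p‖ < ρ := by nlinarith
  exact max_lt (mem_ball_zero_iff.1 hp.2) h4

theorem norm_graphPoint_sub_le (_H : HyperbolicSystem T θ η κ μ ρ N Bs Bc a b)
    {g : ℂ × Es → Ec} (hg : IsAdmissible T θ η ρ g) {p q : ℂ × Es}
    (hp : p ∈ strip T θ ×ˢ ball 0 ρ) (hq : q ∈ strip T θ ×ˢ ball 0 ρ) :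
    ‖graphPoint g p - graphPoint g q‖ ≤ ‖p - q‖ :=
  max_le (norm_fst_le (p - q)) (max_le (norm_snd_le (p - q)) (hg.lip p hp q hq))

/-- Smaller strips and balls are invariant in the base. -/
theorem baseStep_mem (H : HyperbolicSystem T θ η κ μ ρ N Bs Bc a b) {T' ρ' : ℝ} (hT : T ≤ T')
    (hρ' : ρ / 2 ≤ ρ') {P : ℂ × (Es × Ec)} (hP : P ∈ strip T θ ×ˢ ball 0 ρ)
    (h1 : P.1 ∈ strip T' θ) (h2 : P.2.1 ∈ ball 0 ρ') :
    baseStep Bs Bc a b P ∈ strip T' θ ×ˢ ball (0 : Es) ρ' := by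
  have hT' : Real.exp (-T') ≤ 1 :=
    (Real.exp_le_exp.2 (neg_le_neg hT)).trans (H.exp_T.trans (by norm_num))
  refine ⟨step_mem_strip hT' H.θ_pos H.θ_le H.κ_le_θ h1 (H.bound_a P hP), ?_⟩
  rw [mem_ball_zero_iff] at h2 ⊢
  have h3 : (baseStep Bs Bc a b P).2 = (P.2.1 - Complex.exp (-P.1) • Bs P.2.1)
      - Complex.exp (-P.1) • (b P).1 := by
    simp [baseStep, slowStep, smul_add, sub_sub]
  rw [h3]
  refine (norm_sub_le _ _).trans_lt ?_
  have h4 := H.contract P.1 hP.1 P.2.1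
  have h5 : ‖Complex.exp (-P.1) • (b P).1‖ ≤ Real.exp (-P.1.re) * κ := by
    rw [norm_smul, norm_exp_neg]
    gcongr
    exact (norm_fst_le _).trans (H.bound_b' hP)
  have h6 := H.exp_le hP.1
  have h7 := Real.exp_pos (-P.1.re)
  have h8 : (1 - μ * Real.exp (-P.1.re)) * ‖P.2.1‖ < (1 - μ * Real.exp (-P.1.re)) * ρ' :=
    mul_lt_mul_of_pos_left h2 (by nlinarith [H.μ_pos, H.μ_le])
  have h9 : κ ≤ μ * ρ' := by nlinarith [H.κ_le_ρ, H.μ_pos, H.ρ_pos]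
  nlinarith

theorem norm_baseStep_sub_le_of_fst_eq (H : HyperbolicSystem T θ η κ μ ρ N Bs Bc a b)
    {t : ℂ} {w : Es} {v v' : Ec} (hP : (t, (w, v)) ∈ strip T θ ×ˢ ball (0 : Es × Ec) ρ)
    (hQ : (t, (w, v')) ∈ strip T θ ×ˢ ball (0 : Es × Ec) ρ) :
    ‖baseStep Bs Bc a b (t, (w, v)) - baseStep Bs Bc a b (t, (w, v'))‖
      ≤ Real.exp (-t.re) * κ * ‖v - v'‖ := by
  have hn : ‖((t, (w, v)) : ℂ × (Es × Ec)) - (t, (w, v'))‖ = ‖v - v'‖ := by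
    simp [Prod.norm_def]
  have ha := H.lip_a _ hP _ hQ
  have hb := H.lip_b _ hP _ hQ
  rw [hn] at ha hb
  have h0 := Real.exp_pos (-t.re)
  refine max_le ?_ ?_
  · have : (baseStep Bs Bc a b (t, (w, v)) - baseStep Bs Bc a b (t, (w, v'))).1 =
        Complex.exp (-t) * (a (t, (w, v)) - a (t, (w, v'))) := by
      simp [baseStep, slowStep]; ring
    rw [this, norm_mul, norm_exp_neg, mul_assoc]
    gcongr
  · have : (baseStep Bs Bc a b (t, (w, v)) - baseStep Bs Bc a b (t, (w, v'))).2 =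
        - (Complex.exp (-t) • (b (t, (w, v)) - b (t, (w, v'))).1) := by
      simp only [baseStep, slowStep, Prod.snd_sub, Prod.fst_sub, Prod.smul_fst, Prod.fst_add,
        ContinuousLinearMap.coe_prodMap', Prod.map, smul_add, smul_sub]
      abel
    rw [this, norm_neg, norm_smul, norm_exp_neg, mul_assoc]
    gcongr
    exact (norm_fst_le _).trans hb

/-- Applied to f = a and f = b. The hypothesis Re P ≤ Re Q makes e^{-Re P} the larger of the two
factors, so one of the two κ is the Lipschitz bound of f and the other pays for the variation of
e^{-t}. -/
theorem norm_smul_sub_smul_le (H : HyperbolicSystem T θ η κ μ ρ N Bs Bc a b)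
    {X : Type*} [NormedAddCommGroup X] [NormedSpace ℂ X] {f : ℂ × (Es × Ec) → X}
    (hf : ∀ p ∈ strip T θ ×ˢ ball 0 ρ, ‖f p‖ ≤ κ)
    (hl : ∀ p ∈ strip T θ ×ˢ ball 0 ρ, ∀ q ∈ strip T θ ×ˢ ball 0 ρ, ‖f p - f q‖ ≤ κ * ‖p - q‖)
    {P Q : ℂ × (Es × Ec)} (hP : P ∈ strip T θ ×ˢ ball 0 ρ) (hQ : Q ∈ strip T θ ×ˢ ball 0 ρ)
    (hPQ : P.1.re ≤ Q.1.re) {Δ : ℝ} (hΔ : ‖P - Q‖ ≤ Δ) :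
    ‖Complex.exp (-P.1) • f P - Complex.exp (-Q.1) • f Q‖
      ≤ Real.exp (-P.1.re) * (2 * κ * Δ) := by
  have h1 : Complex.exp (-P.1) • f P - Complex.exp (-Q.1) • f Q =
      Complex.exp (-P.1) • (f P - f Q) + (Complex.exp (-P.1) - Complex.exp (-Q.1)) • f Q := by
    rw [smul_sub, sub_smul]; abel
  have h2 := norm_exp_neg_sub_le hPQ
  rw [norm_exp_neg] at h2
  have h0 := Real.exp_pos (-P.1.re)
  have hκ := H.κ_nonneg
  have hΔ0 : 0 ≤ Δ := (norm_nonneg _).trans hΔ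
  rw [h1]
  refine (norm_add_le _ _).trans ?_
  rw [norm_smul, norm_smul, norm_exp_neg]
  have h3 : ‖P.1 - Q.1‖ ≤ Δ := (norm_fst_le (P - Q)).trans hΔ
  calc _ ≤ Real.exp (-P.1.re) * (κ * Δ) + Real.exp (-P.1.re) * Δ * κ := by
        gcongr
        · exact (hl P hP Q hQ).trans (by gcongr)
        · exact h2.trans (by gcongr)
        · exact hf Q hQ
    _ = _ := by ring

/-- The unperturbed base map does not expand, neither in t nor in the contracted variable at fixed
t. The excess consists of Nρ, from the variation of e^{-t} in e^{-t} Bs w with ‖w‖ < ρ, and 2κ from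
the perturbation. The condition 2Nρ + 4κ ≤ μ leaves room for this excess twice. -/
theorem norm_baseStep_sub_le (H : HyperbolicSystem T θ η κ μ ρ N Bs Bc a b)
    {P Q : ℂ × (Es × Ec)} (hP : P ∈ strip T θ ×ˢ ball 0 ρ) (hQ : Q ∈ strip T θ ×ˢ ball 0 ρ)
    (hPQ : P.1.re ≤ Q.1.re) {Δ : ℝ} (hΔ : ‖P - Q‖ ≤ Δ) :
    ‖baseStep Bs Bc a b P - baseStep Bs Bc a b Q‖
      ≤ Δ * (1 + Real.exp (-P.1.re) * (N * ρ + 2 * κ)) := by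
  have h0 := Real.exp_pos (-P.1.re)
  have hκ := H.κ_nonneg
  have hN : 0 ≤ N := (norm_nonneg _).trans H.norm_Bs
  have hρ := H.ρ_pos
  have hΔ0 : 0 ≤ Δ := (norm_nonneg _).trans hΔ
  have h3 : ‖P.1 - Q.1‖ ≤ Δ := (norm_fst_le (P - Q)).trans hΔ
  have h4 : ‖P.2.1 - Q.2.1‖ ≤ Δ :=
    ((norm_fst_le (P - Q).2).trans (norm_snd_le (P - Q))).trans hΔ
  refine max_le ?_ ?_
  · have h1 : (baseStep Bs Bc a b P - baseStep Bs Bc a b Q).1 =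
        ((P.1 + Complex.exp (-P.1)) - (Q.1 + Complex.exp (-Q.1))) +
        (Complex.exp (-P.1) • a P - Complex.exp (-Q.1) • a Q) := by
      simp [baseStep, slowStep]; ring
    rw [h1]
    refine (norm_add_le _ _).trans ?_
    have h5 := norm_add_exp_neg_sub_le (H.exp_T.trans (by norm_num)) H.θ_le hP.1 hQ.1
    have h6 := H.norm_smul_sub_smul_le H.bound_a H.lip_a hP hQ hPQ hΔ
    have : 0 ≤ Real.exp (-P.1.re) * (N * ρ) * Δ := by positivity
    nlinarith
  · have h1 : (baseStep Bs Bc a b P - baseStep Bs Bc a b Q).2 =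
        ((P.2.1 - Q.2.1) - Complex.exp (-P.1) • Bs (P.2.1 - Q.2.1)) -
        (Complex.exp (-P.1) - Complex.exp (-Q.1)) • Bs Q.2.1 -
        (Complex.exp (-P.1) • b P - Complex.exp (-Q.1) • b Q).1 := by
      simp only [baseStep, slowStep, Prod.snd_sub, Prod.fst_sub, Prod.smul_fst, Prod.fst_add,
        ContinuousLinearMap.coe_prodMap', Prod.map, smul_add, smul_sub, map_sub, sub_smul]
      abel
    rw [h1]
    refine (norm_sub_le _ _).trans ((add_le_add (norm_sub_le _ _) le_rfl).trans ?_)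
    have h5 := H.contract P.1 hP.1 (P.2.1 - Q.2.1)
    have h6 := (norm_fst_le _).trans
      (H.norm_smul_sub_smul_le (f := b) (fun p hp => H.bound_b' hp) H.lip_b hP hQ hPQ hΔ)
    have h7 : ‖(Complex.exp (-P.1) - Complex.exp (-Q.1)) • Bs Q.2.1‖ ≤
        Real.exp (-P.1.re) * Δ * (N * ρ) := by
      rw [norm_smul]
      have h8 := norm_exp_neg_sub_le hPQ
      rw [norm_exp_neg] at h8
      have h9 : ‖Bs Q.2.1‖ ≤ N * ρ := by
        refine (Bs.le_opNorm _).trans ?_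
        gcongr
        · exact H.norm_Bs
        · exact ((norm_fst_le Q.2).trans_lt (mem_ball_zero_iff.1 hQ.2)).le
      gcongr
      exact h8.trans (by gcongr)
    have h8 : (1 - μ * Real.exp (-P.1.re)) * ‖P.2.1 - Q.2.1‖ ≤ Δ := by
      have : 0 ≤ μ * Real.exp (-P.1.re) * ‖P.2.1 - Q.2.1‖ :=
        mul_nonneg (mul_nonneg H.μ_pos.le h0.le) (norm_nonneg _)
      linarith
    linarith

theorem isUnit (H : HyperbolicSystem T θ η κ μ ρ N Bs Bc a b) [CompleteSpace Ec] {t : ℂ}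
    (ht : t ∈ strip T θ) : IsUnit (1 - Complex.exp (-t) • Bc) := by
  refine isUnit_one_sub_of_norm_lt_one ?_
  rw [norm_smul, norm_exp_neg]
  refine lt_of_le_of_lt ?_ H.exp_T_mul
  have := Real.exp_le_exp.2 (neg_le_neg ht.1.le)
  gcongr
  exact H.norm_Bc

/-- Only the linear part of the fibre equation is inverted; the perturbation and the base point are
evaluated on the old graph. Hence no implicit equation for the new base point has to be solved, and
a fixed point is exactly an invariant graph (`slowStep_graphPoint`). -/
theorem graphTransform_spec (H : HyperbolicSystem T θ η κ μ ρ N Bs Bc a b) [CompleteSpace Ec]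
    (g : ℂ × Es → Ec) {p : ℂ × Es} (ht : p.1 ∈ strip T θ) :
    graphTransform Bs Bc a b g p - Complex.exp (-p.1) • Bc (graphTransform Bs Bc a b g p) =
      g (baseStep Bs Bc a b (graphPoint g p)) + Complex.exp (-p.1) • (b (graphPoint g p)).2 := by
  have h := Ring.mul_inverse_cancel _ (H.isUnit ht)
  have := congrArg (fun L : Ec →L[ℂ] Ec =>
    L (g (baseStep Bs Bc a b (graphPoint g p)) + Complex.exp (-p.1) • (b (graphPoint g p)).2)) h
  simpa [graphTransform] using this

/-- By the expansion, the left side of `graphTransform_spec` has norm at least (1 + μτ)‖G‖, τ =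
e^{-Re t}. This gain beats the term κτ in the size bound since κ ≤ μρ/4, and it beats the factor 1 +
τ(2Nρ + 4κ) that appears in the Lipschitz bound. -/
theorem isAdmissible_graphTransform (H : HyperbolicSystem T θ η κ μ ρ N Bs Bc a b)
    [CompleteSpace Ec] {g : ℂ × Es → Ec} (hg : IsAdmissible T θ η ρ g) :
    IsAdmissible T θ η ρ (graphTransform Bs Bc a b g) := by
  have hρ := H.ρ_pos
  have hκ := H.κ_nonneg
  have hN : 0 ≤ N := (norm_nonneg _).trans H.norm_Bs
  have hbase : ∀ p ∈ strip T θ ×ˢ ball (0 : Es) ρ,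
      baseStep Bs Bc a b (graphPoint g p) ∈ strip T θ ×ˢ ball (0 : Es) ρ := fun p hp =>
    H.baseStep_mem le_rfl (by linarith) (H.graphPoint_mem hg hp) hp.1 hp.2
  have hbound : ∀ p ∈ strip T θ ×ˢ ball 0 ρ, ‖graphTransform Bs Bc a b g p‖ ≤
      ρ / 2 * Real.exp (-η * (p.1.re - T)) := fun p hp => by
    have h1 := H.expand p.1 hp.1 (graphTransform Bs Bc a b g p)
    rw [H.graphTransform_spec g hp.1] at h1
    have hG := H.graphPoint_mem hg hp
    have h2 := hg.bound _ (hbase p hp)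
    have h3 : ‖Complex.exp (-p.1) • (b (graphPoint g p)).2‖ ≤
        Real.exp (-p.1.re) * (κ * Real.exp (-η * (p.1.re - T))) := by
      rw [norm_smul, norm_exp_neg]
      gcongr
      exact (norm_snd_le _).trans (H.bound_b _ hG)
    have h0 := Real.exp_pos (-p.1.re)
    -- The step increases Re t, so the bound required of g at the image point is no larger than at
    -- p.
    have h4 : Real.exp (-η * ((baseStep Bs Bc a b (graphPoint g p)).1.re - T)) ≤
        Real.exp (-η * (p.1.re - T)) := by
      rw [Real.exp_le_exp]
      have : p.1.re ≤ (baseStep Bs Bc a b (graphPoint g p)).1.re := by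
        have := re_step_ge H.θ_le H.κ_le_θ hp.1 (H.bound_a _ hG)
        have e : (baseStep Bs Bc a b (graphPoint g p)).1 =
          p.1 + Complex.exp (-p.1) * (1 + a (graphPoint g p)) := rfl
        rw [e]
        linarith
      nlinarith [H.η_nonneg]
    have h5 := norm_add_le (g (baseStep Bs Bc a b (graphPoint g p)))
      (Complex.exp (-p.1) • (b (graphPoint g p)).2)
    set e := Real.exp (-η * (p.1.re - T))
    have he : 0 < e := Real.exp_pos _
    have hμ := H.μ_pos
    have h6 : (1 + μ * Real.exp (-p.1.re)) * ‖graphTransform Bs Bc a b g p‖ ≤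
        (1 + μ * Real.exp (-p.1.re)) * (ρ / 2 * e) := by
      have : κ * e ≤ μ * (ρ / 2 * e) := by
        have := H.κ_le_ρ
        have h10 : κ ≤ μ * (ρ / 2) := by nlinarith
        nlinarith
      nlinarith
    exact le_of_mul_le_mul_left h6 (by positivity)
  refine ⟨?_, hbound, ?_⟩
  · have hGd : DifferentiableOn ℂ (graphPoint g) (strip T θ ×ˢ ball 0 ρ) :=
      differentiable_fst.differentiableOn.prodMk
        (differentiable_snd.differentiableOn.prodMk hg.diff)
    have hmaps : MapsTo (graphPoint g) (strip T θ ×ˢ ball 0 ρ)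
        (strip T θ ×ˢ ball (0 : Es × Ec) ρ) := fun p hp => H.graphPoint_mem hg hp
    have had := H.diff_a.comp hGd hmaps
    have hbd := H.diff_b.comp hGd hmaps
    have hexp : Differentiable ℂ fun p : ℂ × Es => Complex.exp (-p.1) := by fun_prop
    have hbased : DifferentiableOn ℂ (fun p => baseStep Bs Bc a b (graphPoint g p))
        (strip T θ ×ˢ ball 0 ρ) := by
      have : (fun p => baseStep Bs Bc a b (graphPoint g p)) = fun p =>
          (p.1 + Complex.exp (-p.1) * (1 + (a ∘ graphPoint g) p),
            p.2 - Complex.exp (-p.1) • (Bs p.2 + ((b ∘ graphPoint g) p).1)) := rfl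
      rw [this]
      refine DifferentiableOn.prodMk ?_ ?_
      · exact differentiable_fst.differentiableOn.add
          (hexp.differentiableOn.mul (had.const_add _))
      · exact differentiable_snd.differentiableOn.sub (hexp.differentiableOn.smul
          ((Bs.differentiable.comp differentiable_snd).differentiableOn.add hbd.fst))
    have hinv : DifferentiableOn ℂ (fun p : ℂ × Es =>
        Ring.inverse (1 - Complex.exp (-p.1) • Bc)) (strip T θ ×ˢ ball 0 ρ) := fun p hp => by
      have h1 : DifferentiableAt ℂ (fun p : ℂ × Es => 1 - Complex.exp (-p.1) • Bc) p :=
        (hexp.smul_const Bc).const_sub 1 p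
      obtain ⟨u, hu⟩ := H.isUnit hp.1
      have h2 : DifferentiableAt ℂ (Ring.inverse : (Ec →L[ℂ] Ec) → _)
          (1 - Complex.exp (-p.1) • Bc) := by
        rw [← hu]; exact differentiableAt_inverse u.isUnit
      exact (DifferentiableAt.comp (g := Ring.inverse) p h2 h1).differentiableWithinAt
    exact hinv.clm_apply ((hg.diff.comp hbased hbase).add
      (hexp.differentiableOn.smul hbd.snd))
  -- Differences are estimated with e^{-t} taken at the point of smaller real part; the other case
  -- follows by symmetry.
  · have key : ∀ p ∈ strip T θ ×ˢ ball (0 : Es) ρ, ∀ q ∈ strip T θ ×ˢ ball (0 : Es) ρ,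
        p.1.re ≤ q.1.re →
        ‖graphTransform Bs Bc a b g p - graphTransform Bs Bc a b g q‖ ≤ ‖p - q‖ := by
      intro p hp q hq hpq
      have hP := H.graphPoint_mem hg hp
      have hQ := H.graphPoint_mem hg hq
      have hΔ := H.norm_graphPoint_sub_le hg hp hq
      set G := graphTransform Bs Bc a b g p
      set G' := graphTransform Bs Bc a b g q with hG'
      have h1 := H.expand p.1 hp.1 (G - G')
      have h2 : (G - G') - Complex.exp (-p.1) • Bc (G - G') =
          (g (baseStep Bs Bc a b (graphPoint g p)) - g (baseStep Bs Bc a b (graphPoint g q))) +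
          (Complex.exp (-p.1) • b (graphPoint g p) - Complex.exp (-q.1) • b (graphPoint g q)).2 +
          (Complex.exp (-p.1) - Complex.exp (-q.1)) • Bc G' := by
        have e1 := H.graphTransform_spec g hp.1
        have e2 := H.graphTransform_spec g hq.1
        have e3 : g (baseStep Bs Bc a b (graphPoint g p)) =
          G - Complex.exp (-p.1) • Bc G - Complex.exp (-p.1) • (b (graphPoint g p)).2 :=
            eq_sub_of_add_eq e1.symm
        have e4 : g (baseStep Bs Bc a b (graphPoint g q)) =
          G' - Complex.exp (-q.1) • Bc G' - Complex.exp (-q.1) • (b (graphPoint g q)).2 :=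
            eq_sub_of_add_eq e2.symm
        rw [e3, e4]
        simp only [map_sub, smul_sub, sub_smul, Prod.snd_sub, Prod.smul_snd]
        abel
      rw [h2] at h1
      have h3 := hg.lip _ (hbase p hp) _ (hbase q hq)
      have h4 := H.norm_baseStep_sub_le hP hQ hpq hΔ
      have h5 := (norm_snd_le _).trans (H.norm_smul_sub_smul_le (f := b)
        (fun p hp => H.bound_b' hp) H.lip_b hP hQ hpq hΔ)
      have h6 : ‖(Complex.exp (-p.1) - Complex.exp (-q.1)) • Bc G'‖ ≤
          Real.exp (-p.1.re) * ‖p - q‖ * (N * ρ) := by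
        rw [norm_smul]
        have h8 := norm_exp_neg_sub_le hpq
        rw [norm_exp_neg] at h8
        have h9 : ‖Bc G'‖ ≤ N * ρ := by
          refine (Bc.le_opNorm _).trans ?_
          gcongr
          · exact H.norm_Bc
          · have := hbound q hq
            have := H.decay_le_one hq.1
            nlinarith
        gcongr
        refine h8.trans ?_
        gcongr
        exact norm_fst_le (p - q)
      have h7 := norm_add₃_le (a := g (baseStep Bs Bc a b (graphPoint g p)) -
          g (baseStep Bs Bc a b (graphPoint g q))) (b := (Complex.exp (-p.1) • b (graphPoint g p)
          - Complex.exp (-q.1) • b (graphPoint g q)).2)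
          (c := (Complex.exp (-p.1) - Complex.exp (-q.1)) • Bc G')
      have h0 := Real.exp_pos (-p.1.re)
      have e0 : (graphPoint g p).1 = p.1 := rfl
      have e1 : (graphPoint g q).1 = q.1 := rfl
      rw [e0] at h4 h5
      rw [e1] at h5
      have hsm := H.small
      have h8 : (1 + μ * Real.exp (-p.1.re)) * ‖G - G'‖ ≤
          (1 + μ * Real.exp (-p.1.re)) * ‖p - q‖ := by
        have h10 : (1 + μ * Real.exp (-p.1.re)) * ‖G - G'‖ ≤
            ‖p - q‖ * (1 + Real.exp (-p.1.re) * (2 * N * ρ + 4 * κ)) := by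
          linarith
        nlinarith [mul_nonneg (norm_nonneg (p - q)) (mul_nonneg h0.le (sub_nonneg.2 hsm))]
      exact le_of_mul_le_mul_left h8 (by have := H.μ_pos; positivity)
    intro p hp q hq
    rcases le_total p.1.re q.1.re with h | h
    · exact key p hp q hq h
    · rw [norm_sub_rev, norm_sub_rev p]; exact key q hq p hp h

end HyperbolicSystem

end Graph

end ParabolicManifolds
end
-- Existence and uniqueness of the invariant graph.
noncomputable section
namespace ParabolicManifolds
open Metric Set

variable {Es Ec : Type*} [NormedAddCommGroup Es] [NormedSpace ℂ Es]
  [NormedAddCommGroup Ec] [NormedSpace ℂ Ec]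

namespace HyperbolicSystem

variable {T θ η κ μ ρ N : ℝ} {Bs : Es →L[ℂ] Es} {Bc : Ec →L[ℂ] Ec}
  {a : ℂ × (Es × Ec) → ℂ} {b : ℂ × (Es × Ec) → Es × Ec}

theorem exp_baseStep_le (H : HyperbolicSystem T θ η κ μ ρ N Bs Bc a b) {P : ℂ × (Es × Ec)}
    (hP : P ∈ strip T θ ×ˢ ball 0 ρ) :
    Real.exp (baseStep Bs Bc a b P).1.re ≤ Real.exp P.1.re + 2 :=
  norm_exp_step_le H.exp_T H.θ_le H.κ_le_θ hP.1 (H.bound_a P hP)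

/-- The contraction at a single point, about 1 - μe^{-Re t}, is not uniform over the strip. The
distance of the n-th iterates is therefore measured against `decay` at e^{Re t}, which turns into
the next term of the sequence when e^{Re t} grows by at most 2. -/
theorem graphTransform_sub_le (H : HyperbolicSystem T θ η κ μ ρ N Bs Bc a b) [CompleteSpace Ec]
    {g g' : ℂ × Es → Ec} (hg : IsAdmissible T θ η ρ g) (hg' : IsAdmissible T θ η ρ g') {M : ℝ}
    (hM : 0 ≤ M) {n : ℕ}
    (h : ∀ p ∈ strip T θ ×ˢ ball 0 ρ, ‖g p - g' p‖ ≤ M * decay (μ / 4) n (Real.exp p.1.re))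
    {p : ℂ × Es} (hp : p ∈ strip T θ ×ˢ ball 0 ρ) :
    ‖graphTransform Bs Bc a b g p - graphTransform Bs Bc a b g' p‖ ≤
      M * decay (μ / 4) (n + 1) (Real.exp p.1.re) := by
  have hμ := H.μ_pos
  have hκ := H.κ_nonneg
  have hP := H.graphPoint_mem hg hp
  have hP' := H.graphPoint_mem hg' hp
  have hx := Real.exp_pos p.1.re
  have h0 := Real.exp_pos (-p.1.re)
  refine le_decay_succ (μ := μ / 2) (τ := Real.exp (-p.1.re)) (y := Real.exp p.1.re + 2)
    (by linarith) (by linarith [H.μ_le]) (by linarith) hx (Real.exp_neg _) (by linarith)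
    le_rfl hM ?_
  set G := graphTransform Bs Bc a b g p
  set G' := graphTransform Bs Bc a b g' p
  have h1 := H.expand p.1 hp.1 (G - G')
  have h2 : (G - G') - Complex.exp (-p.1) • Bc (G - G') =
      (g (baseStep Bs Bc a b (graphPoint g p)) - g (baseStep Bs Bc a b (graphPoint g' p))) +
      (g (baseStep Bs Bc a b (graphPoint g' p)) - g' (baseStep Bs Bc a b (graphPoint g' p))) +
      Complex.exp (-p.1) • (b (graphPoint g p) - b (graphPoint g' p)).2 := by
    have e1 := H.graphTransform_spec g hp.1
    have e2 := H.graphTransform_spec g' hp.1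
    have e3 : g (baseStep Bs Bc a b (graphPoint g p)) =
      G - Complex.exp (-p.1) • Bc G - Complex.exp (-p.1) • (b (graphPoint g p)).2 :=
        eq_sub_of_add_eq e1.symm
    have e4 : g' (baseStep Bs Bc a b (graphPoint g' p)) =
      G' - Complex.exp (-p.1) • Bc G' - Complex.exp (-p.1) • (b (graphPoint g' p)).2 :=
        eq_sub_of_add_eq e2.symm
    rw [e3, e4]
    simp only [map_sub, smul_sub, Prod.snd_sub]
    abel
  rw [h2] at h1
  have hbase : ∀ {g : ℂ × Es → Ec}, IsAdmissible T θ η ρ g →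
      baseStep Bs Bc a b (graphPoint g p) ∈ strip T θ ×ˢ ball (0 : Es) ρ := fun hg =>
    H.baseStep_mem le_rfl (by linarith [H.ρ_pos]) (H.graphPoint_mem hg hp) hp.1 hp.2
  have h3 := (hg.lip _ (hbase hg) _ (hbase hg')).trans (H.norm_baseStep_sub_le_of_fst_eq hP hP')
  have h4 := h _ (hbase hg')
  have h5 : decay (μ / 4) n (Real.exp (baseStep Bs Bc a b (graphPoint g' p)).1.re) ≤
      decay (μ / 4) n (Real.exp p.1.re + 2) :=
    decay_mono (by linarith) n (Real.exp_pos _) (H.exp_baseStep_le hP')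
  have h6 : ‖Complex.exp (-p.1) • (b (graphPoint g p) - b (graphPoint g' p)).2‖ ≤
      Real.exp (-p.1.re) * (κ * ‖g p - g' p‖) := by
    rw [norm_smul, norm_exp_neg]
    gcongr
    refine (norm_snd_le _).trans ((H.lip_b _ hP _ hP').trans_eq ?_)
    simp [graphPoint, Prod.norm_def]
  have h7 := (h p hp).trans (mul_le_mul_of_nonneg_left
    (decay_mono (by linarith : 0 ≤ μ / 4) n hx (by linarith : Real.exp p.1.re ≤
      Real.exp p.1.re + 2)) hM)
  have h8 := h4.trans (mul_le_mul_of_nonneg_left h5 hM)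
  set X := M * decay (μ / 4) n (Real.exp p.1.re + 2)
  have h9 := norm_add₃_le (a := g (baseStep Bs Bc a b (graphPoint g p)) -
      g (baseStep Bs Bc a b (graphPoint g' p))) (b := g (baseStep Bs Bc a b (graphPoint g' p)) -
      g' (baseStep Bs Bc a b (graphPoint g' p)))
      (c := Complex.exp (-p.1) • (b (graphPoint g p) - b (graphPoint g' p)).2)
  set τ := Real.exp (-p.1.re)
  have hτ := H.exp_le hp.1
  have h10 : (1 + μ * τ) * ‖G - G'‖ ≤ (1 + 2 * κ * τ) * X := by
    have : τ * κ * ‖g p - g' p‖ ≤ τ * κ * X := by gcongr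
    linarith
  -- Half of the expansion rate is given up to cancel 1 + 2κτ: since κ ≤ μ/8 and τ ≤ 1, (1 + 2κτ)(1
  -- + μτ/2) ≤ 1 + μτ. This is why `le_decay_succ` is used with μ/2 and the exponent is μ/4.
  have h11 : (1 + 2 * κ * τ) * ((1 + μ / 2 * τ) * ‖G - G'‖) ≤ (1 + 2 * κ * τ) * X := by
    refine le_trans ?_ h10
    rw [← mul_assoc]
    gcongr
    have : κ * μ * τ ^ 2 ≤ μ / 8 * 1 * (τ * 1) := by
      rw [sq]
      gcongr
      · exact H.κ_le_μ
      · exact H.μ_le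
      · linarith
    have := H.κ_le_μ
    nlinarith
  exact le_of_mul_le_mul_left h11 (by positivity)

theorem isAdmissible_zero (H : HyperbolicSystem T θ η κ μ ρ N Bs Bc a b) :
    IsAdmissible T θ η ρ (0 : ℂ × Es → Ec) := by
  refine ⟨differentiableOn_const _, fun p _ => ?_, fun p _ q _ => ?_⟩
  · simp only [Pi.zero_apply, norm_zero]
    have := H.ρ_pos
    positivity
  · simp

theorem norm_le (H : HyperbolicSystem T θ η κ μ ρ N Bs Bc a b) {g : ℂ × Es → Ec}
    (hg : IsAdmissible T θ η ρ g) {p : ℂ × Es} (hp : p ∈ strip T θ ×ˢ ball 0 ρ) :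
    ‖g p‖ ≤ ρ / 2 := by
  have := hg.bound p hp
  have := H.decay_le_one hp.1
  nlinarith [H.ρ_pos]

/-- Existence of the invariant graph. -/
theorem exists_graph (H : HyperbolicSystem T θ η κ μ ρ N Bs Bc a b) [CompleteSpace Ec] :
    ∃ g, IsAdmissible T θ η ρ g ∧
      ∀ p ∈ strip T θ ×ˢ ball 0 ρ, graphTransform Bs Bc a b g p = g p := by
  have hμ := H.μ_pos
  have hρ := H.ρ_pos
  set D : Set (ℂ × Es) := strip T θ ×ˢ ball 0 ρ with hD
  have hDo : IsOpen D := (isOpen_strip T θ).prod isOpen_ball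
  set f : ℕ → ℂ × Es → Ec := fun n => (graphTransform Bs Bc a b)^[n] 0 with hf
  have hfs : ∀ n, f (n + 1) = graphTransform Bs Bc a b (f n) := fun n => by
    simp only [hf]; rw [Function.iterate_succ_apply']
  have hadm : ∀ n, IsAdmissible T θ η ρ (f n) := fun n => by
    induction n with
    | zero => exact H.isAdmissible_zero
    | succ n ih => rw [hfs]; exact H.isAdmissible_graphTransform ih
  -- Applied to an iterate in place of g, this gives the Cauchy property of the sequence of
  -- iterates.
  have hdiff : ∀ n (g : ℂ × Es → Ec), IsAdmissible T θ η ρ g →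
      ∀ p ∈ D, ‖((graphTransform Bs Bc a b)^[n] g) p - f n p‖ ≤
        ρ * decay (μ / 4) n (Real.exp p.1.re) := by
    intro n g hg
    have : IsAdmissible T θ η ρ ((graphTransform Bs Bc a b)^[n] g) ∧ ∀ p ∈ D,
        ‖((graphTransform Bs Bc a b)^[n] g) p - f n p‖ ≤
          ρ * decay (μ / 4) n (Real.exp p.1.re) := by
      induction n with
      | zero =>
        refine ⟨hg, fun p hp => ?_⟩
        rw [decay_zero _ (Real.exp_pos _)]
        have h1 := H.norm_le hg hp
        simpa [hf] using h1.trans (by linarith)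
      | succ n ih =>
        rw [Function.iterate_succ_apply', hfs]
        exact ⟨H.isAdmissible_graphTransform ih.1, fun p hp =>
          H.graphTransform_sub_le ih.1 (hadm n) hρ.le ih.2 hp⟩
    exact this.2
  have hcauchy : ∀ p ∈ D, ∀ n m, n ≤ m →
      ‖f m p - f n p‖ ≤ ρ * decay (μ / 4) n (Real.exp p.1.re) := by
    intro p hp n m hnm
    obtain ⟨l, rfl⟩ := Nat.exists_eq_add_of_le hnm
    have := hdiff n (f l) (hadm l) p hp
    rwa [← Function.iterate_add_apply] at this
  have hto : ∀ x, Tendsto (fun n => ρ * decay (μ / 4) n x) atTop (𝓝 0) := fun x => by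
    simpa using (tendsto_decay (q := μ / 4) (by linarith) x).const_mul ρ
  have hlim : ∀ p ∈ D, ∃ l, Tendsto (fun n => f n p) atTop (𝓝 l) := by
    intro p hp
    refine cauchySeq_tendsto_of_complete (cauchySeq_of_le_tendsto_0'
      (fun n => ρ * decay (μ / 4) n (Real.exp p.1.re)) (fun n m hnm => ?_) (hto _))
    rw [dist_comm, dist_eq_norm]
    exact hcauchy p hp n m hnm
  choose! g hg using hlim
  have hgf : ∀ p ∈ D, ∀ n, ‖g p - f n p‖ ≤ ρ * decay (μ / 4) n (Real.exp p.1.re) := by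
    intro p hp n
    refine le_of_tendsto (((hg p hp).sub_const _).norm) ?_
    filter_upwards [eventually_ge_atTop n] with m hm using hcauchy p hp n m hm
  have hgadm : IsAdmissible T θ η ρ g := by
    refine ⟨fun p hp => ?_, fun p hp => ?_, fun p hp q hq => ?_⟩
    -- `decay` is increasing in x, so on a ball of radius r it is controlled by its value at e^{Re p
    -- + r}: the convergence is locally uniform and the limit is holomorphic.
    · obtain ⟨r, hr, hrD⟩ := Metric.isOpen_iff.1 hDo p hp
      refine (differentiableAt_of_tendstoUniformlyOn hr (fun n => (hadm n).diff.mono hrD)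
        ?_).differentiableWithinAt
      rw [Metric.tendstoUniformlyOn_iff]
      intro ε hε
      filter_upwards [(hto (Real.exp (p.1.re + r))).eventually (gt_mem_nhds hε)] with n hn q hq
      rw [dist_eq_norm]
      refine ((hgf q (hrD hq) n).trans ?_).trans_lt hn
      refine mul_le_mul_of_nonneg_left (decay_mono (by linarith) n (Real.exp_pos _) ?_) hρ.le
      rw [Real.exp_le_exp]
      have h1 : ‖q.1 - p.1‖ < r :=
        (norm_fst_le (q - p)).trans_lt (by rwa [← dist_eq_norm])
      have h2 := (Complex.abs_re_le_norm (q.1 - p.1)).trans h1.le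
      rw [Complex.sub_re] at h2
      linarith [(abs_le.1 h2).2]
    · exact le_of_tendsto (hg p hp).norm (Eventually.of_forall fun n => (hadm n).bound p hp)
    · exact le_of_tendsto ((hg p hp).sub (hg q hq)).norm
        (Eventually.of_forall fun n => (hadm n).lip p hp q hq)
  refine ⟨g, hgadm, fun p hp => ?_⟩
  have h1 : Tendsto (fun n => f (n + 1) p) atTop (𝓝 (graphTransform Bs Bc a b g p)) := by
    rw [tendsto_iff_norm_sub_tendsto_zero]
    refine squeeze_zero (fun _ => norm_nonneg _) (fun n => ?_)
      ((tendsto_add_atTop_iff_nat 1).2 (hto (Real.exp p.1.re)))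
    rw [norm_sub_rev, hfs]
    exact H.graphTransform_sub_le hgadm (hadm n) hρ.le (fun p hp => hgf p hp n) hp
  exact tendsto_nhds_unique h1 ((tendsto_add_atTop_iff_nat 1).2 (hg p hp))

/-- A point whose orbit stays in the domain lies on the invariant graph. -/
theorem eq_graph_of_orbit (H : HyperbolicSystem T θ η κ μ ρ N Bs Bc a b) [CompleteSpace Ec]
    {g : ℂ × Es → Ec} (hg : IsAdmissible T θ η ρ g)
    (hfix : ∀ p ∈ strip T θ ×ˢ ball 0 ρ, graphTransform Bs Bc a b g p = g p)
    {P : ℂ × (Es × Ec)}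
    (hP : ∀ n, (slowStep (Bs.prodMap Bc) a b)^[n] P ∈ strip T θ ×ˢ ball 0 ρ) :
    P.2.2 = g (P.1, P.2.1) := by
  have hμ := H.μ_pos
  have hρ := H.ρ_pos
  have hκ := H.κ_nonneg
  -- The deviation from the graph expands along the orbit but remains below 2ρ as long as the orbit
  -- stays in the domain. Read backwards over n steps, the initial deviation is at most 2ρ times the
  -- n-th term of `decay`. The induction is over all points, since the step replaces P by its image.
  have key : ∀ n, ∀ P : ℂ × (Es × Ec),
      (∀ n, (slowStep (Bs.prodMap Bc) a b)^[n] P ∈ strip T θ ×ˢ ball 0 ρ) →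
      ‖P.2.2 - g (P.1, P.2.1)‖ ≤ 2 * ρ * decay (μ / 4) n (Real.exp P.1.re) := by
    intro n
    induction n with
    | zero =>
      intro P hP
      have hP0 := hP 0
      have hp : (P.1, P.2.1) ∈ strip T θ ×ˢ ball (0 : Es) ρ := ⟨hP0.1,
        mem_ball_zero_iff.2 ((norm_fst_le _).trans_lt (mem_ball_zero_iff.1 hP0.2))⟩
      rw [decay_zero _ (Real.exp_pos _)]
      have h1 := H.norm_le hg hp
      have h2 : ‖P.2.2‖ < ρ := (norm_snd_le _).trans_lt (mem_ball_zero_iff.1 hP0.2)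
      have h3 := norm_sub_le P.2.2 (g (P.1, P.2.1))
      linarith
    | succ n ih =>
      intro P hP
      have hP0 : P ∈ strip T θ ×ˢ ball 0 ρ := hP 0
      have hp : (P.1, P.2.1) ∈ strip T θ ×ˢ ball (0 : Es) ρ := ⟨hP0.1,
        mem_ball_zero_iff.2 ((norm_fst_le _).trans_lt (mem_ball_zero_iff.1 hP0.2))⟩
      have hG := H.graphPoint_mem hg hp
      have h1 := ih (slowStep (Bs.prodMap Bc) a b P) (fun n => by
        rw [← Function.iterate_succ_apply]; exact hP (n + 1))
      have hx := Real.exp_pos P.1.re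
      have h0 := Real.exp_pos (-P.1.re)
      refine le_decay_succ (μ := μ / 2) (τ := Real.exp (-P.1.re))
        (y := Real.exp (slowStep (Bs.prodMap Bc) a b P).1.re)
        (by linarith) (by linarith [H.μ_le]) (by linarith) hx (Real.exp_neg _) (Real.exp_pos _)
        (H.exp_baseStep_le hP0) (by linarith) (le_trans ?_ h1)
      set v := P.2.2 with hv
      set w := g (P.1, P.2.1) with hw
      have h2 := H.expand P.1 hP0.1 (v - w)
      have h3 : (v - w) - Complex.exp (-P.1) • Bc (v - w) =
          ((slowStep (Bs.prodMap Bc) a b P).2.2 - g (baseStep Bs Bc a b P)) +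
          (g (baseStep Bs Bc a b P) - g (baseStep Bs Bc a b (graphPoint g (P.1, P.2.1)))) +
          Complex.exp (-P.1) • (b P - b (graphPoint g (P.1, P.2.1))).2 := by
        have e1 := H.graphTransform_spec g (p := (P.1, P.2.1)) hP0.1
        rw [hfix _ hp] at e1
        have e2 : g (baseStep Bs Bc a b (graphPoint g (P.1, P.2.1))) =
          w - Complex.exp (-P.1) • Bc w -
            Complex.exp (-P.1) • (b (graphPoint g (P.1, P.2.1))).2 :=
          eq_sub_of_add_eq e1.symm
        rw [e2]
        simp only [slowStep, map_sub, smul_sub, Prod.snd_sub, Prod.snd_add, Prod.smul_snd,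
          ContinuousLinearMap.coe_prodMap', Prod.map, smul_add]
        abel
      rw [h3] at h2
      have hbP := H.baseStep_mem le_rfl (by linarith) hP0 hP0.1 hp.2
      have hbG := H.baseStep_mem le_rfl (by linarith) hG hG.1 hp.2
      have h4 := (hg.lip _ hbP _ hbG).trans (H.norm_baseStep_sub_le_of_fst_eq
        (t := P.1) (w := P.2.1) (v := v) (v' := w) hP0 hG)
      have h5 : ‖Complex.exp (-P.1) • (b P - b (graphPoint g (P.1, P.2.1))).2‖ ≤
          Real.exp (-P.1.re) * (κ * ‖v - w‖) := by
        rw [norm_smul, norm_exp_neg]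
        gcongr
        refine (norm_snd_le _).trans ((H.lip_b _ hP0 _ hG).trans_eq ?_)
        have : P - graphPoint g (P.1, P.2.1) = (0, (0, v - w)) := by
          ext <;> simp [graphPoint, hv, hw]
        rw [this]
        simp [Prod.norm_def]
      have h6 := norm_add₃_le
        (a := (slowStep (Bs.prodMap Bc) a b P).2.2 - g (baseStep Bs Bc a b P))
        (b := g (baseStep Bs Bc a b P) - g (baseStep Bs Bc a b (graphPoint g (P.1, P.2.1))))
        (c := Complex.exp (-P.1) • (b P - b (graphPoint g (P.1, P.2.1))).2)
      have h7 := H.κ_le_μ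
      have h8 : 2 * κ * Real.exp (-P.1.re) * ‖v - w‖ ≤
          μ / 2 * Real.exp (-P.1.re) * ‖v - w‖ := by gcongr; linarith
      have h9 : (slowStep (Bs.prodMap Bc) a b P).2.2 - g (baseStep Bs Bc a b P) =
        (slowStep (Bs.prodMap Bc) a b P).2.2 - g ((slowStep (Bs.prodMap Bc) a b P).1,
          (slowStep (Bs.prodMap Bc) a b P).2.1) := rfl
      rw [h9] at h2 h6
      linarith
  have hto : Tendsto (fun n => 2 * ρ * decay (μ / 4) n (Real.exp P.1.re)) atTop (𝓝 0) := by
    simpa using (tendsto_decay (q := μ / 4) (by linarith) (Real.exp P.1.re)).const_mul (2 * ρ)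
  have := ge_of_tendsto' hto fun n => key n P hP
  exact sub_eq_zero.1 (norm_le_zero_iff.1 this)

/-- The graph is invariant. -/
theorem slowStep_graphPoint (H : HyperbolicSystem T θ η κ μ ρ N Bs Bc a b) [CompleteSpace Ec]
    {g : ℂ × Es → Ec}
    (hfix : ∀ p ∈ strip T θ ×ˢ ball 0 ρ, graphTransform Bs Bc a b g p = g p)
    {p : ℂ × Es} (hp : p ∈ strip T θ ×ˢ ball 0 ρ) :
    slowStep (Bs.prodMap Bc) a b (graphPoint g p) =
      graphPoint g (baseStep Bs Bc a b (graphPoint g p)) := by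
  have e1 := H.graphTransform_spec g (p := p) hp.1
  rw [hfix _ hp] at e1
  refine Prod.ext rfl (Prod.ext rfl ?_)
  have e2 : g (baseStep Bs Bc a b (graphPoint g p)) =
    g p - Complex.exp (-p.1) • Bc (g p) - Complex.exp (-p.1) • (b (graphPoint g p)).2 :=
    eq_sub_of_add_eq e1.symm
  have e3 : (graphPoint g (baseStep Bs Bc a b (graphPoint g p))).2.2 =
    g (baseStep Bs Bc a b (graphPoint g p)) := rfl
  rw [e3, e2]
  simp [slowStep, graphPoint, smul_add, sub_sub]

end HyperbolicSystem

end ParabolicManifolds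
end
-- Slow systems: Cauchy estimates, and hyperbolicity far in the strip.
noncomputable section
namespace ParabolicManifolds
open Metric Set

section

variable {E F : Type*} [NormedAddCommGroup E] [NormedSpace ℂ E]
  [NormedAddCommGroup F] [NormedSpace ℂ F]

/-- The perturbation terms of a slow system: holomorphic and exponentially small. -/
structure SlowSystem (T θ η C : ℝ) (a : ℂ × E → ℂ) (b : ℂ × E → E) : Prop where
  diff_a : DifferentiableOn ℂ a (strip T θ ×ˢ ball 0 1)
  diff_b : DifferentiableOn ℂ b (strip T θ ×ˢ ball 0 1)
  bound_a : ∀ p ∈ strip T θ ×ˢ ball 0 1, ‖a p‖ ≤ C * Real.exp (-η * p.1.re)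
  bound_b : ∀ p ∈ strip T θ ×ˢ ball 0 1, ‖b p‖ ≤ C * Real.exp (-η * p.1.re)

theorem SlowSystem.mono {T T' θ θ' η C : ℝ} {a : ℂ × E → ℂ} {b : ℂ × E → E}
    (H : SlowSystem T θ η C a b) (hT : T ≤ T') (hθ : θ' ≤ θ) : SlowSystem T' θ' η C a b := by
  have hs : strip T' θ' ×ˢ ball (0 : E) 1 ⊆ strip T θ ×ˢ ball 0 1 :=
    prod_mono (strip_subset_strip hT hθ) subset_rfl
  exact ⟨H.diff_a.mono hs, H.diff_b.mono hs, fun p hp => H.bound_a p (hs hp),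
    fun p hp => H.bound_b p (hs hp)⟩

theorem ball_subset_strip {T T' θ θ' r : ℝ} (hT : T + r ≤ T') (hθ : θ' + r ≤ θ) {t : ℂ}
    (ht : t ∈ strip T' θ') : ball t r ⊆ strip T θ := by
  intro s hs
  rw [mem_ball, dist_eq_norm] at hs
  have h1 := (Complex.abs_re_le_norm (s - t)).trans_lt hs
  have h2 := (Complex.abs_im_le_norm (s - t)).trans_lt hs
  rw [Complex.sub_re] at h1
  rw [Complex.sub_im] at h2
  have h3 := abs_add_le (s.im - t.im) t.im
  rw [sub_add_cancel] at h3
  exact ⟨by linarith [(abs_lt.1 h1).1, ht.1], by linarith [ht.2]⟩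

/-- Cauchy estimates on a smaller domain. -/
theorem exists_lipschitz_of_exp_bound {T θ θ' η C : ℝ} (hη : 0 ≤ η) (hθ : θ' < θ) {f : ℂ × E → F}
    (hf : DifferentiableOn ℂ f (strip T θ ×ˢ ball 0 1))
    (hC : ∀ p ∈ strip T θ ×ˢ ball 0 1, ‖f p‖ ≤ C * Real.exp (-η * p.1.re)) :
    ∃ L, 0 ≤ L ∧ ∀ T', T + 1 ≤ T' → ∀ p ∈ strip T' θ' ×ˢ ball (0 : E) (1 / 2),
      ∀ q ∈ strip T' θ' ×ˢ ball (0 : E) (1 / 2),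
        ‖f p - f q‖ ≤ L * Real.exp (-η * T') * ‖p - q‖ := by
  set r := min (1 / 2) (θ - θ') with hr
  have hr0 : 0 < r := lt_min (by norm_num) (by linarith)
  have hr1 : r ≤ 1 / 2 := min_le_left _ _
  have hr2 : r ≤ θ - θ' := min_le_right _ _
  -- The factor e^η pays for the decrease of Re t, by less than 1, inside the ball used in Cauchy's
  -- estimate.
  refine ⟨2 * (|C| * Real.exp η) / r, by positivity, fun T' hT' p hp q hq => ?_⟩
  have hsub : ∀ p ∈ strip T' θ' ×ˢ ball (0 : E) (1 / 2), ball p r ⊆ strip T θ ×ˢ ball 0 1 := by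
    intro p hp y hy
    rw [← ball_prod_same] at hy
    refine ⟨ball_subset_strip (by linarith) (by linarith) hp.1 hy.1, ?_⟩
    have h1 := hp.2
    have h2 := hy.2
    rw [mem_ball, dist_eq_norm] at h2
    rw [mem_ball_zero_iff] at h1 ⊢
    have := norm_add_le (y.2 - p.2) p.2
    rw [sub_add_cancel] at this
    linarith
  have hopen : IsOpen (strip T θ ×ˢ ball (0 : E) 1) := (isOpen_strip T θ).prod isOpen_ball
  refine Convex.norm_image_sub_le_of_norm_fderiv_le (𝕜 := ℂ) (fun x hx => ?_) (fun x hx => ?_)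
    ((convex_strip T' θ').prod (convex_ball (0 : E) (1 / 2))) hq hp
  · exact hf.differentiableAt (hopen.mem_nhds (hsub x hx (mem_ball_self hr0)))
  · refine (norm_fderiv_le_of_forall_norm_le hr0 (hf.mono (hsub x hx))
      (C := |C| * Real.exp η * Real.exp (-η * T')) fun y hy => ?_).trans_eq (by ring)
    refine (hC y (hsub x hx hy)).trans ?_
    rw [mul_assoc, ← Real.exp_add]
    refine mul_le_mul (le_abs_self C) ?_ (Real.exp_nonneg _) (abs_nonneg C)
    rw [Real.exp_le_exp]
    have h1 : y.1 ∈ strip (T' - 1) θ := by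
      rw [← ball_prod_same] at hy
      exact ball_subset_strip (by linarith) (by linarith) hx.1 hy.1
    nlinarith [h1.1]

/-- Lipschitz estimate in the fibre variable. -/
theorem exists_lipschitz_fiber {T θ θ' η C : ℝ} (hη : 0 ≤ η) (hθ : θ' < θ) {f : ℂ × E → F}
    (hf : DifferentiableOn ℂ f (strip T θ ×ˢ ball 0 1))
    (hC : ∀ p ∈ strip T θ ×ˢ ball 0 1, ‖f p‖ ≤ C * Real.exp (-η * p.1.re)) :
    ∃ L, 0 ≤ L ∧ ∀ t ∈ strip (T + 2) θ', ∀ u ∈ ball (0 : E) (1 / 2), ∀ v ∈ ball (0 : E) (1 / 2),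
        ‖f (t, u) - f (t, v)‖ ≤ L * Real.exp (-η * t.re) * ‖u - v‖ := by
  obtain ⟨L, hL, h⟩ := exists_lipschitz_of_exp_bound hη hθ hf hC
  refine ⟨L * Real.exp η, by positivity, fun t ht u hu v hv => ?_⟩
  -- Taking the strip that starts at Re t - 1 turns the uniform constant into a pointwise rate.
  have ht' : t ∈ strip (t.re - 1) θ' := ⟨by linarith, ht.2⟩
  have := h (t.re - 1) (by linarith [ht.1]) (t, u) ⟨ht', hu⟩ (t, v) ⟨ht', hv⟩
  have e1 : ‖((t, u) : ℂ × E) - (t, v)‖ = ‖u - v‖ := by simp [Prod.norm_def]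
  have e2 : Real.exp (-η * (t.re - 1)) = Real.exp η * Real.exp (-η * t.re) := by
    rw [← Real.exp_add]; congr 1; ring
  rw [e1, e2] at this
  rwa [mul_assoc L]

theorem tendsto_const_mul_exp_neg {η : ℝ} (hη : 0 < η) (C : ℝ) :
    Tendsto (fun T : ℝ => C * Real.exp (-η * T)) atTop (𝓝 0) := by
  have h1 : Tendsto (fun T : ℝ => -η * T) atTop atBot :=
    tendsto_id.const_mul_atTop_of_neg (by linarith)
  simpa using (Real.tendsto_exp_atBot.comp h1).const_mul C

end

section Hyperbolic

variable {Es Ec : Type*} [NormedAddCommGroup Es] [NormedSpace ℂ Es]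
  [NormedAddCommGroup Ec] [NormedSpace ℂ Ec]

/-- Far in the strip, a slow system with a hyperbolic linear part is a hyperbolic system. -/
theorem SlowSystem.exists_hyperbolicSystem {T T₀ θ₀ θ η C μ : ℝ} {Bs : Es →L[ℂ] Es}
    {Bc : Ec →L[ℂ] Ec} {a : ℂ × (Es × Ec) → ℂ} {b : ℂ × (Es × Ec) → Es × Ec}
    (H : SlowSystem T θ₀ η C a b) (hη : 0 < η) (hθ0 : 0 < θ) (hθ : θ < θ₀) (hθ1 : θ ≤ 1)
    (hμ0 : 0 < μ) (hμ1 : μ ≤ 1)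
    (contract : ∀ t ∈ strip T₀ θ, ∀ w,
      ‖w - Complex.exp (-t) • Bs w‖ ≤ (1 - μ * Real.exp (-t.re)) * ‖w‖)
    (expand : ∀ t ∈ strip T₀ θ, ∀ v,
      (1 + μ * Real.exp (-t.re)) * ‖v‖ ≤ ‖v - Complex.exp (-t) • Bc v‖) :
    ∃ T₁ κ ρ N, T ≤ T₁ ∧ ρ ≤ 1 ∧ HyperbolicSystem T₁ θ η κ μ ρ N Bs Bc a b := by
  obtain ⟨La, hLa, ha⟩ := exists_lipschitz_of_exp_bound hη.le hθ H.diff_a H.bound_a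
  obtain ⟨Lb, hLb, hb⟩ := exists_lipschitz_of_exp_bound hη.le hθ H.diff_b H.bound_b
  set N := max ‖Bs‖ ‖Bc‖ with hN
  have hN0 : 0 ≤ N := (norm_nonneg Bs).trans (le_max_left _ _)
  -- With these choices 2Nρ ≤ μ/2 and 4κ ≤ μρ ≤ μ/2, which is the condition `small`; all remaining
  -- conditions hold once the strip starts far enough.
  set ρ := min (1 / 2) (μ / (4 * (N + 1))) with hρ
  have hρ0 : 0 < ρ := lt_min (by norm_num) (by positivity)
  have hρ1 : ρ ≤ 1 / 2 := min_le_left _ _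
  have hρ2 : ρ * (4 * (N + 1)) ≤ μ := by
    rw [← le_div_iff₀ (by positivity)]; exact min_le_right _ _
  set κ := min (θ / 4) (μ * ρ / 4) with hκ
  have hκ0 : 0 < κ := lt_min (by positivity) (by positivity)
  have hκ1 : κ ≤ θ / 4 := min_le_left _ _
  have hκ2 : κ ≤ μ * ρ / 4 := min_le_right _ _
  have hκ3 : κ ≤ μ / 8 := by nlinarith
  have e1 := (tendsto_const_mul_exp_neg one_pos 1).eventually
    (gt_mem_nhds (by norm_num : (0 : ℝ) < 1 / 4))
  have e2 := (tendsto_const_mul_exp_neg one_pos N).eventually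
    (gt_mem_nhds (by norm_num : (0 : ℝ) < 1))
  have e3 := (tendsto_const_mul_exp_neg hη |C|).eventually (gt_mem_nhds hκ0)
  have e4 := (tendsto_const_mul_exp_neg hη La).eventually (gt_mem_nhds hκ0)
  have e5 := (tendsto_const_mul_exp_neg hη Lb).eventually (gt_mem_nhds hκ0)
  obtain ⟨T₁, h1, h2, h3, h4, h5, h6, h7⟩ := (e1.and (e2.and (e3.and (e4.and (e5.and
    ((eventually_ge_atTop (T + 1)).and (eventually_ge_atTop T₀))))))).exists
  simp only [neg_mul, one_mul] at h1 h2
  have hs : strip T₁ θ ×ˢ ball (0 : Es × Ec) ρ ⊆ strip T θ₀ ×ˢ ball 0 1 :=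
    prod_mono (strip_subset_strip (by linarith) hθ.le) (ball_subset_ball (by linarith))
  have hs' : strip T₁ θ ×ˢ ball (0 : Es × Ec) ρ ⊆ strip T₁ θ ×ˢ ball 0 (1 / 2) :=
    prod_mono subset_rfl (ball_subset_ball hρ1)
  have hb1 : ∀ p ∈ strip T₁ θ ×ˢ ball (0 : Es × Ec) ρ,
      C * Real.exp (-η * p.1.re) ≤ κ * Real.exp (-η * (p.1.re - T₁)) := fun p hp => by
    have : Real.exp (-η * p.1.re) = Real.exp (-η * T₁) * Real.exp (-η * (p.1.re - T₁)) := by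
      rw [← Real.exp_add]; congr 1; ring
    rw [this, ← mul_assoc]
    have := mul_le_mul_of_nonneg_right (le_abs_self C) (Real.exp_nonneg (-η * T₁))
    gcongr
    linarith
  refine ⟨T₁, κ, ρ, N, by linarith, by linarith, ?_⟩
  refine { exp_T := h1.le, exp_T_mul := by linarith, θ_pos := hθ0, θ_le := hθ1,
           η_nonneg := hη.le, κ_nonneg := hκ0.le, κ_le_θ := hκ1, κ_le_μ := hκ3, κ_le_ρ := hκ2,
           μ_pos := hμ0, μ_le := hμ1, ρ_pos := hρ0, norm_Bs := le_max_left _ _,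
           norm_Bc := le_max_right _ _, small := by nlinarith, diff_a := H.diff_a.mono hs,
           diff_b := H.diff_b.mono hs, bound_a := fun p hp => ?_,
           bound_b := fun p hp => (H.bound_b p (hs hp)).trans (hb1 p hp),
           lip_a := fun p hp q hq => ?_, lip_b := fun p hp q hq => ?_,
           contract := fun t ht => contract t (strip_subset_strip h7 le_rfl ht),
           expand := fun t ht => expand t (strip_subset_strip h7 le_rfl ht) }
  · refine ((H.bound_a p (hs hp)).trans (hb1 p hp)).trans ?_
    have : Real.exp (-η * (p.1.re - T₁)) ≤ 1 := by
      rw [Real.exp_le_one_iff]; nlinarith [hp.1.1]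
    nlinarith
  · refine (ha T₁ h6 p (hs' hp) q (hs' hq)).trans ?_
    gcongr
  · refine (hb T₁ h6 p (hs' hp) q (hs' hq)).trans ?_
    gcongr

end Hyperbolic

section Hilbert

variable {E : Type*} [NormedAddCommGroup E] [InnerProductSpace ℂ E]

/-- Multiplication by e^{-t} scales by e^{-Re t} and rotates by at most θ. Since cos ≥ 1/2, half of
the lower bound m survives, and the imaginary part of the numerical range costs at most θ‖B‖ ≤ m/4.
This is what forces narrow strips. -/
theorem re_inner_exp_smul_ge {B : E →L[ℂ] E} {m θ : ℝ} (hθ1 : θ ≤ 1)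
    (hθ : θ * ‖B‖ ≤ m / 4) (hB : ∀ w, m * ‖w‖ ^ 2 ≤ (inner ℂ w (B w)).re) (hm : 0 < m) {T : ℝ}
    {t : ℂ} (ht : t ∈ strip T θ) (w : E) :
    Real.exp (-t.re) * (m / 4) * ‖w‖ ^ 2 ≤ (inner ℂ w (Complex.exp (-t) • B w)).re := by
  rw [inner_smul_right, Complex.mul_re, re_exp_neg, im_exp_neg]
  have h1 := half_le_cos (ht.2.le.trans hθ1)
  have h2 : |Real.sin t.im| ≤ θ := (Real.abs_sin_le_abs).trans ht.2.le
  have h3 : |(inner ℂ w (B w)).im| ≤ ‖B‖ * ‖w‖ ^ 2 := by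
    refine (Complex.abs_im_le_norm _).trans ((norm_inner_le_norm _ _).trans ?_)
    nlinarith [B.le_opNorm w, norm_nonneg w]
  have h0 := Real.exp_pos (-t.re)
  have h4 := hB w
  have h5 : |Real.sin t.im * (inner ℂ w (B w)).im| ≤ m / 4 * ‖w‖ ^ 2 := by
    rw [abs_mul]
    have hθ0 : 0 ≤ θ := (abs_nonneg _).trans h2
    calc _ ≤ θ * (‖B‖ * ‖w‖ ^ 2) := by gcongr
      _ = (θ * ‖B‖) * ‖w‖ ^ 2 := by ring
      _ ≤ _ := by gcongr
  have h6 := neg_abs_le (Real.sin t.im * (inner ℂ w (B w)).im)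
  have h7 : m / 2 * ‖w‖ ^ 2 ≤ Real.cos t.im * (inner ℂ w (B w)).re := by
    have : 0 ≤ m * ‖w‖ ^ 2 := by positivity
    nlinarith
  have h8 : m / 4 * ‖w‖ ^ 2 ≤ Real.cos t.im * (inner ℂ w (B w)).re +
      Real.sin t.im * (inner ℂ w (B w)).im := by linarith
  nlinarith [mul_le_mul_of_nonneg_left h8 h0.le]

/-- With τ = e^{-Re t}, the cross term of the squared norm gives at most -τ m/2 and the quadratic
term at most τ m/4. The sum -τ m/4 is twice -τ m/8, whence the factor in front of ‖w‖. -/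
theorem norm_sub_exp_smul_le {B : E →L[ℂ] E} {m θ T : ℝ} (hθ1 : θ ≤ 1)
    (hθ : θ * ‖B‖ ≤ m / 4) (hB : ∀ w, m * ‖w‖ ^ 2 ≤ (inner ℂ w (B w)).re) (hm : 0 < m)
    (hT : Real.exp (-T) * ‖B‖ ^ 2 ≤ m / 4) (hT' : Real.exp (-T) * m ≤ 1) {t : ℂ}
    (ht : t ∈ strip T θ) (w : E) :
    ‖w - Complex.exp (-t) • B w‖ ≤ (1 - m / 8 * Real.exp (-t.re)) * ‖w‖ := by
  have h0 := Real.exp_pos (-t.re)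
  have hτ := Real.exp_le_exp.2 (neg_le_neg ht.1.le)
  have h1 := re_inner_exp_smul_ge hθ1 hθ hB hm ht w
  have h2 : 0 ≤ 1 - m / 8 * Real.exp (-t.re) := by nlinarith
  refine (sq_le_sq₀ (norm_nonneg _) (by positivity)).1 ?_
  rw [@norm_sub_sq ℂ]
  have h3 : ‖Complex.exp (-t) • B w‖ ^ 2 ≤ Real.exp (-t.re) * (m / 4) * ‖w‖ ^ 2 := by
    rw [norm_smul, norm_exp_neg, mul_pow]
    have h4 : ‖B w‖ ^ 2 ≤ ‖B‖ ^ 2 * ‖w‖ ^ 2 := by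
      rw [← mul_pow]; exact pow_le_pow_left₀ (norm_nonneg _) (B.le_opNorm w) 2
    calc _ ≤ Real.exp (-t.re) ^ 2 * (‖B‖ ^ 2 * ‖w‖ ^ 2) := by gcongr
      _ = Real.exp (-t.re) * (Real.exp (-t.re) * ‖B‖ ^ 2) * ‖w‖ ^ 2 := by ring
      _ ≤ Real.exp (-t.re) * (Real.exp (-T) * ‖B‖ ^ 2) * ‖w‖ ^ 2 := by gcongr
      _ ≤ _ := by gcongr
  have h5 : 0 ≤ (m / 8 * Real.exp (-t.re)) ^ 2 * ‖w‖ ^ 2 := by positivity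
  have h6 : RCLike.re (inner ℂ w (Complex.exp (-t) • B w)) =
    (inner ℂ w (Complex.exp (-t) • B w)).re := rfl
  rw [h6]
  nlinarith

/-- Here the quadratic term has the favourable sign, so no bound on ‖B‖² e^{-T} is required. -/
theorem le_norm_sub_exp_smul {B : E →L[ℂ] E} {m θ T : ℝ} (hθ1 : θ ≤ 1)
    (hθ : θ * ‖B‖ ≤ m / 4) (hB : ∀ w, (inner ℂ w (B w)).re ≤ -m * ‖w‖ ^ 2) (hm : 0 < m)
    (hT' : Real.exp (-T) * m ≤ 1) {t : ℂ} (ht : t ∈ strip T θ) (w : E) :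
    (1 + m / 8 * Real.exp (-t.re)) * ‖w‖ ≤ ‖w - Complex.exp (-t) • B w‖ := by
  have h0 := Real.exp_pos (-t.re)
  have hτ := Real.exp_le_exp.2 (neg_le_neg ht.1.le)
  have h1 := re_inner_exp_smul_ge (B := -B) hθ1 (by rwa [norm_neg])
    (fun w => by
      rw [_root_.neg_apply, inner_neg_right, Complex.neg_re]; linarith [hB w]) hm ht w
  rw [_root_.neg_apply, smul_neg, inner_neg_right, Complex.neg_re] at h1
  refine (sq_le_sq₀ (by positivity) (norm_nonneg _)).1 ?_
  rw [@norm_sub_sq ℂ]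
  have h6 : RCLike.re (inner ℂ w (Complex.exp (-t) • B w)) =
    (inner ℂ w (Complex.exp (-t) • B w)).re := rfl
  rw [h6]
  have h7 : (m / 8 * Real.exp (-t.re)) ^ 2 * ‖w‖ ^ 2 ≤
      m / 64 * Real.exp (-t.re) * ‖w‖ ^ 2 := by
    gcongr
    have h8 : m * Real.exp (-t.re) ≤ 1 := by nlinarith
    nlinarith [mul_pos hm h0]
  have h9 : 0 ≤ m * Real.exp (-t.re) * ‖w‖ ^ 2 := by positivity
  nlinarith [sq_nonneg ‖Complex.exp (-t) • B w‖]

end Hilbert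

end ParabolicManifolds
end
-- Slow systems in exponentially shrinking charts around an almost invariant curve.
noncomputable section
namespace ParabolicManifolds
open Metric Set

variable {E E' : Type*} [NormedAddCommGroup E] [NormedSpace ℂ E]
  [NormedAddCommGroup E'] [NormedSpace ℂ E']

/-- The defect of invariance of the curve `u = c(t)`. -/
def residual (B : E →L[ℂ] E) (a : ℂ × E → ℂ) (b : ℂ × E → E) (c : ℂ → E) (t : ℂ) : E :=
  Complex.exp t • (c t - c (t + Complex.exp (-t) * (1 + a (t, c t)))) - (B (c t) + b (t, c t))

/-- The chart `(t, W) ↦ (t, c(t) + e^{-βt} J W)` around the curve `u = c(t)`. -/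
def chart (β : ℝ) (c : ℂ → E) (J : E' ≃L[ℂ] E) (p : ℂ × E') : ℂ × E :=
  (p.1, c p.1 + Complex.exp (-(β * p.1)) • J p.2)

/-- The map of a slow system in the fibre coordinate of the chart. -/
def chartFiber (B : E →L[ℂ] E) (a : ℂ × E → ℂ) (b : ℂ × E → E) (β : ℝ) (c : ℂ → E)
    (J : E' ≃L[ℂ] E) (p : ℂ × E') : E' :=
  Complex.exp (β * (slowStep B a b (chart β c J p)).1) •
    J.symm ((slowStep B a b (chart β c J p)).2 - c (slowStep B a b (chart β c J p)).1)

/-- The linear part of a slow system in a chart. -/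
def chartLinear (B : E →L[ℂ] E) (β : ℝ) (J : E' ≃L[ℂ] E) : E' →L[ℂ] E' :=
  (J.symm : E →L[ℂ] E') ∘L B ∘L (J : E' →L[ℂ] E) - (β : ℂ) • ContinuousLinearMap.id ℂ E'

/-- The remainder of a slow system in a chart. -/
def chartRemainder (B : E →L[ℂ] E) (a : ℂ × E → ℂ) (b : ℂ × E → E) (β : ℝ) (c : ℂ → E)
    (J : E' ≃L[ℂ] E) (p : ℂ × E') : E' :=
  Complex.exp p.1 • (p.2 - chartFiber B a b β c J p) - chartLinear B β J p.2

/-- The conjugacy is exact because the remainder is defined by solving for it; all the content is in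
the estimate of that remainder. -/
theorem slowStep_chart (B : E →L[ℂ] E) (a : ℂ × E → ℂ) (b : ℂ × E → E) (β : ℝ) (c : ℂ → E)
    (J : E' ≃L[ℂ] E) (p : ℂ × E') :
    slowStep B a b (chart β c J p) = chart β c J
      (slowStep (chartLinear B β J) (a ∘ chart β c J) (chartRemainder B a b β c J) p) := by
  have h1 : (slowStep (chartLinear B β J) (a ∘ chart β c J) (chartRemainder B a b β c J) p).2 =
      chartFiber B a b β c J p := by
    simp only [slowStep, chartRemainder, add_sub_cancel]
    rw [smul_smul, ← Complex.exp_add, neg_add_cancel, Complex.exp_zero, one_smul, sub_sub_cancel]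
  have h2 : (slowStep (chartLinear B β J) (a ∘ chart β c J) (chartRemainder B a b β c J) p).1 =
      (slowStep B a b (chart β c J p)).1 := rfl
  refine Prod.ext h2.symm ?_
  simp only [chart]
  rw [h1, h2]
  rw [chartFiber, map_smul, smul_smul, ← Complex.exp_add, neg_add_cancel, Complex.exp_zero,
    one_smul, J.apply_symm_apply]
  simp [chart]

/-- Three kinds of small terms are separated. Since e^t h = 1 + a, the factor β - e^t(e^{βh} - 1) is
small; so is e^{βh} - 1; and the last bracket collects the residual of c together with increments of
b and c that are proportional to u - c(t) = e^{-βt} J W, so the prefactor e^{βt} leaves it bounded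
by a multiple of e^{-ηt}. -/
theorem chartRemainder_eq (B : E →L[ℂ] E) (a : ℂ × E → ℂ) (b : ℂ × E → E) (β : ℝ) (c : ℂ → E)
    (J : E' ≃L[ℂ] E) (t : ℂ) (W : E') (u : E) (h hc : ℂ)
    (hu : u = c t + Complex.exp (-(β * t)) • J W)
    (hh : h = Complex.exp (-t) * (1 + a (t, u)))
    (hhc : hc = Complex.exp (-t) * (1 + a (t, c t))) :
    chartRemainder B a b β c J (t, W) =
      (β - Complex.exp t * (Complex.exp (β * h) - 1)) • W +
      (Complex.exp (β * h) - 1) • J.symm (B (J W)) -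
      Complex.exp (β * h) • Complex.exp (β * t) • J.symm (residual B a b c t -
        (b (t, u) - b (t, c t)) - Complex.exp t • (c (t + h) - c (t + hc))) := by
  have e1 : Complex.exp t * Complex.exp (-t) = 1 := by rw [← Complex.exp_add]; simp
  have e2 : Complex.exp (β * t) * Complex.exp (-(β * t)) = 1 := by rw [← Complex.exp_add]; simp
  have hstep : slowStep B a b (chart β c J (t, W)) =
      (t + h, u - Complex.exp (-t) • (B u + b (t, u))) := by
    simp only [slowStep, chart, ← hu, ← hh]
  have h1 : chartFiber B a b β c J (t, W) = Complex.exp (β * h) • Complex.exp (β * t) •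
      J.symm (u - Complex.exp (-t) • (B u + b (t, u)) - c (t + h)) := by
    rw [chartFiber, hstep, smul_smul, ← Complex.exp_add]
    congr 2
    ring_nf
  have h2 : u - Complex.exp (-t) • (B u + b (t, u)) - c (t + h) =
      Complex.exp (-(β * t)) • (J W - Complex.exp (-t) • B (J W)) +
      Complex.exp (-t) • (residual B a b c t - (b (t, u) - b (t, c t)) -
        Complex.exp t • (c (t + h) - c (t + hc))) := by
    rw [residual, ← hhc]
    nth_rewrite 1 [hu]
    nth_rewrite 1 [hu]
    simp only [smul_sub, smul_add, smul_smul, map_add, map_smul, mul_comm (Complex.exp (-t)), e1,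
      one_smul]
    abel
  rw [chartRemainder, h1, h2]
  generalize hR : residual B a b c t - (b (t, u) - b (t, c t)) -
        Complex.exp t • (c (t + h) - c (t + hc)) = R
  simp only [chartLinear, map_add, map_sub, map_smul, smul_add, smul_sub, sub_smul, mul_smul,
    _root_.sub_apply, _root_.smul_apply, ContinuousLinearMap.comp_apply,
    ContinuousLinearMap.id_apply, ContinuousLinearEquiv.coe_coe, ContinuousLinearEquiv.symm_apply_apply]
  have e3 : ∀ x : E', Complex.exp (β * t) • Complex.exp (-(β * t)) • x = x := fun x => by
    rw [smul_smul, e2, one_smul]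
  have e4 : ∀ x : E', Complex.exp t • Complex.exp (-t) • x = x := fun x => by
    rw [smul_smul, e1, one_smul]
  have e5 : ∀ (z w : ℂ) (x : E'), z • w • x = w • z • x := fun z w x => smul_comm z w x
  rw [e3, e3, e5 (Complex.exp t) (Complex.exp (β * h)), e5 (Complex.exp t) (Complex.exp (β * h)),
    e5 (Complex.exp t) (Complex.exp (β * h)), e4, e5 (Complex.exp t) (Complex.exp (β * t)), e4]
  module

theorem exists_lipschitz_curve {T θ θ' η C : ℝ} (hη : 0 ≤ η) (hθ : θ' < θ) {c : ℂ → E}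
    (hc : DifferentiableOn ℂ c (strip T θ)) (hC : ∀ t ∈ strip T θ, ‖c t‖ ≤ C * Real.exp (-η * t.re)) :
    ∃ L, 0 ≤ L ∧ ∀ T', T + 1 ≤ T' → ∀ t ∈ strip T' θ', ∀ t' ∈ strip T' θ',
      ‖c t - c t'‖ ≤ L * Real.exp (-η * T') * ‖t - t'‖ := by
  obtain ⟨L, hL, h⟩ := exists_lipschitz_of_exp_bound (E := ℂ) (f := fun p => c p.1) (C := C)
    hη hθ (hc.comp differentiable_fst.differentiableOn fun p hp => hp.1)
    (fun p hp => hC p.1 hp.1)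
  refine ⟨L, hL, fun T' hT' t ht t' ht' => ?_⟩
  have := h T' hT' (t, 0) ⟨ht, by simp⟩ (t', 0) ⟨ht', by simp⟩
  simpa [Prod.norm_def] using this

/-- A slow system seen around an almost invariant curve is a slow system. -/
theorem SlowSystem.exists_chart {T θ₀ θ η C C₁ C₂ β : ℝ} {B : E →L[ℂ] E} {a : ℂ × E → ℂ}
    {b : ℂ × E → E} (H : SlowSystem T θ₀ η C a b) (hη : 0 < η) (hη1 : η ≤ 1)
    (hθ : θ < θ₀) (hβ : 0 < β) (J : E' ≃L[ℂ] E) {c : ℂ → E}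
    (hc : DifferentiableOn ℂ c (strip T θ₀))
    (hc1 : ∀ t ∈ strip T θ₀, ‖c t‖ ≤ C₁ * Real.exp (-η * t.re))
    (hc2 : ∀ t ∈ strip T θ₀, ‖residual B a b c t‖ ≤ C₂ * Real.exp (-(β + η) * t.re)) :
    ∃ T' C', T ≤ T' ∧ SlowSystem T' θ η C' (a ∘ chart β c J) (chartRemainder B a b β c J) ∧
      MapsTo (chart β c J) (strip T' θ ×ˢ ball 0 1) (strip T θ₀ ×ˢ ball (0 : E) 1) := by
  obtain ⟨La, hLa, ha⟩ := exists_lipschitz_fiber hη.le hθ H.diff_a H.bound_a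
  obtain ⟨Lb, hLb, hb⟩ := exists_lipschitz_fiber hη.le hθ H.diff_b H.bound_b
  obtain ⟨Lc, hLc, hcl⟩ : ∃ L, 0 ≤ L ∧ ∀ t ∈ strip (T + 1) ((θ + θ₀) / 2),
      ∀ t' ∈ strip (T + 1) ((θ + θ₀) / 2), ‖c t - c t'‖ ≤ L * ‖t - t'‖ := by
    obtain ⟨L, hL, h⟩ := exists_lipschitz_curve hη.le (by linarith : (θ + θ₀) / 2 < θ₀) hc hc1
    exact ⟨_, by positivity, h (T + 1) le_rfl⟩
  set j := ‖(J : E' →L[ℂ] E)‖ with hj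
  set j' := ‖(J.symm : E →L[ℂ] E')‖ with hj'
  set δ := min (1 / 2) ((θ₀ - θ) / 2) with hδ
  have hδ0 : 0 < δ := lt_min (by norm_num) (by linarith)
  have hδ1 : δ ≤ 1 / 2 := min_le_left _ _
  have hδ2 : δ ≤ (θ₀ - θ) / 2 := min_le_right _ _
  have e1 := (tendsto_const_mul_exp_neg one_pos 2).eventually (gt_mem_nhds hδ0)
  have e2 := (tendsto_const_mul_exp_neg hη |C|).eventually (gt_mem_nhds one_pos)
  have e3 := (tendsto_const_mul_exp_neg hη |C₁|).eventually
    (gt_mem_nhds (by norm_num : (0 : ℝ) < 1 / 4))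
  have e4 := (tendsto_const_mul_exp_neg hβ j).eventually
    (gt_mem_nhds (by norm_num : (0 : ℝ) < 1 / 4))
  have e5 := (tendsto_const_mul_exp_neg one_pos (2 * β)).eventually
    (gt_mem_nhds (by norm_num : (0 : ℝ) < 1 / 2))
  obtain ⟨T', h1, h2, h3, h4, h5, h6, h7⟩ := (e1.and (e2.and (e3.and (e4.and (e5.and
    ((eventually_ge_atTop (T + 2)).and (eventually_ge_atTop 0))))))).exists
  have hexp : ∀ {s : ℝ} (_ : 0 < s) {t : ℂ} (_ : t ∈ strip T' θ) {X y : ℝ} (_ : 0 ≤ X)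
      (_ : X * Real.exp (-s * T') < y), X * Real.exp (-s * t.re) < y := by
    intro s hs t ht X y hX h
    refine lt_of_le_of_lt (mul_le_mul_of_nonneg_left ?_ hX) h
    rw [Real.exp_le_exp]; nlinarith [ht.1]
  have hstrip : strip T' θ ⊆ strip T θ₀ := strip_subset_strip (by linarith) hθ.le
  have hsmall : ∀ t ∈ strip T' θ, ‖c t‖ < 1 / 4 := fun t ht => by
    refine (hc1 t (hstrip ht)).trans_lt ?_
    refine lt_of_le_of_lt ?_ (hexp hη ht (abs_nonneg C₁) h3)
    gcongr
    exact le_abs_self _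
  have hexpβ : ∀ t : ℂ, ‖Complex.exp (-(β * t))‖ = Real.exp (-β * t.re) := fun t => by
    rw [norm_exp_neg]; simp
  have hJ : ∀ t ∈ strip T' θ, ∀ W ∈ ball (0 : E') 1,
      ‖Complex.exp (-(β * t)) • J W‖ ≤ j * Real.exp (-β * t.re) := fun t ht W hW => by
    rw [norm_smul, hexpβ, mul_comm]
    gcongr
    have := (J : E' →L[ℂ] E).le_opNorm W
    rw [mem_ball_zero_iff] at hW
    exact this.trans (mul_le_of_le_one_right (norm_nonneg _) hW.le)
  have hJ' : ∀ t ∈ strip T' θ, ∀ W ∈ ball (0 : E') 1,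
      ‖Complex.exp (-(β * t)) • J W‖ < 1 / 4 := fun t ht W hW =>
    (hJ t ht W hW).trans_lt (hexp hβ ht (norm_nonneg _) h4)
  have hmem : ∀ t ∈ strip T' θ, ∀ W ∈ ball (0 : E') 1,
      c t + Complex.exp (-(β * t)) • J W ∈ ball (0 : E) (1 / 2) := fun t ht W hW => by
    rw [mem_ball_zero_iff]
    refine (norm_add_le _ _).trans_lt ?_
    linarith [hsmall t ht, hJ' t ht W hW]
  have hmaps : MapsTo (chart β c J) (strip T' θ ×ˢ ball 0 1) (strip T θ₀ ×ˢ ball (0 : E) 1) :=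
    fun p hp => ⟨hstrip hp.1, ball_subset_ball (by norm_num) (hmem p.1 hp.1 p.2 hp.2)⟩
  have hC : ∀ t ∈ strip T' θ, ∀ u ∈ ball (0 : E) 1, ‖a (t, u)‖ ≤ |C| * Real.exp (-η * t.re) :=
    fun t ht u hu => (H.bound_a (t, u) ⟨hstrip ht, hu⟩).trans (by gcongr; exact le_abs_self C)
  have hh : ∀ t ∈ strip T' θ, ∀ u ∈ ball (0 : E) 1,
      ‖Complex.exp (-t) * (1 + a (t, u))‖ ≤ 2 * Real.exp (-t.re) := by
    intro t ht u hu
    have h8 := (hC t ht u hu).trans_lt (hexp hη ht (abs_nonneg C) h2)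
    have h9 := norm_add_le 1 (a (t, u))
    rw [norm_one] at h9
    rw [norm_mul, norm_exp_neg, mul_comm]
    gcongr
    linarith
  have hstep : ∀ t ∈ strip T' θ, ∀ u ∈ ball (0 : E) 1,
      t + Complex.exp (-t) * (1 + a (t, u)) ∈ strip (T + 1) ((θ + θ₀) / 2) := by
    intro t ht u hu
    refine ball_subset_strip (r := δ) (T' := T') (θ' := θ) (by linarith) (by linarith) ht ?_
    rw [mem_ball, dist_eq_norm, add_sub_cancel_left]
    refine (hh t ht u hu).trans_lt ?_
    have := hexp one_pos ht (by norm_num : (0 : ℝ) ≤ 2) h1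
    simpa using this
  have hdchart : DifferentiableOn ℂ (chart β c J) (strip T' θ ×ˢ ball 0 1) := by
    refine differentiable_fst.differentiableOn.prodMk (DifferentiableOn.add ?_ ?_)
    · exact (hc.mono hstrip).comp differentiable_fst.differentiableOn fun p hp => hp.1
    · refine Differentiable.differentiableOn ?_
      have : Differentiable ℂ fun p : ℂ × E' => Complex.exp (-(β * p.1)) := by fun_prop
      exact this.smul (J.differentiable.comp differentiable_snd)
  have hda : DifferentiableOn ℂ (a ∘ chart β c J) (strip T' θ ×ˢ ball 0 1) :=
    H.diff_a.comp hdchart hmaps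
  have hdb : DifferentiableOn ℂ (b ∘ chart β c J) (strip T' θ ×ˢ ball 0 1) :=
    H.diff_b.comp hdchart hmaps
  have hdstep1 : DifferentiableOn ℂ (fun p => (slowStep B a b (chart β c J p)).1)
      (strip T' θ ×ˢ ball 0 1) := by
    have : Differentiable ℂ fun p : ℂ × E' => Complex.exp (-p.1) := by fun_prop
    exact differentiable_fst.differentiableOn.add (this.differentiableOn.mul (hda.const_add 1))
  have hdstep2 : DifferentiableOn ℂ (fun p => (slowStep B a b (chart β c J p)).2)
      (strip T' θ ×ˢ ball 0 1) := by
    have : Differentiable ℂ fun p : ℂ × E' => Complex.exp (-p.1) := by fun_prop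
    exact hdchart.snd.sub (this.differentiableOn.smul
      ((B.differentiable.comp_differentiableOn hdchart.snd).add hdb))
  have hdfib : DifferentiableOn ℂ (chartFiber B a b β c J) (strip T' θ ×ˢ ball 0 1) := by
    refine DifferentiableOn.smul (hdstep1.const_mul _).cexp ?_
    refine J.symm.differentiable.comp_differentiableOn (hdstep2.sub ?_)
    refine hc.comp hdstep1 fun p hp => ?_
    exact strip_subset_strip (by linarith) (by linarith)
      (hstep p.1 hp.1 _ (ball_subset_ball (by norm_num) (hmem p.1 hp.1 p.2 hp.2)))
  set NB := ‖(J.symm : E →L[ℂ] E') ∘L B ∘L (J : E' →L[ℂ] E)‖ with hNB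
  -- The three summands bound the three terms of `chartRemainder_eq`; |C| bounds the time
  -- perturbation.
  refine ⟨T', max |C| ((4 * β ^ 2 + β * |C|) + 4 * β * NB + 2 * (j' * (|C₂| + Lb * j +
    Lc * La * j))), by linarith, ⟨hda, ?_, fun p hp => ?_, fun p hp => ?_⟩, hmaps⟩
  · have : Differentiable ℂ fun p : ℂ × E' => Complex.exp p.1 := by fun_prop
    exact (this.differentiableOn.smul (differentiable_snd.differentiableOn.sub hdfib)).sub
      ((chartLinear B β J).differentiable.comp differentiable_snd).differentiableOn
  · refine (hC p.1 hp.1 _ (hmaps hp).2).trans ?_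
    gcongr
    exact le_max_left _ _
  · obtain ⟨t, W⟩ := p
    obtain ⟨ht, hW⟩ := hp
    simp only at ht hW ⊢
    set u := c t + Complex.exp (-(β * t)) • J W with hu
    set h := Complex.exp (-t) * (1 + a (t, u)) with hhdef
    set h' := Complex.exp (-t) * (1 + a (t, c t)) with hhdef'
    have hu2 : u ∈ ball (0 : E) (1 / 2) := hmem t ht W hW
    have hc2' : c t ∈ ball (0 : E) (1 / 2) := by
      rw [mem_ball_zero_iff]; linarith [hsmall t ht]
    have hu1 : u ∈ ball (0 : E) 1 := ball_subset_ball (by norm_num) hu2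
    have hc1' : c t ∈ ball (0 : E) 1 := ball_subset_ball (by norm_num) hc2'
    have hW1 : ‖W‖ ≤ 1 := (mem_ball_zero_iff.1 hW).le
    have ht2 : t ∈ strip (T + 2) θ := strip_subset_strip h6 le_rfl ht
    set τ := Real.exp (-t.re) with hτ
    set e := Real.exp (-η * t.re) with he
    have hτ0 : 0 < τ := Real.exp_pos _
    have he0 : 0 < e := Real.exp_pos _
    have hτe : τ ≤ e := by
      rw [hτ, he, Real.exp_le_exp]; nlinarith [ht.1]
    have hhn : ‖h‖ ≤ 2 * τ := hh t ht u hu1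
    have hβh : ‖(β : ℂ) * h‖ ≤ 2 * β * τ := by
      rw [norm_mul, Complex.norm_real, Real.norm_of_nonneg hβ.le]; nlinarith
    have hβτ : 2 * β * τ ≤ 1 / 2 := by
      have := (hexp one_pos ht (by positivity : (0 : ℝ) ≤ 2 * β) h5).le
      simpa [hτ] using this
    have hx1 : ‖Complex.exp (β * h) - 1‖ ≤ 4 * β * τ := by
      refine (Complex.norm_exp_sub_one_le (by linarith)).trans (by linarith)
    have hx2 : ‖Complex.exp (β * h)‖ ≤ 2 := by
      have := norm_add_le (Complex.exp (β * h) - 1) 1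
      rw [sub_add_cancel, norm_one] at this
      linarith
    have hx3 : ‖Complex.exp (β * h) - 1 - β * h‖ ≤ (2 * β * τ) ^ 2 :=
      (Complex.norm_exp_sub_one_sub_id_le (by linarith)).trans (by gcongr)
    have hexpt : ‖Complex.exp t‖ = τ⁻¹ := by rw [Complex.norm_exp, hτ, Real.exp_neg, inv_inv]
    have ee : Complex.exp t * Complex.exp (-t) = 1 := by rw [← Complex.exp_add]; simp
    have hy1 : ‖(β : ℂ) - Complex.exp t * (Complex.exp (β * h) - 1)‖ ≤
        (4 * β ^ 2 + β * |C|) * e := by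
      have : (β : ℂ) - Complex.exp t * (Complex.exp (β * h) - 1) =
          -(Complex.exp t * (Complex.exp (β * h) - 1 - β * h)) - β * a (t, u) := by
        rw [hhdef]
        linear_combination (-(β : ℂ) * (1 + a (t, u))) * ee
      rw [this]
      refine (norm_sub_le _ _).trans ?_
      rw [norm_neg, norm_mul, norm_mul, hexpt, Complex.norm_real, Real.norm_of_nonneg hβ.le,
        add_mul]
      refine add_le_add ?_ ?_
      · calc _ ≤ τ⁻¹ * (2 * β * τ) ^ 2 := by gcongr
          _ = 4 * β ^ 2 * τ := by field_simp; ring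
          _ ≤ _ := by gcongr
      · rw [mul_assoc]; gcongr; exact hC t ht u hu1
    have hy2 : ‖Complex.exp (β * t)‖ = (Real.exp (-β * t.re))⁻¹ := by
      rw [Complex.norm_exp, ← Real.exp_neg]; simp
    have hd := hJ t ht W hW
    have huc : u - c t = Complex.exp (-(β * t)) • J W := by rw [hu, add_sub_cancel_left]
    have hy3 := hb t ht2 u hu2 (c t) hc2'
    have hy4 := ha t ht2 u hu2 (c t) hc2'
    rw [huc] at hy3 hy4
    have hy5 : ‖Complex.exp t • (c (t + h) - c (t + h'))‖ ≤
        Lc * La * j * e * Real.exp (-β * t.re) := by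
      have h8 := hcl _ (hstep t ht u hu1) _ (hstep t ht (c t) hc1')
      have h9 : t + h - (t + h') = Complex.exp (-t) * (a (t, u) - a (t, c t)) := by
        rw [hhdef, hhdef']; ring
      rw [← hhdef, ← hhdef', h9, norm_mul, norm_exp_neg] at h8
      rw [norm_smul, hexpt]
      calc _ ≤ τ⁻¹ * (Lc * (τ * (La * e * (j * Real.exp (-β * t.re))))) := by
            gcongr
            refine h8.trans ?_
            gcongr
            exact hy4.trans (by gcongr)
        _ = Lc * La * j * e * Real.exp (-β * t.re) := by
            field_simp
    have hy6 : ‖residual B a b c t - (b (t, u) - b (t, c t)) -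
        Complex.exp t • (c (t + h) - c (t + h'))‖ ≤
        (|C₂| + Lb * j + Lc * La * j) * e * Real.exp (-β * t.re) := by
      refine (norm_sub_le _ _).trans ((add_le_add (norm_sub_le _ _) hy5).trans ?_)
      have h8 : ‖residual B a b c t‖ ≤ |C₂| * e * Real.exp (-β * t.re) := by
        refine (hc2 t (hstrip ht)).trans ?_
        rw [mul_assoc, he, ← Real.exp_add]
        have : -(β + η) * t.re = -η * t.re + -β * t.re := by ring
        rw [this]
        gcongr
        exact le_abs_self _
      have h9 : ‖b (t, u) - b (t, c t)‖ ≤ Lb * j * e * Real.exp (-β * t.re) := by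
        refine hy3.trans ?_
        calc _ ≤ Lb * e * (j * Real.exp (-β * t.re)) := by gcongr
          _ = _ := by ring
      linarith
    rw [chartRemainder_eq B a b β c J t W u h h' hu hhdef hhdef']
    refine (norm_sub_le _ _).trans ((add_le_add (norm_add_le _ _) le_rfl).trans ?_)
    have z1 : ‖((β : ℂ) - Complex.exp t * (Complex.exp (β * h) - 1)) • W‖ ≤
        (4 * β ^ 2 + β * |C|) * e := by
      rw [norm_smul]
      calc _ ≤ (4 * β ^ 2 + β * |C|) * e * 1 := by gcongr
        _ = _ := mul_one _
    have z2 : ‖(Complex.exp (β * h) - 1) • J.symm (B (J W))‖ ≤ 4 * β * NB * e := by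
      rw [norm_smul]
      have h8 : ‖J.symm (B (J W))‖ ≤ NB :=
        (((J.symm : E →L[ℂ] E') ∘L B ∘L (J : E' →L[ℂ] E)).le_opNorm W).trans
          (mul_le_of_le_one_right (norm_nonneg _) hW1)
      calc _ ≤ 4 * β * e * NB := by
            gcongr
            exact hx1.trans (by gcongr)
        _ = _ := by ring
    have z3 : ‖Complex.exp (β * h) • Complex.exp (β * t) • J.symm (residual B a b c t -
        (b (t, u) - b (t, c t)) - Complex.exp t • (c (t + h) - c (t + h')))‖ ≤
        2 * (j' * (|C₂| + Lb * j + Lc * La * j)) * e := by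
      rw [norm_smul, norm_smul, hy2]
      have h8 := (J.symm : E →L[ℂ] E').le_opNorm (residual B a b c t -
        (b (t, u) - b (t, c t)) - Complex.exp t • (c (t + h) - c (t + h')))
      have hpos := Real.exp_pos (-β * t.re)
      calc _ ≤ 2 * ((Real.exp (-β * t.re))⁻¹ * (j' * ((|C₂| + Lb * j + Lc * La * j) * e *
            Real.exp (-β * t.re)))) := by
            gcongr
            exact h8.trans (by gcongr)
        _ = _ := by field_simp
    calc _ ≤ (4 * β ^ 2 + β * |C|) * e + 4 * β * NB * e +
          2 * (j' * (|C₂| + Lb * j + Lc * La * j)) * e := add_le_add (add_le_add z1 z2) z3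
      _ = ((4 * β ^ 2 + β * |C|) + 4 * β * NB + 2 * (j' * (|C₂| + Lb * j + Lc * La * j))) * e := by
          ring
      _ ≤ _ := by gcongr; exact le_max_right _ _

end ParabolicManifolds
end
-- The linear equation d' = -Bd + R with exponentially decaying right-hand side.
noncomputable section
namespace ParabolicManifolds
open Metric Set

variable {E : Type*} [NormedAddCommGroup E] [NormedSpace ℂ E]

theorem mul_exp_neg_le {x : ℝ} (y : ℝ) {δ : ℝ} (hδ : 0 < δ) (hx : x ≤ y) :
    Real.exp (-δ * y) ≤ Real.exp (-δ * x) := by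
  rw [Real.exp_le_exp]; nlinarith

/-- The scalar linear equation `e' = -λ e + R` in a strip. -/
theorem exists_solution_scalar [CompleteSpace E] {T θ σ σ' C : ℝ} (hσ : σ' < σ) (l : ℂ)
    {R : ℂ → E} (hR : DifferentiableOn ℂ R (strip T θ))
    (hC : ∀ t ∈ strip T θ, ‖R t‖ ≤ C * Real.exp (-σ * t.re)) :
    ∃ (e : ℂ → E) (C' : ℝ), (∀ t ∈ strip (T + 1) θ, HasDerivAt e (-(l • e t) + R t) t) ∧
      (∀ t ∈ strip (T + 1) θ, ‖e t‖ ≤ C' * Real.exp (-σ' * t.re)) ∧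
      ∀ L : E →L[ℂ] E, (∀ t ∈ strip T θ, L (R t) = 0) → ∀ t ∈ strip (T + 1) θ, L (e t) = 0 := by
  rcases le_or_gt θ 0 with hθ | hθ
  · have hempty : ∀ t, t ∉ strip (T + 1) θ := fun t ht =>
      absurd ht.2 (not_lt.2 (hθ.trans (abs_nonneg _)))
    exact ⟨0, 0, fun t ht => (hempty t ht).elim, fun t ht => (hempty t ht).elim,
      fun _ _ t ht => (hempty t ht).elim⟩
  set t₀ : ℂ := ((T + 1 : ℝ) : ℂ) with ht₀
  have ht₀m : t₀ ∈ strip T θ := ⟨by simp [ht₀], by simpa [ht₀] using hθ⟩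
  have hsub : strip (T + 1) θ ⊆ strip T θ := strip_subset_strip (by linarith) le_rfl
  -- Variation of constants: e = e^{-lt} G with G' = e^{lt} R, whose size is at most K e^{ν Re t}
  -- with ν = Re l - σ. The sign of ν decides where the integration starts.
  set f : ℂ → E := fun t => Complex.exp (l * t) • R t with hf
  have hfd : DifferentiableOn ℂ f (strip T θ) :=
    DifferentiableOn.smul (by fun_prop : Differentiable ℂ fun t => Complex.exp (l * t)).differentiableOn
      hR
  obtain ⟨G₀, hG₀⟩ := (convex_strip T θ).exists_forall_hasDerivWithinAt hfd
  set G : ℂ → E := fun t => G₀ t - G₀ t₀ with hGdef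
  have hG : ∀ t ∈ strip T θ, HasDerivAt G (f t) t := fun t ht =>
    ((hG₀ t ht).hasDerivAt ((isOpen_strip T θ).mem_nhds ht)).sub_const _
  have hGt₀ : G t₀ = 0 := sub_self _
  set ν := l.re - σ with hν
  set K := |C| * Real.exp (‖l‖ * θ) with hK
  have hK0 : 0 ≤ K := by positivity
  have hexpim : ∀ t ∈ strip T θ, ‖Complex.exp (l * t)‖ ≤ Real.exp (‖l‖ * θ) * Real.exp (l.re * t.re) ∧
      ‖Complex.exp (-(l * t))‖ ≤ Real.exp (‖l‖ * θ) * Real.exp (-l.re * t.re) := by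
    intro t ht
    have h1 : |l.im * t.im| ≤ ‖l‖ * θ := by
      rw [abs_mul]
      have := Complex.abs_im_le_norm l
      have := ht.2.le
      gcongr
    rw [Complex.norm_exp, Complex.norm_exp, ← Real.exp_add, ← Real.exp_add, Real.exp_le_exp,
      Real.exp_le_exp, Complex.neg_re, Complex.mul_re]
    constructor <;> linarith [(abs_le.1 h1).1, (abs_le.1 h1).2]
  have hfb : ∀ t ∈ strip T θ, ‖f t‖ ≤ K * Real.exp (ν * t.re) := by
    intro t ht
    rw [hf, norm_smul]
    calc _ ≤ (Real.exp (‖l‖ * θ) * Real.exp (l.re * t.re)) * (|C| * Real.exp (-σ * t.re)) := by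
          gcongr
          · exact (hexpim t ht).1
          · exact (hC t ht).trans (by gcongr; exact le_abs_self C)
      _ = |C| * Real.exp (‖l‖ * θ) * (Real.exp (l.re * t.re) * Real.exp (-σ * t.re)) := by ring
      _ = _ := by rw [← Real.exp_add, hK, hν]; ring_nf
  -- A linear map that kills R kills the primitive. The induction over the factors of the
  -- characteristic polynomial needs this.
  have hLG : ∀ L : E →L[ℂ] E, (∀ t ∈ strip T θ, L (R t) = 0) → ∀ t ∈ strip T θ, L (G t) = 0 := by
    intro L hL t ht
    have := (convex_strip T θ).norm_image_sub_le_of_norm_hasDerivWithin_le (C := 0)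
      (f := fun t => L (G t)) (f' := fun t => L (f t))
      (fun z hz => (L.hasFDerivAt.comp_hasDerivAt z (hG z hz)).hasDerivWithinAt)
      (fun z hz => by simp [hf, hL z hz]) ht₀m ht
    simpa [hGt₀] using this
  have hsol : ∀ G : ℂ → E, (∀ t ∈ strip T θ, HasDerivAt G (f t) t) → ∀ t ∈ strip T θ,
      HasDerivAt (fun t => Complex.exp (-(l * t)) • G t)
        (-(l • Complex.exp (-(l * t)) • G t) + R t) t := by
    intro G hG t ht
    have h1 : HasDerivAt (fun t => Complex.exp (-(l * t))) (Complex.exp (-(l * t)) * -(l * 1)) t :=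
      ((hasDerivAt_id t).const_mul l).neg.cexp
    refine (h1.smul (hG t ht)).congr_deriv ?_
    rw [hf]
    simp only [smul_smul, ← Complex.exp_add]
    rw [neg_add_cancel, Complex.exp_zero, one_smul, add_comm, mul_one, mul_neg, neg_smul,
      mul_comm (Complex.exp (-(l * t))) l]
  rcases le_or_gt 0 ν with hν0 | hν0
  -- For ν ≥ 0 the integration starts at the finite point t₀. The length of the path contributes a
  -- factor linear in Re t, which is absorbed by e^{δ Re t}; this covers the resonant case ν = 0.
  · set δ := σ - σ' with hδ
    have hδ0 : 0 < δ := by linarith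
    refine ⟨fun t => Complex.exp (-(l * t)) • G t,
      Real.exp (‖l‖ * θ) * K * ((1 / δ + θ) * Real.exp (-δ * (T + 1))),
      fun t ht => hsol G hG t (hsub ht), fun t ht => ?_, fun L hL t ht => ?_⟩
    · have hseg : ‖G t‖ ≤ K * Real.exp (ν * t.re) * ‖t - t₀‖ := by
        have hc : Convex ℝ (strip T θ ∩ {z | z.re ≤ t.re}) :=
          (convex_strip T θ).inter (convex_halfSpace_re_le t.re)
        have := hc.norm_image_sub_le_of_norm_hasDerivWithin_le
          (fun z hz => (hG z hz.1).hasDerivWithinAt)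
          (fun z hz => (hfb z hz.1).trans (mul_le_mul_of_nonneg_left (Real.exp_le_exp.2
            (mul_le_mul_of_nonneg_left hz.2 hν0)) hK0))
          (x := t₀) ⟨ht₀m, show t₀.re ≤ t.re by simpa [ht₀] using ht.1.le⟩
          (y := t) ⟨hsub ht, le_refl t.re⟩
        simpa [hGt₀] using this
      have hdist : ‖t - t₀‖ ≤ (t.re - (T + 1)) + θ := by
        refine (Complex.norm_le_abs_re_add_abs_im _).trans ?_
        simp only [ht₀, Complex.sub_re, Complex.sub_im, Complex.ofReal_re, Complex.ofReal_im,
          sub_zero]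
        rw [abs_of_pos (by linarith [ht.1])]
        linarith [ht.2]
      have hx : (t.re - (T + 1)) + θ ≤ (1 / δ + θ) * Real.exp (δ * (t.re - (T + 1))) := by
        have h1 := Real.add_one_le_exp (δ * (t.re - (T + 1)))
        have h2 : 0 ≤ t.re - (T + 1) := by linarith [ht.1]
        have h3 : t.re - (T + 1) ≤ 1 / δ * Real.exp (δ * (t.re - (T + 1))) := by
          rw [div_mul_eq_mul_div, le_div_iff₀ hδ0]; linarith
        have h4 : 1 ≤ Real.exp (δ * (t.re - (T + 1))) := Real.one_le_exp (by positivity)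
        nlinarith
      rw [norm_smul]
      calc _ ≤ (Real.exp (‖l‖ * θ) * Real.exp (-l.re * t.re)) * (K * Real.exp (ν * t.re) *
            ((1 / δ + θ) * Real.exp (δ * (t.re - (T + 1))))) := by
            gcongr
            · exact (hexpim t (hsub ht)).2
            · exact hseg.trans (by gcongr; exact hdist.trans hx)
        _ = Real.exp (‖l‖ * θ) * K * (1 / δ + θ) * (Real.exp (-l.re * t.re) *
            Real.exp (ν * t.re) * Real.exp (δ * (t.re - (T + 1)))) := by ring
        _ = Real.exp (‖l‖ * θ) * K * (1 / δ + θ) * (Real.exp (-δ * (T + 1)) *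
            Real.exp (-σ' * t.re)) := by
            rw [← Real.exp_add, ← Real.exp_add, ← Real.exp_add, hν, hδ]; ring_nf
        _ = _ := by ring
    · rw [map_smul, hLG L hL t (hsub ht), smul_zero]
  -- For ν < 0 the integrand decays, so the constant of integration is chosen to make G vanish at
  -- infinity; the limit is obtained along t + n and does not depend on t.
  · have hshift : ∀ t ∈ strip T θ, ∀ r : ℝ, 0 ≤ r → t + r ∈ strip T θ := fun t ht r hr =>
      ⟨by simpa using ht.1.trans_le (by linarith), by simpa using ht.2⟩
    have hbound : ∀ t ∈ strip T θ, ∀ r : ℝ, 0 ≤ r →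
        ‖G (t + r) - G t‖ ≤ K / (-ν) * Real.exp (ν * t.re) := by
      intro t ht r hr
      have hder : ∀ x : ℝ, 0 ≤ x → HasDerivAt (fun r : ℝ => G (t + r) - G t) (f (t + x)) x := by
        intro x hx
        have h1 : HasDerivAt (fun r : ℝ => t + (r : ℂ)) 1 x :=
          (Complex.ofRealCLM.hasDerivAt).const_add t
        have h2 := (hG (t + x) (hshift t ht x hx)).scomp x h1
        simpa using h2.sub_const (G t)
      have := image_norm_le_of_norm_deriv_right_le_deriv_boundary (a := 0) (b := r)
        (f := fun r : ℝ => G (t + r) - G t) (f' := fun x : ℝ => f (t + x))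
        (B := fun x => K / (-ν) * Real.exp (ν * t.re) * (1 - Real.exp (ν * x)))
        (B' := fun x => K / (-ν) * Real.exp (ν * t.re) * (-(Real.exp (ν * x) * (ν * 1))))
        (fun x hx => (hder x hx.1).continuousAt.continuousWithinAt)
        (fun x hx => (hder x hx.1).hasDerivWithinAt) (by simp)
        (fun x => (((hasDerivAt_id x).const_mul ν).exp.const_sub 1).const_mul _)
        (fun x hx => by
          refine (hfb _ (hshift t ht x hx.1)).trans_eq ?_
          have : (t + (x : ℂ)).re = t.re + x := by simp
          have hν1 := hν0.ne
          rw [this, mul_add, Real.exp_add]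
          field_simp)
        (x := r) ⟨hr, le_rfl⟩
      refine this.trans ?_
      have h3 : 0 ≤ K / (-ν) * Real.exp (ν * t.re) := by
        have : 0 < -ν := by linarith
        positivity
      have h4 := Real.exp_pos (ν * r)
      nlinarith
    have hzero : ∀ x : ℝ, Tendsto (fun n : ℕ => Real.exp (ν * (x + n))) atTop (𝓝 0) := by
      intro x
      refine Real.tendsto_exp_atBot.comp ?_
      exact (tendsto_atTop_add_const_left _ x tendsto_natCast_atTop_atTop).const_mul_atTop_of_neg hν0
    have hcau : CauchySeq fun n : ℕ => G (t₀ + n) := by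
      refine cauchySeq_of_le_tendsto_0' (fun n : ℕ => K / (-ν) * Real.exp (ν * (t₀.re + n)))
        (fun n m hnm => ?_) (by simpa using (hzero t₀.re).const_mul (K / (-ν)))
      obtain ⟨k, rfl⟩ := Nat.exists_eq_add_of_le hnm
      have := hbound (t₀ + (n : ℝ)) (hshift t₀ ht₀m n (Nat.cast_nonneg n)) k (Nat.cast_nonneg k)
      rw [dist_comm, dist_eq_norm]
      have e1 : t₀ + ((n : ℝ) : ℂ) + ((k : ℝ) : ℂ) = t₀ + ((n + k : ℕ) : ℂ) := by
        push_cast; ring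
      rw [e1] at this
      simpa using this
    obtain ⟨Gi, hGi⟩ := cauchySeq_tendsto_of_complete hcau
    have hGi' : ∀ t ∈ strip T θ, Tendsto (fun n : ℕ => G (t + n)) atTop (𝓝 Gi) := by
      intro t ht
      have h1 : Tendsto (fun n : ℕ => G (t + n) - G (t₀ + n)) atTop (𝓝 0) := by
        rw [tendsto_zero_iff_norm_tendsto_zero]
        refine squeeze_zero (fun _ => norm_nonneg _) (fun n => ?_)
          (g := fun n : ℕ => K * Real.exp (ν * (T + n)) * ‖t - t₀‖)
          (by simpa using ((hzero T).const_mul K).mul_const ‖t - t₀‖)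
        have hsh : ∀ z ∈ strip T θ, z + (n : ℂ) ∈ strip (T + n) θ := fun z hz =>
          ⟨by simpa using hz.1, by simpa using hz.2⟩
        have hsn : strip (T + n) θ ⊆ strip T θ := strip_subset_strip (by simp) le_rfl
        have := (convex_strip (T + n) θ).norm_image_sub_le_of_norm_hasDerivWithin_le
          (fun z hz => (hG z (hsn hz)).hasDerivWithinAt)
          (fun z hz => (hfb z (hsn hz)).trans (mul_le_mul_of_nonneg_left (Real.exp_le_exp.2
            (mul_le_mul_of_nonpos_left hz.1.le hν0.le)) hK0))
          (hsh t₀ ht₀m) (hsh t ht)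
        simpa using this
      simpa using h1.add hGi
    have hGGi : ∀ t ∈ strip T θ, ‖G t - Gi‖ ≤ K / (-ν) * Real.exp (ν * t.re) := by
      intro t ht
      have h1 : Tendsto (fun n : ℕ => ‖G (t + n) - G t‖) atTop (𝓝 ‖Gi - G t‖) :=
        ((hGi' t ht).sub_const _).norm
      rw [norm_sub_rev]
      refine le_of_tendsto' h1 fun n => ?_
      simpa using hbound t ht n (Nat.cast_nonneg n)
    refine ⟨fun t => Complex.exp (-(l * t)) • (G t - Gi),
      Real.exp (‖l‖ * θ) * (K / (-ν)) * Real.exp (-(σ - σ') * (T + 1)),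
      fun t ht => hsol _ (fun t ht => (hG t ht).sub_const Gi) t (hsub ht), fun t ht => ?_,
      fun L hL t ht => ?_⟩
    · rw [norm_smul]
      have hν' : 0 < -ν := by linarith
      calc _ ≤ (Real.exp (‖l‖ * θ) * Real.exp (-l.re * t.re)) *
            (K / (-ν) * Real.exp (ν * t.re)) := by
            gcongr
            · exact (hexpim t (hsub ht)).2
            · exact hGGi t (hsub ht)
        _ = Real.exp (‖l‖ * θ) * (K / (-ν)) * (Real.exp (-l.re * t.re) * Real.exp (ν * t.re)) := by
            ring
        _ = Real.exp (‖l‖ * θ) * (K / (-ν)) * (Real.exp (-(σ - σ') * t.re) *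
            Real.exp (-σ' * t.re)) := by
            rw [← Real.exp_add, ← Real.exp_add, hν]; ring_nf
        _ ≤ Real.exp (‖l‖ * θ) * (K / (-ν)) * (Real.exp (-(σ - σ') * (T + 1)) *
            Real.exp (-σ' * t.re)) := by
            refine mul_le_mul_of_nonneg_left (mul_le_mul_of_nonneg_right
              (mul_exp_neg_le _ (sub_pos.2 hσ) ht.1.le) (Real.exp_nonneg _)) ?_
            positivity
        _ = _ := by ring
    · have hLi : L Gi = 0 := by
        have h1 : Tendsto (fun n : ℕ => L (G (t₀ + n))) atTop (𝓝 (L Gi)) :=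
          (L.continuous.tendsto _).comp hGi
        refine tendsto_nhds_unique h1 ?_
        have h2 : ∀ n : ℕ, L (G (t₀ + n)) = 0 := fun n => by
          have := hLG L hL (t₀ + (n : ℝ)) (hshift t₀ ht₀m n (Nat.cast_nonneg n))
          simpa using this
        simp only [h2]
        exact tendsto_const_nhds
      rw [map_smul, map_sub, hLG L hL t (hsub ht), hLi, sub_zero, smul_zero]

/-- Induction on the factors, with S = B - l the first one. If e solves e' = -le + R, and d solves
d' = -Bd + Se, then e - d solves the equation for B. The right-hand side Se is killed by the product
of the remaining factors, because the factors commute and R is killed by the full product. -/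
theorem exists_solution_of_prod_eq_zero [CompleteSpace E] (B : E →L[ℂ] E) {θ : ℝ} (ls : List ℂ) :
    ∀ {T σ σ' C : ℝ} (_ : σ' < σ) {R : ℂ → E} (_ : DifferentiableOn ℂ R (strip T θ))
      (_ : ∀ t ∈ strip T θ, ‖R t‖ ≤ C * Real.exp (-σ * t.re))
      (_ : ∀ t ∈ strip T θ, (ls.map fun l => B - l • (1 : E →L[ℂ] E)).prod (R t) = 0),
    ∃ (T' : ℝ) (d : ℂ → E) (C' : ℝ), T ≤ T' ∧
      (∀ t ∈ strip T' θ, HasDerivAt d (-B (d t) + R t) t) ∧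
      (∀ t ∈ strip T' θ, ‖d t‖ ≤ C' * Real.exp (-σ' * t.re)) := by
  induction ls with
  | nil =>
    intro T σ σ' C _ R _ _ h
    refine ⟨T, 0, 0, le_rfl, fun t ht => ?_, fun t _ => by simp⟩
    have : R t = 0 := by simpa using h t ht
    simp [this]
  | cons l ls ih =>
    intro T σ σ' C hσ R hR hC h
    set Q := (ls.map fun l => B - l • (1 : E →L[ℂ] E)).prod with hQ
    set S := B - l • (1 : E →L[ℂ] E) with hS
    have hcomm : Commute S Q := by
      refine Commute.list_prod_right _ _ fun X hX => ?_
      obtain ⟨m, -, rfl⟩ := List.mem_map.1 hX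
      refine Commute.sub_left (Commute.sub_right (Commute.refl _) ?_)
        (Commute.sub_right ?_ ?_)
      · exact (Commute.one_right B).smul_right m
      · exact (Commute.one_left B).smul_left l
      · exact ((Commute.refl (1 : E →L[ℂ] E)).smul_left l).smul_right m
    -- Half of the permitted loss of rate is spent on this factor, the rest on the remaining ones.
    obtain ⟨e, C₁, he1, he2, he3⟩ := exists_solution_scalar
      (by linarith : (σ + σ') / 2 < σ) l hR hC
    have hSQ : ∀ t ∈ strip T θ, (Q * S) (R t) = 0 := fun t ht => by
      rw [← hcomm.eq]
      simpa [hQ, hS] using h t ht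
    have he4 := he3 (Q * S) hSQ
    obtain ⟨T', d, C₂, hT', hd1, hd2⟩ := ih (T := T + 1) (σ := (σ + σ') / 2) (σ' := σ')
      (C := ‖S‖ * C₁) (by linarith) (R := fun t => S (e t))
      (S.differentiable.comp_differentiableOn fun t ht =>
        (he1 t ht).differentiableAt.differentiableWithinAt)
      (fun t ht => (S.le_opNorm _).trans (by
        rw [mul_assoc]; exact mul_le_mul_of_nonneg_left (he2 t ht) (norm_nonneg _)))
      he4
    have hsub : strip T' θ ⊆ strip (T + 1) θ := strip_subset_strip hT' le_rfl
    refine ⟨max T' 0, fun t => e t - d t, |C₁| + C₂, by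
      exact le_trans (by linarith) (le_max_left _ _), fun t ht => ?_, fun t ht => ?_⟩
    · have ht' := strip_subset_strip (le_max_left T' 0) le_rfl ht
      refine ((he1 t (hsub ht')).sub (hd1 t ht')).congr_deriv ?_
      simp only [hS, _root_.sub_apply, _root_.smul_apply, one_apply_eq_self, map_sub]
      abel
    · have ht' := strip_subset_strip (le_max_left T' 0) le_rfl ht
      have ht0 : 0 ≤ t.re := (le_max_right T' 0).trans ht.1.le
      refine (norm_sub_le _ _).trans ?_
      rw [add_mul]
      refine add_le_add ((he2 t (hsub ht')).trans ?_) (hd2 t ht')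
      refine mul_le_mul (le_abs_self _) ?_ (Real.exp_nonneg _) (abs_nonneg _)
      rw [Real.exp_le_exp]
      nlinarith

/-- Cayley–Hamilton with the characteristic polynomial split over ℂ. -/
theorem exists_list_prod_eq_zero [FiniteDimensional ℂ E] (B : E →L[ℂ] E) :
    ∃ ls : List ℂ, (ls.map fun l => B - l • (1 : E →L[ℂ] E)).prod = 0 := by
  set p := LinearMap.charpoly (B : E →ₗ[ℂ] E) with hp
  refine ⟨p.roots.toList, ?_⟩
  have h1 : p = (p.roots.toList.map fun a => Polynomial.X - Polynomial.C a).prod := by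
    have := (IsAlgClosed.splits p).eq_prod_roots_of_monic (LinearMap.charpoly_monic _)
    conv_lhs => rw [this, ← Multiset.coe_toList p.roots, Multiset.map_coe, Multiset.prod_coe]
  have h2 : Polynomial.aeval (B : E →ₗ[ℂ] E) p = 0 := LinearMap.aeval_self_charpoly _
  rw [h1, map_list_prod, List.map_map] at h2
  ext x
  have h3 : ∀ ls : List ℂ, ∀ x, (ls.map fun l => B - l • (1 : E →L[ℂ] E)).prod x =
      (ls.map ((Polynomial.aeval (B : E →ₗ[ℂ] E)) ∘
        fun a => Polynomial.X - Polynomial.C a)).prod x := by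
    intro ls
    induction ls with
    | nil => intro x; simp
    | cons l ls ih => intro x; simp [ih, Module.algebraMap_end_apply]
  rw [h3, h2]
  simp

/-- The linear equation `d' = -B d + R` in a strip. -/
theorem exists_solution [FiniteDimensional ℂ E] (B : E →L[ℂ] E) {T θ σ σ' C : ℝ} (hσ : σ' < σ)
    {R : ℂ → E} (hR : DifferentiableOn ℂ R (strip T θ))
    (hC : ∀ t ∈ strip T θ, ‖R t‖ ≤ C * Real.exp (-σ * t.re)) :
    ∃ (T' : ℝ) (d : ℂ → E) (C' : ℝ), T ≤ T' ∧
      (∀ t ∈ strip T' θ, HasDerivAt d (-B (d t) + R t) t) ∧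
      (∀ t ∈ strip T' θ, ‖d t‖ ≤ C' * Real.exp (-σ' * t.re)) := by
  have : CompleteSpace E := FiniteDimensional.complete ℂ E
  obtain ⟨ls, hls⟩ := exists_list_prod_eq_zero B
  exact exists_solution_of_prod_eq_zero B ls hσ hR hC fun t _ => by rw [hls]; rfl

end ParabolicManifolds
end
-- Curves that are invariant up to an arbitrarily high exponential order.
noncomputable section
namespace ParabolicManifolds
open Metric Set

variable {E : Type*} [NormedAddCommGroup E] [NormedSpace ℂ E]

theorem SlowSystem.exists_step_mem {T θ₀ θ θ' η C : ℝ} {a : ℂ × E → ℂ} {b : ℂ × E → E}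
    (H : SlowSystem T θ₀ η C a b) (hη : 0 < η) (hθ : θ' < θ) (hθ₀ : θ' < θ₀) (T₁ : ℝ) :
    ∃ T', T ≤ T' ∧ T₁ ≤ T' ∧ ∀ t ∈ strip T' θ', ∀ u ∈ ball (0 : E) 1,
      ‖Complex.exp (-t) * (1 + a (t, u))‖ ≤ 2 * Real.exp (-t.re) ∧
      t + Complex.exp (-t) * (1 + a (t, u)) ∈ strip T₁ θ := by
  set δ := min 1 (θ - θ') with hδ
  have hδ0 : 0 < δ := lt_min one_pos (by linarith)
  have e1 := (tendsto_const_mul_exp_neg one_pos 2).eventually (gt_mem_nhds hδ0)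
  have e2 := (tendsto_const_mul_exp_neg hη |C|).eventually (gt_mem_nhds one_pos)
  obtain ⟨T', h1, h2, h3, h4⟩ := (e1.and (e2.and ((eventually_ge_atTop T).and
    (eventually_ge_atTop (T₁ + 1))))).exists
  refine ⟨T', h3, by linarith, fun t ht u hu => ?_⟩
  have h5 : ‖a (t, u)‖ ≤ 1 := by
    refine (H.bound_a (t, u) ⟨strip_subset_strip h3 hθ₀.le ht, hu⟩).trans (le_trans ?_ h2.le)
    refine mul_le_mul (le_abs_self C) (mul_exp_neg_le _ hη ht.1.le) (Real.exp_nonneg _)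
      (abs_nonneg C)
  have h6 : ‖Complex.exp (-t) * (1 + a (t, u))‖ ≤ 2 * Real.exp (-t.re) := by
    have h9 := norm_add_le 1 (a (t, u))
    rw [norm_one] at h9
    rw [norm_mul, norm_exp_neg, mul_comm]
    gcongr
    linarith
  refine ⟨h6, ball_subset_strip (r := δ) (T' := T') (θ' := θ') ?_ ?_ ht ?_⟩
  · linarith [min_le_left 1 (θ - θ')]
  · linarith [min_le_right 1 (θ - θ')]
  · rw [mem_ball, dist_eq_norm, add_sub_cancel_left]
    refine h6.trans_lt (lt_of_le_of_lt ?_ h1)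
    have := mul_exp_neg_le t.re one_pos ht.1.le
    simpa using this

/-- The equation for d cancels the old residual against the first-order effect of d. What remains is
the change of c caused by the change of a, the second-order Taylor remainder of d, the term a d' and
the increment of b; each is smaller than d by a factor e^{-ηt}. -/
theorem residual_add (B : E →L[ℂ] E) (a : ℂ × E → ℂ) (b : ℂ × E → E) (c d : ℂ → E) (t : ℂ)
    (h h' : ℂ) (d' : E) (hd : d' = -B (d t) + residual B a b c t)
    (hh : h = Complex.exp (-t) * (1 + a (t, c t)))
    (hh' : h' = Complex.exp (-t) * (1 + a (t, c t + d t))) :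
    residual B a b (fun t => c t + d t) t =
      Complex.exp t • (c (t + h) - c (t + h')) - Complex.exp t • (d (t + h') - d t - h' • d') -
        a (t, c t + d t) • d' - (b (t, c t + d t) - b (t, c t)) := by
  have e1 : Complex.exp t * Complex.exp (-t) = 1 := by rw [← Complex.exp_add]; simp
  have e2 : Complex.exp t * h' = 1 + a (t, c t + d t) := by
    rw [hh', ← mul_assoc, e1, one_mul]
  have e3 : B (d t) = residual B a b c t - d' := by rw [hd]; abel
  have e4 : residual B a b c t = Complex.exp t • (c t - c (t + h)) - (B (c t) + b (t, c t)) := by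
    rw [residual, ← hh]
  have e5 : residual B a b (fun t => c t + d t) t = Complex.exp t • (c t + d t -
      (c (t + h') + d (t + h'))) - (B (c t + d t) + b (t, c t + d t)) := by
    simp only [residual, ← hh']
  rw [e5, map_add, e3, e4]
  simp only [smul_sub, smul_add, smul_smul, e2, add_smul, one_smul]
  abel

/-- The increment h has size e^{-Re t}, so the quadratic Taylor remainder has size e^{-2 Re t};
after multiplication by e^t one factor e^{-Re t} is left. -/
theorem norm_exp_smul_sub_sub_le [CompleteSpace E] {d : ℂ → E} {t h : ℂ} {K r : ℝ} {d' : E}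
    (hr : 0 < r) (hd : ∀ z ∈ ball t r, DifferentiableAt ℂ d z) (hK : ∀ z ∈ ball t r, ‖d z‖ ≤ K)
    (hd' : HasDerivAt d d' t) (hh : ‖h‖ ≤ 2 * Real.exp (-t.re)) (hhr : 2 * Real.exp (-t.re) < r) :
    ‖Complex.exp t • (d (t + h) - d t - h • d')‖ ≤ 16 * K / r ^ 2 * Real.exp (-t.re) := by
  have h8 := norm_sub_sub_fderiv_le (f := d) (x := t) (C := K) hr
    (fun z hz => (hd z hz).differentiableWithinAt) hK (y := t + h)
    (by rw [mem_ball, dist_eq_norm, add_sub_cancel_left]; exact hh.trans_lt hhr)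
  have hK0 : 0 ≤ K := (norm_nonneg _).trans (hK t (mem_ball_self hr))
  rw [add_sub_cancel_left, hd'.hasFDerivAt.fderiv] at h8
  have e6 : (ContinuousLinearMap.toSpanSingleton ℂ d') h = h • d' := by simp
  rw [e6] at h8
  have hτ0 := Real.exp_pos (-t.re)
  have hexpt : ‖Complex.exp t‖ = (Real.exp (-t.re))⁻¹ := by
    rw [Complex.norm_exp, Real.exp_neg, inv_inv]
  set τ := Real.exp (-t.re)
  rw [norm_smul, hexpt]
  calc _ ≤ τ⁻¹ * (4 * K * (2 * τ / r) ^ 2) := by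
        gcongr
        exact h8.trans (by gcongr)
    _ = _ := by field_simp; ring

set_option maxHeartbeats 1000000 in
/-- Existence of curves which are invariant up to an arbitrarily small error. -/
theorem SlowSystem.exists_curve [FiniteDimensional ℂ E] {T θ₀ η C : ℝ} (B : E →L[ℂ] E)
    {a : ℂ × E → ℂ} {b : ℂ × E → E} (H : SlowSystem T θ₀ η C a b) (hη : 0 < η) (hη1 : η ≤ 1)
    (n : ℕ) : ∀ θ < θ₀, ∃ (T' : ℝ) (c : ℂ → E) (C₁ C₂ : ℝ), T ≤ T' ∧
      DifferentiableOn ℂ c (strip T' θ) ∧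
      (∀ t ∈ strip T' θ, ‖c t‖ ≤ C₁ * Real.exp (-(η / 2) * t.re)) ∧
      (∀ t ∈ strip T' θ, ‖residual B a b c t‖ ≤ C₂ * Real.exp (-(η + n * (η / 2)) * t.re)) := by
  have hcomplete : CompleteSpace E := FiniteDimensional.complete ℂ E
  induction n with
  | zero =>
    intro θ hθ
    refine ⟨T, fun _ => 0, 0, C, le_rfl, differentiableOn_const _, fun t _ => by simp,
      fun t ht => ?_⟩
    have := H.bound_b (t, 0) ⟨strip_subset_strip le_rfl hθ.le ht, by simp⟩
    simpa [residual] using this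
  | succ n ih =>
    intro θ hθ
    -- Each correction costs some width of the strip: the old curve lives at width θ + 2δ, its
    -- correction at θ + δ, the new estimates hold at θ.
    set δ := (θ₀ - θ) / 3 with hδ
    have hδ0 : 0 < δ := by rw [hδ]; linarith
    obtain ⟨T₁, c, C₁, C₂, hT₁, hcd, hc1, hc2⟩ := ih (θ + 2 * δ) (by linarith)
    set σ := η + n * (η / 2) with hσ
    have hσ0 : η ≤ σ := by
      have : 0 ≤ n * (η / 2) := by positivity
      linarith
    -- the domain where the residual is holomorphic
    obtain ⟨T₂, hT₂, hT₂', hstep₂⟩ := H.exists_step_mem hη (by linarith : θ + δ < θ + 2 * δ)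
      (by linarith) T₁
    have e3 := (tendsto_const_mul_exp_neg (half_pos hη) |C₁|).eventually
      (gt_mem_nhds (by norm_num : (0 : ℝ) < 1 / 4))
    obtain ⟨T₃, hT₃, hT₃'⟩ := (e3.and (eventually_ge_atTop T₂)).exists
    have hcsmall : ∀ t ∈ strip T₃ (θ + δ), ‖c t‖ < 1 / 4 := fun t ht => by
      refine (hc1 t (strip_subset_strip (by linarith) (by linarith) ht)).trans_lt
        (lt_of_le_of_lt ?_ hT₃)
      exact mul_le_mul (le_abs_self _) (mul_exp_neg_le _ (half_pos hη) ht.1.le)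
        (Real.exp_nonneg _) (abs_nonneg _)
    have hcdiff : DifferentiableOn ℂ c (strip T₃ (θ + δ)) :=
      hcd.mono (strip_subset_strip (by linarith) (by linarith))
    have hpair : DifferentiableOn ℂ (fun t => (t, c t)) (strip T₃ (θ + δ)) :=
      differentiableOn_id.prodMk hcdiff
    have hpm : MapsTo (fun t => (t, c t)) (strip T₃ (θ + δ)) (strip T θ₀ ×ˢ ball (0 : E) 1) :=
      fun t ht => ⟨strip_subset_strip (by linarith) (by linarith) ht, by
        rw [mem_ball_zero_iff]; linarith [hcsmall t ht]⟩
    have hRd : DifferentiableOn ℂ (residual B a b c) (strip T₃ (θ + δ)) := by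
      have h1 := H.diff_a.comp hpair hpm
      have h2 := H.diff_b.comp hpair hpm
      have h3 : DifferentiableOn ℂ (fun t => t + Complex.exp (-t) * (1 + a (t, c t)))
          (strip T₃ (θ + δ)) :=
        differentiableOn_id.add ((by fun_prop : Differentiable ℂ fun t : ℂ =>
          Complex.exp (-t)).differentiableOn.mul (h1.const_add 1))
      refine DifferentiableOn.sub (DifferentiableOn.smul Complex.differentiable_exp.differentiableOn
        (hcdiff.sub ?_)) ((B.differentiable.comp_differentiableOn hcdiff).add h2)
      exact hcd.comp h3 fun t ht => (hstep₂ t (strip_subset_strip (by linarith) le_rfl ht) (c t)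
        (hpm ht).2).2
    -- Solving the equation loses η/2 in the rate, the new residual regains η: the net gain is η/2
    -- for each correction.
    obtain ⟨T₄, d, C₃, hT₄, hd1, hd2⟩ := exists_solution (σ' := σ - η / 2) B (by linarith) hRd
      (fun t ht => hc2 t (strip_subset_strip (by linarith) (by linarith) ht))
    have hd2' : ∀ t ∈ strip T₄ (θ + δ), ‖d t‖ ≤ |C₃| * Real.exp (-(σ - η / 2) * t.re) :=
      fun t ht => (hd2 t ht).trans (by gcongr; exact le_abs_self _)
    obtain ⟨La, hLa, ha⟩ := exists_lipschitz_fiber hη.le (by linarith : θ < θ₀) H.diff_a H.bound_a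
    obtain ⟨Lb, hLb, hb⟩ := exists_lipschitz_fiber hη.le (by linarith : θ < θ₀) H.diff_b H.bound_b
    obtain ⟨Lc, hLc, hcl⟩ : ∃ L, 0 ≤ L ∧ ∀ t ∈ strip (T₁ + 1) (θ + δ),
        ∀ t' ∈ strip (T₁ + 1) (θ + δ), ‖c t - c t'‖ ≤ L * ‖t - t'‖ := by
      obtain ⟨L, hL, h⟩ := exists_lipschitz_curve (half_pos hη).le
        (by linarith : θ + δ < θ + 2 * δ) hcd hc1
      exact ⟨_, by positivity, h (T₁ + 1) le_rfl⟩
    set r := min (δ / 2) 1 with hr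
    have hr0 : 0 < r := lt_min (by positivity) one_pos
    have hr1 : r ≤ 1 := min_le_right _ _
    have hr2 : r ≤ δ / 2 := min_le_left _ _
    obtain ⟨T₅, hT₅, hT₅', hstep₅⟩ := H.exists_step_mem hη (by linarith : θ < θ + δ)
      (by linarith) (max (T₁ + 1) (T₄ + 1))
    have e4 := (tendsto_const_mul_exp_neg (by linarith : 0 < σ - η / 2) |C₃|).eventually
      (gt_mem_nhds (by norm_num : (0 : ℝ) < 1 / 4))
    have e5 := (tendsto_const_mul_exp_neg one_pos 2).eventually (gt_mem_nhds hr0)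
    obtain ⟨T', h1, h2, h3, h4, h5, h6⟩ := (e4.and (e5.and ((eventually_ge_atTop T₅).and
      ((eventually_ge_atTop (T + 2)).and ((eventually_ge_atTop (T₄ + 1)).and
        (eventually_ge_atTop 0)))))).exists
    refine ⟨T', fun t => c t + d t, |C₁| + |C₃|,
      Lc * La * |C₃| + 16 * (|C₃| * Real.exp (σ - η / 2)) / r ^ 2 +
        |C| * (‖B‖ * |C₃| + |C₂|) + Lb * |C₃|, by linarith, ?_, fun t ht => ?_, fun t ht => ?_⟩
    · refine (hcd.mono (strip_subset_strip (by linarith) (by linarith))).add fun t ht => ?_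
      exact (hd1 t (strip_subset_strip (by linarith) (by linarith) ht)).differentiableAt.differentiableWithinAt
    · refine (norm_add_le _ _).trans ?_
      rw [add_mul]
      have ht0 : 0 ≤ t.re := by linarith [ht.1]
      refine add_le_add ((hc1 t (strip_subset_strip (by linarith) (by linarith) ht)).trans
        (by gcongr; exact le_abs_self _))
        ((hd2' t (strip_subset_strip (by linarith) (by linarith) ht)).trans ?_)
      gcongr
      linarith
    · have ht0 : 0 ≤ t.re := by linarith [ht.1]
      have htd : t ∈ strip T₄ (θ + δ) := strip_subset_strip (by linarith) (by linarith) ht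
      set s := Real.exp (-(σ - η / 2) * t.re) with hs
      set e := Real.exp (-η * t.re) with he
      set τ := Real.exp (-t.re) with hτ
      have hτ0 : 0 < τ := Real.exp_pos _
      have hs0 : 0 < s := Real.exp_pos _
      have he0 : 0 < e := Real.exp_pos _
      have hτe : τ ≤ e := by rw [hτ, he, Real.exp_le_exp]; nlinarith
      have hse : Real.exp (-(η + ((n + 1 : ℕ) : ℝ) * (η / 2)) * t.re) = s * e := by
        rw [hs, he, ← Real.exp_add, hσ]; push_cast; ring_nf
      have hcs : ‖c t‖ < 1 / 4 :=
        hcsmall t (strip_subset_strip (by linarith) (by linarith) ht)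
      have hdn : ‖d t‖ ≤ |C₃| * s := hd2' t htd
      have hds : ‖d t‖ < 1 / 4 := by
        refine (hdn.trans ?_).trans_lt h1
        exact mul_le_mul_of_nonneg_left (mul_exp_neg_le _ (by linarith) ht.1.le) (abs_nonneg _)
      have hu1 : c t ∈ ball (0 : E) (1 / 2) := by rw [mem_ball_zero_iff]; linarith
      have hu2 : c t + d t ∈ ball (0 : E) (1 / 2) := by
        rw [mem_ball_zero_iff]; exact (norm_add_le _ _).trans_lt (by linarith)
      have hu1' : c t ∈ ball (0 : E) 1 := ball_subset_ball (by norm_num) hu1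
      have hu2' : c t + d t ∈ ball (0 : E) 1 := ball_subset_ball (by norm_num) hu2
      have ht5 : t ∈ strip T₅ θ := strip_subset_strip h3 le_rfl ht
      have ht2 : t ∈ strip (T + 2) θ := strip_subset_strip h4 le_rfl ht
      set h := Complex.exp (-t) * (1 + a (t, c t)) with hh
      set h' := Complex.exp (-t) * (1 + a (t, c t + d t)) with hh'
      set d' := -B (d t) + residual B a b c t with hd'
      have hres : ‖residual B a b c t‖ ≤ |C₂| * s := by
        refine (hc2 t (strip_subset_strip (by linarith) (by linarith) ht)).trans ?_
        have : Real.exp (-σ * t.re) ≤ s := by rw [hs, Real.exp_le_exp]; nlinarith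
        exact mul_le_mul (le_abs_self _) this (Real.exp_nonneg _) (abs_nonneg _)
      have hd'n : ‖d'‖ ≤ (‖B‖ * |C₃| + |C₂|) * s := by
        refine (norm_add_le _ _).trans ?_
        rw [norm_neg, add_mul]
        refine add_le_add ((B.le_opNorm _).trans ?_) hres
        rw [mul_assoc]; gcongr
      have hexpt : ‖Complex.exp t‖ = τ⁻¹ := by rw [Complex.norm_exp, hτ, Real.exp_neg, inv_inv]
      have hha := ha t ht2 _ hu2 _ hu1
      have hhb := hb t ht2 _ hu2 _ hu1
      rw [add_sub_cancel_left] at hha hhb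
      have z1 : ‖Complex.exp t • (c (t + h) - c (t + h'))‖ ≤ Lc * La * |C₃| * (s * e) := by
        have m1 := (hstep₅ t ht5 _ hu1').2
        have m2 := (hstep₅ t ht5 _ hu2').2
        have h8 := hcl _ (strip_subset_strip (le_max_left _ _) le_rfl m1) _
          (strip_subset_strip (le_max_left _ _) le_rfl m2)
        have h9 : t + h - (t + h') = -(Complex.exp (-t) * (a (t, c t + d t) - a (t, c t))) := by
          rw [hh, hh']; ring
        rw [← hh, ← hh', h9, norm_neg, norm_mul, norm_exp_neg] at h8
        rw [norm_smul, hexpt]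
        calc _ ≤ τ⁻¹ * (Lc * (τ * (La * e * (|C₃| * s)))) := by
              gcongr
              refine h8.trans ?_
              gcongr
              exact hha.trans (by gcongr)
          _ = _ := by field_simp
      have hball : ball t r ⊆ strip (t.re - 1) (θ + δ) ∩ strip T₄ (θ + δ) := by
        have h8 := ball_subset_strip (T := T₄) (T' := T') (r := r) (by linarith)
          (by linarith : θ + r ≤ θ + δ) ht
        intro z hz
        refine ⟨⟨?_, (h8 hz).2⟩, h8 hz⟩
        rw [mem_ball, dist_eq_norm] at hz
        have := (Complex.abs_re_le_norm (z - t)).trans_lt hz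
        rw [Complex.sub_re] at this
        linarith [(abs_lt.1 this).1]
      have hh'n : ‖h'‖ ≤ 2 * τ := (hstep₅ t ht5 _ hu2').1
      have z2 : ‖Complex.exp t • (d (t + h') - d t - h' • d')‖ ≤
          16 * (|C₃| * Real.exp (σ - η / 2)) / r ^ 2 * (s * e) := by
        have h8 := norm_exp_smul_sub_sub_le (K := |C₃| * Real.exp (σ - η / 2) * s) hr0
          (fun z hz => (hd1 z (hball hz).2).differentiableAt) (fun z hz => ?_) (hd1 t htd) hh'n ?_
        · refine h8.trans ?_
          have : 16 * (|C₃| * Real.exp (σ - η / 2) * s) / r ^ 2 * τ =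
            16 * (|C₃| * Real.exp (σ - η / 2)) / r ^ 2 * (s * τ) := by ring
          rw [← hτ, this]
          exact mul_le_mul_of_nonneg_left (mul_le_mul_of_nonneg_left hτe hs0.le) (by positivity)
        · refine (hd2' z (hball hz).2).trans ?_
          rw [mul_assoc, hs, ← Real.exp_add]
          gcongr
          have := (hball hz).1.1
          nlinarith
        · refine lt_of_le_of_lt ?_ h2
          have := mul_exp_neg_le t.re one_pos ht.1.le
          simpa using this
      have z3 : ‖a (t, c t + d t) • d'‖ ≤ |C| * (‖B‖ * |C₃| + |C₂|) * (s * e) := by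
        rw [norm_smul]
        have h8 := H.bound_a (t, c t + d t)
          ⟨strip_subset_strip (by linarith) hθ.le ht, hu2'⟩
        calc _ ≤ (|C| * e) * ((‖B‖ * |C₃| + |C₂|) * s) := by
              gcongr
              exact h8.trans (by gcongr; exact le_abs_self _)
          _ = _ := by ring
      have z4 : ‖b (t, c t + d t) - b (t, c t)‖ ≤ Lb * |C₃| * (s * e) := by
        refine hhb.trans ?_
        calc _ ≤ Lb * e * (|C₃| * s) := by gcongr
          _ = _ := by ring
      rw [residual_add B a b c d t h h' d' hd' hh hh', hse]
      refine (norm_sub_le _ _).trans ((add_le_add ((norm_sub_le _ _).trans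
        (add_le_add ((norm_sub_le _ _).trans (add_le_add z1 z2)) z3)) z4).trans_eq ?_)
      ring

end ParabolicManifolds
end
-- Linear algebra: adapted Hermitian coordinates and spectral splittings.
noncomputable section
namespace ParabolicManifolds
open Metric Set

section

theorem finrank_biSup_of_iSupIndep {K V ι : Type*} [Field K] [AddCommGroup V] [Module K V]
    [FiniteDimensional K V] {t : ι → Submodule K V} (ht : iSupIndep t) (s : Finset ι) :
    Module.finrank K ↥(⨆ i ∈ s, t i) = ∑ i ∈ s, Module.finrank K (t i) := by
  classical
  induction s using Finset.induction_on with
  | empty => simp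
  | insert i s hi ih =>
    rw [Finset.sum_insert hi, Finset.iSup_insert, ← ih]
    have h1 := Submodule.finrank_sup_add_finrank_inf_eq (t i) (⨆ j ∈ s, t j)
    have h2 : Disjoint (t i) (⨆ j ∈ s, t j) :=
      ht.disjoint_biSup (y := (s : Set ι)) (by simpa using hi)
    rw [h2.eq_bot, finrank_bot] at h1
    simpa using h1

/-- The vector of the coordinates after the first one. -/
def tail (n : ℕ) : Cn (n + 1) →L[ℂ] Cn n :=
  LinearMap.toContinuousLinearMap
    { toFun := fun z => WithLp.toLp 2 fun i : Fin n => z i.succ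
      map_add' := fun _ _ => rfl
      map_smul' := fun _ _ => rfl }

@[simp] theorem tail_apply (n : ℕ) (z : Cn (n + 1)) (i : Fin n) : tail n z i = z i.succ := rfl

theorem inner_eq_add_inner_tail {n : ℕ} (z w : Cn (n + 1)) :
    inner ℂ z w = inner ℂ (z 0) (w 0) + inner ℂ (tail n z) (tail n w) := by
  simp [PiLp.inner_apply, Fin.sum_univ_succ]

theorem norm_sq_eq_add_norm_sq_tail {n : ℕ} (z : Cn (n + 1)) :
    ‖z‖ ^ 2 = ‖z 0‖ ^ 2 + ‖tail n z‖ ^ 2 := by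
  simp [EuclideanSpace.norm_sq_eq, Fin.sum_univ_succ]

theorem tail_injective {n : ℕ} {z w : Cn (n + 1)} (h0 : z 0 = w 0) (h : tail n z = tail n w) :
    z = w := by
  ext i
  refine Fin.cases h0 (fun i => ?_) i
  rw [← tail_apply, h, tail_apply]

/-- In suitable coordinates, the numerical range of an endomorphism is close to its spectrum. -/
theorem exists_adapted_coordinates (b : ℝ) (n : ℕ) : ∀ (V : Type) [AddCommGroup V] [Module ℂ V]
    [FiniteDimensional ℂ V] (f : Module.End ℂ V), Module.finrank ℂ V = n →
    (∀ μ : ℂ, f.HasEigenvalue μ → b < μ.re) →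
    ∃ (e : Cn n ≃ₗ[ℂ] V) (g : Cn n →ₗ[ℂ] Cn n) (m : ℝ), 0 < m ∧ (∀ w, f (e w) = e (g w)) ∧
      ∀ w, (b + m) * ‖w‖ ^ 2 ≤ (inner ℂ w (g w)).re := by
  induction n with
  | zero =>
    intro V _ _ _ f hV hf
    have : Subsingleton V := Module.finrank_zero_iff.1 hV
    refine ⟨LinearEquiv.ofFinrankEq _ _ (by simp [hV]), 0, 1, one_pos,
      fun w => Subsingleton.elim _ _, fun w => ?_⟩
    have : w = 0 := Subsingleton.elim _ _
    simp [this]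
  | succ n ih =>
    intro V _ _ _ f hV hf
    have : Nontrivial V := Module.nontrivial_of_finrank_pos (R := ℂ) (by omega)
    obtain ⟨l, hl⟩ := Module.End.exists_eigenvalue f
    -- The range of f - l is proper, hence contained in a hyperplane H. This H is invariant and f
    -- acts as l modulo H, so the induction applies to H.
    have hlt : LinearMap.range (f - algebraMap ℂ (Module.End ℂ V) l) < ⊤ := by
      rw [lt_top_iff_ne_top]
      intro h
      have h1 := LinearMap.ker_eq_bot_iff_range_eq_top.2 h
      exact hl ((Module.End.eigenspace_def).trans h1)
    obtain ⟨φ, hφ, hle⟩ := Submodule.exists_le_ker_of_lt_top _ hlt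
    set H := LinearMap.ker φ with hH
    have hfr (v : V) : f v - l • v ∈ H := hle ⟨v, by simp [Module.algebraMap_end_apply]⟩
    have hinv : ∀ v ∈ H, f v ∈ H := fun v hv => by
      have := H.add_mem (hfr v) (H.smul_mem l hv)
      rwa [sub_add_cancel] at this
    have hdim : Module.finrank ℂ H = n := by
      have h1 := LinearMap.finrank_range_add_finrank_ker φ
      have h2 : LinearMap.range φ = ⊤ := LinearMap.range_eq_top.2
        (LinearMap.surjective (f := φ) hφ)
      rw [h2, finrank_top, hV, Module.finrank_self, ← hH] at h1
      omega
    obtain ⟨e, g, m, hm, he, hg⟩ := ih H (f.restrict hinv) hdim fun μ hμ => by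
      obtain ⟨v, hv⟩ := hμ.exists_hasEigenvector
      refine hf μ (Module.End.hasEigenvalue_of_hasEigenvector (x := (v : V)) ⟨?_, ?_⟩)
      · rw [Module.End.mem_eigenspace_iff]
        simpa using congrArg Subtype.val hv.apply_eq_smul
      · simpa using hv.2
    obtain ⟨v, hv⟩ : ∃ v, φ v ≠ 0 := by
      by_contra! h
      exact hφ (LinearMap.ext h)
    set h₀ : Cn n := e.symm ⟨f v - l • v, hfr v⟩ with hh₀
    have hlb := hf l hl
    set m' := min m (l.re - b) / 2 with hm'
    have hm'0 : 0 < m' := half_pos (lt_min hm (by linarith))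
    have hm1 : 2 * m' ≤ m := by rw [hm', mul_div_cancel₀ _ two_ne_zero]; exact min_le_left _ _
    have hm2 : 2 * m' ≤ l.re - b := by
      rw [hm', mul_div_cancel₀ _ two_ne_zero]; exact min_le_right _ _
    -- The vector completing the coordinates of H is scaled by ε, which makes the off-diagonal entry
    -- ε h₀ of size at most m'. Taking m' half of the available gap leaves the other half to absorb
    -- this coupling.
    set ε : ℝ := m' / (‖h₀‖ + 1) with hε
    have hε0 : 0 < ε := by positivity
    have hεh : ε * ‖h₀‖ ≤ m' := by
      rw [hε, div_mul_eq_mul_div, div_le_iff₀ (by positivity)]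
      nlinarith [norm_nonneg h₀]
    let L : Cn (n + 1) →ₗ[ℂ] V :=
      { toFun := fun w => (e (tail n w) : V) + ((ε : ℂ) * w 0) • v
        map_add' := fun w w' => by
          simp only [map_add, Submodule.coe_add, PiLp.add_apply, mul_add, add_smul]; abel
        map_smul' := fun c w => by
          simp only [map_smul, Submodule.coe_smul, PiLp.smul_apply, smul_eq_mul, smul_add,
            smul_smul, RingHom.id_apply]
          congr 2; ring }
    have hL (w : Cn (n + 1)) : L w = (e (tail n w) : V) + ((ε : ℂ) * w 0) • v := rfl
    have hφe (w : Cn n) : φ (e w : V) = 0 := (e w).2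
    have hLinj : Function.Injective L := by
      rw [← LinearMap.ker_eq_bot, LinearMap.ker_eq_bot']
      intro w hw
      rw [hL] at hw
      have h1 := congrArg φ hw
      rw [map_add, hφe, zero_add, map_smul, map_zero, smul_eq_mul] at h1
      have h0 : w 0 = 0 := by simpa [hε0.ne', hv] using h1
      rw [h0, mul_zero, zero_smul, add_zero] at hw
      have h2 : tail n w = 0 := by
        have : e (tail n w) = 0 := Subtype.ext hw
        simpa using this
      exact tail_injective (by simpa using h0) (by simpa using h2)
    have hLbij : Function.Bijective L :=
      ⟨hLinj, (LinearMap.injective_iff_surjective_of_finrank_eq_finrank (by simp [hV])).1 hLinj⟩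
    let e' := LinearEquiv.ofBijective L hLbij
    let g' : Cn (n + 1) →ₗ[ℂ] Cn (n + 1) :=
      { toFun := fun w => WithLp.toLp 2 (Fin.cons (l * w 0) fun i =>
          (g (tail n w) + ((ε : ℂ) * w 0) • h₀) i)
        map_add' := fun w w' => by
          refine tail_injective ?_ ?_
          · simp [mul_add]
          · ext i; simp [mul_add, add_mul]; ring
        map_smul' := fun c w => by
          refine tail_injective ?_ ?_
          · simp; ring
          · ext i; simp; ring }
    have hg0 (w : Cn (n + 1)) : g' w 0 = l * w 0 := rfl
    have hgt (w : Cn (n + 1)) : tail n (g' w) = g (tail n w) + ((ε : ℂ) * w 0) • h₀ := rfl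
    refine ⟨e', g', m', hm'0, fun w => ?_, fun w => ?_⟩
    · change f (L w) = L (g' w)
      rw [hL, hL, hgt, hg0, map_add, map_smul, map_add, map_smul, ← he, hh₀,
        LinearEquiv.apply_symm_apply]
      simp only [Submodule.coe_add, Submodule.coe_smul, LinearMap.coe_restrict_apply, smul_sub,
        smul_smul]
      rw [show (ε : ℂ) * (l * w 0) = ε * w 0 * l by ring]
      abel
    · rw [inner_eq_add_inner_tail, hgt, hg0, norm_sq_eq_add_norm_sq_tail, inner_add_right,
        inner_smul_right, Complex.add_re, Complex.add_re]
      have k1 := hg (tail n w)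
      have k2 : (inner ℂ (w 0) (l * w 0)).re = l.re * ‖w 0‖ ^ 2 := by
        rw [← smul_eq_mul, inner_smul_right, inner_self_eq_norm_sq_to_K]
        change (l * ((‖w 0‖ : ℝ) : ℂ) ^ 2).re = _
        rw [← Complex.ofReal_pow, Complex.re_mul_ofReal]
      have k3 : -(m' * (‖w 0‖ * ‖tail n w‖)) ≤ ((ε : ℂ) * w 0 * inner ℂ (tail n w) h₀).re := by
        have h1 := Complex.abs_re_le_norm ((ε : ℂ) * w 0 * inner ℂ (tail n w) h₀)
        have h2 : ‖(ε : ℂ) * w 0 * inner ℂ (tail n w) h₀‖ ≤ m' * (‖w 0‖ * ‖tail n w‖) := by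
          rw [norm_mul, norm_mul, Complex.norm_real, Real.norm_of_nonneg hε0.le]
          calc _ ≤ ε * ‖w 0‖ * (‖tail n w‖ * ‖h₀‖) := by
                gcongr; exact norm_inner_le_norm _ _
            _ = (ε * ‖h₀‖) * (‖w 0‖ * ‖tail n w‖) := by ring
            _ ≤ _ := by gcongr
        linarith [(abs_le.1 h1).1]
      rw [k2]
      have h5 : 0 ≤ m' * (‖w 0‖ - ‖tail n w‖) ^ 2 := by positivity
      have h6 : 0 ≤ (l.re - b - 2 * m') * ‖w 0‖ ^ 2 := mul_nonneg (by linarith) (by positivity)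
      have h7 : 0 ≤ (m - 2 * m') * ‖tail n w‖ ^ 2 := mul_nonneg (by linarith) (by positivity)
      nlinarith [sq_nonneg (‖w 0‖), sq_nonneg ‖tail n w‖, mul_nonneg hm'0.le (sq_nonneg ‖w 0‖),
        mul_nonneg hm'0.le (sq_nonneg ‖tail n w‖)]

/-- Splitting of an endomorphism by a vertical line that avoids its eigenvalues. -/
theorem exists_splitting {E : Type} [NormedAddCommGroup E] [NormedSpace ℂ E]
    [FiniteDimensional ℂ E] (A : Module.End ℂ E) (b : ℝ)
    (hb : ∀ μ : ℂ, A.HasEigenvalue μ → μ.re ≠ b) :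
    ∃ (n n' : ℕ) (J : (Cn n × Cn n') ≃L[ℂ] E) (As : Cn n →L[ℂ] Cn n) (Ac : Cn n' →L[ℂ] Cn n')
      (m : ℝ), 0 < m ∧ (∀ w, A (J w) = J (As w.1, Ac w.2)) ∧
      (∀ w, (b + m) * ‖w‖ ^ 2 ≤ (inner ℂ w (As w)).re) ∧
      (∀ w, (inner ℂ w (Ac w)).re ≤ (b - m) * ‖w‖ ^ 2) ∧
      n = Module.finrank ℂ ↥(⨆ μ ∈ {μ : ℂ | b < μ.re}, A.maxGenEigenspace μ) ∧
      ∀ w, J (w, 0) ∈ ⨆ μ ∈ {μ : ℂ | b < μ.re}, A.maxGenEigenspace μ := by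
  set Vs := ⨆ μ ∈ {μ : ℂ | b < μ.re}, A.maxGenEigenspace μ with hVs
  set Vc := ⨆ μ ∈ {μ : ℂ | b < μ.re}ᶜ, A.maxGenEigenspace μ with hVc
  have hdisj : Disjoint Vs Vc :=
    A.independent_maxGenEigenspace.disjoint_biSup_biSup disjoint_compl_right
  have htop : Vs ⊔ Vc = ⊤ := by
    rw [hVs, hVc, ← iSup_union, union_compl_self]
    simp only [mem_univ, iSup_pos]
    exact Module.End.iSup_maxGenEigenspace_eq_top A
  have hinv (S : Set ℂ) : ∀ v ∈ ⨆ μ ∈ S, A.maxGenEigenspace μ,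
      A v ∈ ⨆ μ ∈ S, A.maxGenEigenspace μ := by
    intro v hv
    have : (⨆ μ ∈ S, A.maxGenEigenspace μ) ≤ (⨆ μ ∈ S, A.maxGenEigenspace μ).comap A := by
      refine iSup₂_le fun μ hμ v hv => ?_
      exact (le_iSup₂_of_le (f := fun μ (_ : μ ∈ S) => A.maxGenEigenspace μ) μ hμ le_rfl)
        (Module.End.mapsTo_maxGenEigenspace_of_comm (Commute.refl A) μ hv)
    exact this hv
  -- An eigenvector of the restriction whose eigenvalue were in S' would lie in both of the disjoint
  -- summands.
  have heig (S S' : Set ℂ) (hS : S ∪ S' = univ)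
      (hd : Disjoint (⨆ μ ∈ S, A.maxGenEigenspace μ) (⨆ μ ∈ S', A.maxGenEigenspace μ)) (μ : ℂ)
      (hμ : Module.End.HasEigenvalue (A.restrict (hinv S)) μ) : μ ∈ S ∧ A.HasEigenvalue μ := by
    obtain ⟨v, hv⟩ := hμ.exists_hasEigenvector
    have h1 : A (v : E) = μ • (v : E) := by simpa using congrArg Subtype.val hv.apply_eq_smul
    have h2 : (v : E) ∈ A.eigenspace μ := Module.End.mem_eigenspace_iff.2 h1
    have h3 : (v : E) ≠ 0 := by simpa using hv.2
    refine ⟨?_, Module.End.hasEigenvalue_of_hasEigenvector ⟨h2, h3⟩⟩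
    rcases (hS ▸ mem_univ μ : μ ∈ S ∪ S') with h | h
    · exact h
    · exfalso
      have h4 : (v : E) ∈ ⨆ μ ∈ S', A.maxGenEigenspace μ :=
        (le_iSup₂_of_le (f := fun μ (_ : μ ∈ S') => A.maxGenEigenspace μ) μ h le_rfl)
          (Module.End.eigenspace_le_maxGenEigenspace h2)
      exact h3 (Submodule.disjoint_def.1 hd _ v.2 h4)
  obtain ⟨e, g, m, hm, he, hg⟩ := exists_adapted_coordinates b _ Vs (A.restrict (hinv _)) rfl
    fun μ hμ => (heig _ _ (union_compl_self _) hdisj μ hμ).1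
  -- An upper bound of the numerical range is a lower bound for the negative endomorphism at level
  -- -b.
  obtain ⟨e', g', m', hm', he', hg'⟩ := exists_adapted_coordinates (-b) _ Vc
    (-(A.restrict (hinv _))) rfl fun μ hμ => by
      obtain ⟨v, hv⟩ := hμ.exists_hasEigenvector
      have h2 := heig _ _ (compl_union_self _) hdisj.symm (-μ)
        (Module.End.hasEigenvalue_of_hasEigenvector (x := v) ⟨by
          rw [Module.End.mem_eigenspace_iff]
          have := hv.apply_eq_smul
          rw [LinearMap.neg_apply, neg_eq_iff_eq_neg] at this
          rw [this, neg_smul], hv.2⟩)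
      have h3 : ¬ b < (-μ).re := h2.1
      have h4 := hb _ h2.2
      have : (-μ).re < b := lt_of_le_of_ne (not_lt.1 h3) h4
      rw [Complex.neg_re] at this
      linarith
  have hcompl : IsCompl Vs Vc := ⟨hdisj, codisjoint_iff.2 htop⟩
  let J₀ := (e.prodCongr e').trans (Submodule.prodEquivOfIsCompl Vs Vc hcompl)
  have hJ₀ (w) : J₀ w = (e w.1 : E) + (e' w.2 : E) := by
    simp [J₀]
  refine ⟨_, _, J₀.toContinuousLinearEquiv, LinearMap.toContinuousLinearMap g,
    LinearMap.toContinuousLinearMap (-g'), min m m', lt_min hm hm', fun w => ?_, fun w => ?_,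
    fun w => ?_, rfl, fun w => ?_⟩
  · change A (J₀ w) = J₀ (g w.1, -g' w.2)
    have h1 := congrArg Subtype.val (he w.1)
    have h2 := congrArg Subtype.val (he' w.2)
    simp only [LinearMap.coe_restrict_apply, LinearMap.neg_apply, Submodule.coe_neg] at h1 h2
    rw [hJ₀, hJ₀, map_add, h1, map_neg, Submodule.coe_neg, ← h2, neg_neg]
  · refine le_trans ?_ (hg w)
    gcongr
    exact min_le_left _ _
  · have h1 := hg' w
    have h2 : min m m' ≤ m' := min_le_right _ _
    change (inner ℂ w (-g' w)).re ≤ _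
    rw [inner_neg_right, Complex.neg_re]
    nlinarith [sq_nonneg ‖w‖]
  · change J₀ (w, 0) ∈ Vs
    rw [hJ₀]
    simp

end

section

variable {E : Type*} [NormedAddCommGroup E] [NormedSpace ℂ E]

theorem SlowSystem.mono_rate {T θ η η' C : ℝ} {a : ℂ × E → ℂ} {b : ℂ × E → E}
    (H : SlowSystem T θ η C a b) (hT : 0 ≤ T) (hη : η' ≤ η) : SlowSystem T θ η' |C| a b := by
  have key : ∀ p ∈ strip T θ ×ˢ ball (0 : E) 1,
      C * Real.exp (-η * p.1.re) ≤ |C| * Real.exp (-η' * p.1.re) := fun p hp => by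
    have : 0 ≤ p.1.re := hT.trans hp.1.1.le
    gcongr
    exact le_abs_self _
  exact ⟨H.diff_a, H.diff_b, fun p hp => (H.bound_a p hp).trans (key p hp),
    fun p hp => (H.bound_b p hp).trans (key p hp)⟩

end

end ParabolicManifolds
end
-- Affine coordinates, the Taylor expansion of the germ, and asymptotics of one step.
noncomputable section
namespace ParabolicManifolds
open Metric Set

section Coordinates

variable {m : ℕ} (j : Fin (m + 1))

@[simp] theorem point_apply_self (x : ℂ) (y : Fin m → ℂ) : point j x y j = x := by simp [point]

@[simp] theorem point_apply_succAbove (x : ℂ) (y : Fin m → ℂ) (i : Fin m) :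
    point j x y (j.succAbove i) = y i := by simp [point]

theorem ext_succAbove {z w : Cn (m + 1)} (h0 : z j = w j)
    (h : ∀ i, z (j.succAbove i) = w (j.succAbove i)) : z = w := by
  ext i
  exact Fin.succAboveCases j h0 h i

theorem eq_smul_point {z : Cn (m + 1)} (hz : z j ≠ 0) : z = z j • point j 1 (affineCoord j z) :=
  ext_succAbove j (by simp) fun i => by simp [affineCoord, mul_div_cancel₀ _ hz]

theorem affineCoord_smul_point {c : ℂ} (hc : c ≠ 0) (u : Fin m → ℂ) :
    affineCoord j (c • point j 1 u) = u := by
  ext i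
  simp [affineCoord, hc]

/-- The inclusion of the hyperplane of the last coordinates, as a continuous linear map. -/
def inclusionL : (Fin m → ℂ) →L[ℂ] Cn (m + 1) := LinearMap.toContinuousLinearMap (inclusion j)

theorem inclusionL_apply (y : Fin m → ℂ) : inclusionL j y = point j 0 y := rfl

theorem point_add (x : ℂ) (y y' : Fin m → ℂ) :
    point j x (y + y') = point j x y + inclusionL j y' :=
  ext_succAbove j (by simp [inclusionL_apply]) (by simp [inclusionL_apply])

theorem differentiable_point (x : ℂ) : Differentiable ℂ (point j x) := by
  have : point j x = fun y => point j x 0 + inclusionL j y := by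
    ext1 y
    rw [← point_add, zero_add]
  rw [this]
  exact (inclusionL j).differentiable.const_add _

/-- The coordinates other than the `j`-th one, as a continuous linear map. -/
def otherCoords : Cn (m + 1) →L[ℂ] (Fin m → ℂ) :=
  LinearMap.toContinuousLinearMap
    { toFun := fun z i => z (j.succAbove i)
      map_add' := fun _ _ => rfl
      map_smul' := fun _ _ => rfl }

theorem otherCoords_apply (z : Cn (m + 1)) (i : Fin m) : otherCoords j z i = z (j.succAbove i) :=
  rfl

end Coordinates

section Taylor

variable {p : ℕ} {Φ : Cn p → Cn p} {U : Set (Cn p)}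

theorem homogeneousPart_smul (Φ : Cn p → Cn p) (n : ℕ) (c : ℂ) (z : Cn p) :
    homogeneousPart Φ n (c • z) = c ^ n • homogeneousPart Φ n z := by
  have := (iteratedFDeriv ℂ n Φ 0).map_smul_univ (fun _ => c) (fun _ => z)
  simp only [Finset.prod_const, Finset.card_univ, Fintype.card_fin] at this
  rw [homogeneousPart, this, homogeneousPart, smul_comm]

theorem differentiable_homogeneousPart (Φ : Cn p → Cn p) (n : ℕ) :
    Differentiable ℂ (homogeneousPart Φ n) := by
  have h1 : ContDiff ℂ 1 (iteratedFDeriv ℂ n Φ 0) := ContinuousMultilinearMap.contDiff _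
  have h2 : Differentiable ℂ fun z : Cn p => iteratedFDeriv ℂ n Φ 0 fun _ => z :=
    (h1.differentiable one_ne_zero).comp (differentiable_pi.2 fun _ => differentiable_id)
  exact fun z => (h2 z).const_smul ((n.factorial : ℂ)⁻¹)

/-- One-variable Taylor expansion along the lines s ↦ s v, with constants uniform in ‖v‖ ≤ K. This
is the form suited to points x · (1, u) with u bounded and x small. -/
theorem IsTangentToIdentity.exists_taylor (hΦ : IsTangentToIdentity Φ U) {k : ℕ}
    (hk : HasOrder Φ (k + 1)) {K : ℝ} (hK : 0 < K) :
    ∃ R > 0, ∃ C, ∀ v : Cn p, ‖v‖ ≤ K → ∀ s : ℂ, ‖s‖ < R → s • v ∈ U ∧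
      ‖Φ (s • v) - s • v - s ^ (k + 1) • homogeneousPart Φ (k + 1) v‖ ≤ C * ‖s‖ ^ (k + 2) := by
  have hcont : ContinuousAt Φ 0 :=
    (hΦ.holomorphic.differentiableAt (hΦ.isOpen.mem_nhds hΦ.zero_mem)).continuousAt
  obtain ⟨r, hr, hrU⟩ : ∃ r > 0, ball (0 : Cn p) r ⊆ U ∩ {z | ‖Φ z‖ < 1} := by
    refine Metric.mem_nhds_iff.1 (inter_mem (hΦ.isOpen.mem_nhds hΦ.zero_mem) ?_)
    exact hcont.norm.eventually (gt_mem_nhds (by simp [hΦ.map_zero]))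
  have hPc : Continuous (homogeneousPart Φ (k + 1)) :=
    (differentiable_homogeneousPart Φ (k + 1)).continuous
  obtain ⟨D, hD⟩ := (isCompact_closedBall (0 : Cn p) K).exists_bound_of_continuousOn hPc.continuousOn
  set R := r / K with hR
  have hR0 : 0 < R := by positivity
  have hmem (v : Cn p) (hv : ‖v‖ ≤ K) (s : ℂ) (hs : s ∈ ball (0 : ℂ) R) : s • v ∈ ball (0 : Cn p) r := by
    rw [mem_ball_zero_iff] at *
    rw [norm_smul]
    calc _ ≤ ‖s‖ * K := by gcongr
      _ < R * K := by gcongr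
      _ = r := by rw [hR]; field_simp
  have hk2 := hk.1
  refine ⟨R, hR0, (1 + R * K + R ^ (k + 1) * D) / R ^ (k + 2), fun v hv s hs => ?_⟩
  have hs' : s ∈ ball (0 : ℂ) R := by simpa using hs
  refine ⟨(hrU (hmem v hv s hs')).1, ?_⟩
  have hsum (z : ℂ) : ∑ i ∈ Finset.range (k + 1 + 1), z ^ i • ((i.factorial : ℂ)⁻¹ •
      iteratedDeriv i (fun s : ℂ => Φ (s • v)) 0) =
        z • v + z ^ (k + 1) • homogeneousPart Φ (k + 1) v := by
    have e (i : ℕ) : (i.factorial : ℂ)⁻¹ • iteratedDeriv i (fun s : ℂ => Φ (s • v)) 0 =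
        homogeneousPart Φ i v := by
      rw [iteratedDeriv_comp_smul_eq hΦ.isOpen hΦ.holomorphic v i (by simpa using hΦ.zero_mem),
        zero_smul, homogeneousPart]
    simp only [e]
    rw [Finset.sum_range_succ]
    congr 1
    -- Below degree k + 1 only the linear part survives: the constant term is Φ 0 = 0 and the
    -- degrees from 2 to k vanish by the definition of the order.
    rw [Finset.sum_eq_single_of_mem 1 (by simp; omega)]
    · have : homogeneousPart Φ 1 v = v := by
        simp [homogeneousPart, hΦ.fderiv_zero]
      rw [this, pow_one]
    · intro i hi hi1
      have hi' : i < k + 1 := by simpa using hi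
      rcases Nat.eq_zero_or_pos i with rfl | hpos
      · simp [homogeneousPart, hΦ.map_zero]
      · rw [hk.2.2 i (by omega) hi' v, smul_zero]
  have hd : DifferentiableOn ℂ (fun s : ℂ => Φ (s • v)) (ball 0 R) :=
    hΦ.holomorphic.comp (by fun_prop) fun z hz => (hrU (hmem v hv z hz)).1
  have := norm_sub_taylor_le (h := fun s : ℂ => Φ (s • v)) (M := 1 + R * K + R ^ (k + 1) * D) hR0
    (k + 1) hd (fun z hz => ?_) hs'
  · rw [hsum] at this
    rw [sub_sub]
    refine this.trans_eq ?_
    rw [div_pow]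
    ring
  · rw [hsum, ← sub_sub]
    have hz' : ‖z‖ ≤ R := by rw [mem_ball_zero_iff] at hz; exact hz.le
    refine (norm_sub_le _ _).trans (add_le_add ((norm_sub_le _ _).trans (add_le_add ?_ ?_)) ?_)
    · exact (hrU (hmem v hv z hz)).2.le
    · rw [norm_smul]; gcongr
    · rw [norm_smul, norm_pow]
      gcongr
      exact hD v (by simpa using hv)

end Taylor

section Asymptotics

open Asymptotics

variable {α : Type*} {l : Filter α} {s ε : α → ℝ}

theorem isBigO_log_sub {ζ : α → ℂ} (hζ : ζ =O[l] s) (hs0 : Tendsto s l (𝓝 0)) :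
    (fun p => Complex.log (1 + ζ p) - ζ p) =O[l] fun p => s p * s p := by
  have h0 : Tendsto ζ l (𝓝 0) := hζ.trans_tendsto hs0
  have h1 : (fun p => Complex.log (1 + ζ p) - ζ p) =O[l] fun p => ζ p * ζ p := by
    refine IsBigO.of_bound 1 ?_
    have h2 := h0.norm.eventually (gt_mem_nhds (by simp : ‖(0 : ℂ)‖ < 1 / 2))
    filter_upwards [h2] with p hp
    refine (Complex.norm_log_one_add_sub_self_le (by linarith)).trans ?_
    rw [norm_mul, one_mul, ← sq]
    have : (1 - ‖ζ p‖)⁻¹ ≤ 2 := by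
      rw [inv_le_comm₀ (by linarith) (by norm_num)]; linarith
    nlinarith [sq_nonneg ‖ζ p‖]
  exact h1.trans (hζ.mul hζ)

theorem isBigO_exp_sub {h : α → ℂ} (hh : h =O[l] s) (hs0 : Tendsto s l (𝓝 0)) :
    (fun p => Complex.exp (h p) - 1 - h p) =O[l] fun p => s p * s p := by
  have h0 : Tendsto h l (𝓝 0) := hh.trans_tendsto hs0
  have h1 : (fun p => Complex.exp (h p) - 1 - h p) =O[l] fun p => h p * h p := by
    refine IsBigO.of_bound 1 ?_
    have h2 := h0.norm.eventually (gt_mem_nhds (by simp : ‖(0 : ℂ)‖ < 1))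
    filter_upwards [h2] with p hp
    refine (Complex.norm_exp_sub_one_sub_id_le hp.le).trans_eq ?_
    rw [norm_mul, one_mul, ← sq]
  exact h1.trans (hh.mul hh)

/-- When x is multiplied by 1 + ζ, the time t = -k log(x / κ) increases by -k log(1 + ζ). To first
order ζ is x^k p(1, u) = -(τ / (k p₀)) p(1, u), so the increment is τ(1 + O(ε)). -/
theorem isBigO_time {τ pu e₀ ζ : α → ℂ} {k p₀ : ℂ} (hk : k ≠ 0) (hp₀ : p₀ ≠ 0)
    (hτ : ∀ p, ‖τ p‖ = s p) (hs : ∀ p, 0 < s p) (hs0 : Tendsto s l (𝓝 0)) (hsε : s =O[l] ε)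
    (hε0 : Tendsto ε l (𝓝 0)) (hζ : ∀ p, ζ p = -(τ p / (k * p₀)) * pu p + e₀ p)
    (hpu : (fun p => pu p - p₀) =O[l] ε) (he₀ : e₀ =O[l] fun p => s p * ε p) :
    ζ =O[l] s ∧ (fun p => (τ p)⁻¹ * (-k * Complex.log (1 + ζ p)) - 1) =O[l] ε := by
  have hτ0 (p) : τ p ≠ 0 := by rw [← norm_ne_zero_iff, hτ]; exact (hs p).ne'
  have hτs : τ =O[l] s := IsBigO.of_bound 1 (Eventually.of_forall fun p => by
    rw [hτ, one_mul, Real.norm_of_nonneg (hs p).le])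
  have hτi : (fun p => (τ p)⁻¹) =O[l] fun p => (s p)⁻¹ :=
    IsBigO.of_bound 1 (Eventually.of_forall fun p => by
      rw [norm_inv, hτ, one_mul, norm_inv, Real.norm_of_nonneg (hs p).le])
  have hε1 : ε =O[l] fun _ => (1 : ℝ) := hε0.isBigO_one ℝ
  have hpu1 : pu =O[l] fun _ => (1 : ℝ) := by
    have h1 := (hpu.trans hε1).add (isBigO_const_const p₀ (one_ne_zero : (1 : ℝ) ≠ 0) l)
    simpa using h1
  have hζs : ζ =O[l] s := by
    have h1 : (fun p => -(τ p / (k * p₀)) * pu p) =O[l] fun p => s p * 1 := by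
      refine IsBigO.mul ?_ hpu1
      refine IsBigO.neg_left ?_
      simp only [div_eq_mul_inv]
      simpa using hτs.mul (isBigO_const_const (k * p₀)⁻¹ (one_ne_zero : (1 : ℝ) ≠ 0) l)
    have h2 : (fun p => s p * ε p) =O[l] fun p => s p * 1 := (isBigO_refl _ _).mul hε1
    have h3 := h1.add (he₀.trans h2)
    simp only [mul_one] at h3
    exact h3.congr_left fun p => (hζ p).symm
  refine ⟨hζs, ?_⟩
  have k1 : (fun p => (τ p)⁻¹ * (-k * (Complex.log (1 + ζ p) - ζ p))) =O[l] ε := by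
    have h1 := hτi.mul ((isBigO_log_sub hζs hs0).const_mul_left (-k))
    refine (h1.congr_right fun p => ?_).trans hsε
    rw [← mul_assoc, inv_mul_cancel₀ (hs p).ne', one_mul]
  have k2 : (fun p => p₀⁻¹ * (pu p - p₀)) =O[l] ε := hpu.const_mul_left _
  have k3 : (fun p => (τ p)⁻¹ * (-k * e₀ p)) =O[l] ε := by
    have h1 := hτi.mul (he₀.const_mul_left (-k))
    refine h1.congr_right fun p => ?_
    rw [← mul_assoc, inv_mul_cancel₀ (hs p).ne', one_mul]
  refine ((k1.add k2).add k3).congr_left fun p => ?_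
  have := hτ0 p
  rw [mul_sub, mul_sub, hζ]
  field_simp
  ring

variable {E : Type*} [NormedAddCommGroup E] [NormedSpace ℂ E]

/-- The new value of u - u₀ is δ(w - τ A w) with A = D / (k p₀), up to O(s ε²). Rescaling by δ⁻¹
e^{ηh} contributes the term ητ w and costs one power of ε, which is why the errors e₀ and e₁ are
required to carry two. -/
theorem isBigO_fiber {τ δ pu e₀ ζ a : α → ℂ} {q e₁ w : α → E} {u₀ : E} {k p₀ η : ℂ} {D : E →L[ℂ] E}
    (hτ : ∀ p, ‖τ p‖ = s p) (hs : ∀ p, 0 < s p)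
    (hs0 : Tendsto s l (𝓝 0)) (hδ : ∀ p, ‖δ p‖ = ε p) (hε : ∀ p, 0 < ε p) (hsε : s =O[l] ε)
    (hε0 : Tendsto ε l (𝓝 0)) (hζ : ∀ p, ζ p = -(τ p / (k * p₀)) * pu p + e₀ p) (hζs : ζ =O[l] s)
    (hw : w =O[l] fun _ => (1 : ℝ)) (ha : a =O[l] ε)
    (he₀ : e₀ =O[l] fun p => s p * (ε p * ε p)) (he₁ : e₁ =O[l] fun p => s p * (ε p * ε p))
    (hr : (fun p => q p - pu p • (u₀ + δ p • w p) - D (δ p • w p)) =O[l] fun p => ε p * ε p) :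
    (fun p => (τ p)⁻¹ • (w p - ((δ p)⁻¹ * Complex.exp (η * (τ p * (1 + a p)))) •
      ((1 + ζ p)⁻¹ • (u₀ + δ p • w p + -(τ p / (k * p₀)) • q p + e₁ p) - u₀)) -
      (((k * p₀)⁻¹ • D) (w p) - η • w p)) =O[l] ε := by
  have hτ0 (p) : τ p ≠ 0 := by rw [← norm_ne_zero_iff, hτ]; exact (hs p).ne'
  have hδ0 (p) : δ p ≠ 0 := by rw [← norm_ne_zero_iff, hδ]; exact (hε p).ne'
  have hτs : τ =O[l] s := IsBigO.of_bound 1 (Eventually.of_forall fun p => by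
    rw [hτ, one_mul, Real.norm_of_nonneg (hs p).le])
  have hτi : (fun p => (τ p)⁻¹) =O[l] fun p => (s p)⁻¹ :=
    IsBigO.of_bound 1 (Eventually.of_forall fun p => by
      rw [norm_inv, hτ, one_mul, norm_inv, Real.norm_of_nonneg (hs p).le])
  have hδε : δ =O[l] ε := IsBigO.of_bound 1 (Eventually.of_forall fun p => by
    rw [hδ, one_mul, Real.norm_of_nonneg (hε p).le])
  have hδi : (fun p => (δ p)⁻¹) =O[l] fun p => (ε p)⁻¹ :=
    IsBigO.of_bound 1 (Eventually.of_forall fun p => by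
      rw [norm_inv, hδ, one_mul, norm_inv, Real.norm_of_nonneg (hε p).le])
  have hε1 : ε =O[l] fun _ => (1 : ℝ) := hε0.isBigO_one ℝ
  have hs1 : s =O[l] fun _ => (1 : ℝ) := hs0.isBigO_one ℝ
  have c1 (z : ℂ) : (fun _ : α => z) =O[l] fun _ => (1 : ℝ) :=
    isBigO_const_const z one_ne_zero l
  have hδw : (fun p => δ p • w p) =O[l] ε := by simpa using hδε.smul hw
  set u : α → E := fun p => u₀ + δ p • w p with hu
  have hu1 : u =O[l] fun _ => (1 : ℝ) :=
    (isBigO_const_const u₀ one_ne_zero l).add (hδw.trans hε1)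
  set r : α → E := fun p => q p - pu p • u p with hr'
  set xk : α → ℂ := fun p => -(τ p / (k * p₀)) with hxk
  have hxks : xk =O[l] s := by
    refine IsBigO.neg_left ?_
    simp only [div_eq_mul_inv]
    simpa using hτs.mul (c1 (k * p₀)⁻¹)
  have hDw : (fun p => D (δ p • w p)) =O[l] ε := (D.isBigO_comp _ l).trans hδw
  have hεε : (fun p => ε p * ε p) =O[l] ε := by simpa using (isBigO_refl ε l).mul hε1
  have hrε : r =O[l] ε := by
    have h1 := (hr.trans hεε).add hDw
    simpa [hr', hu] using h1
  -- the numerator of the difference between the new and the old affine coordinates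
  set N : α → E := fun p => xk p • r p + e₁ p - e₀ p • u p with hN
  have he₀u : (fun p => e₀ p • u p) =O[l] fun p => s p * (ε p * ε p) := by
    simpa using he₀.smul hu1
  have hNs : N =O[l] fun p => s p * ε p := by
    have h1 : (fun p => s p * (ε p * ε p)) =O[l] fun p => s p * ε p :=
      (isBigO_refl s l).mul hεε
    exact ((hxks.smul hrε).add (he₁.trans h1)).sub (he₀u.trans h1)
  have hinv : (fun p => (1 + ζ p)⁻¹ - 1) =O[l] s := by
    have h0 : Tendsto ζ l (𝓝 0) := hζs.trans_tendsto hs0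
    have h2 := h0.norm.eventually (gt_mem_nhds (by simp : ‖(0 : ℂ)‖ < 1 / 2))
    refine IsBigO.trans (IsBigO.of_bound 2 ?_) hζs
    filter_upwards [h2] with p hp
    have h3 : 1 / 2 ≤ ‖1 + ζ p‖ := by
      have := norm_sub_le_norm_add (1 : ℂ) (ζ p)
      rw [norm_one] at this
      linarith
    have h4 : 1 + ζ p ≠ 0 := by rw [← norm_pos_iff]; linarith
    have h5 : (1 + ζ p)⁻¹ - 1 = -(ζ p * (1 + ζ p)⁻¹) := by field_simp; ring
    rw [h5, norm_neg, norm_mul, norm_inv, mul_comm]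
    gcongr
    rw [inv_le_comm₀ (by linarith) (by norm_num)]
    linarith
  have hne : ∀ᶠ p in l, 1 + ζ p ≠ 0 := by
    have h0 : Tendsto ζ l (𝓝 0) := hζs.trans_tendsto hs0
    filter_upwards [h0.norm.eventually (gt_mem_nhds (by simp : ‖(0 : ℂ)‖ < 1 / 2))] with p hp h
    have : ζ p = -1 := by linear_combination h
    rw [this] at hp
    norm_num at hp
  -- the error term in the new affine coordinate
  set e₂ : α → E := fun p => xk p • (r p - D (δ p • w p)) + e₁ p - e₀ p • u p +
    ((1 + ζ p)⁻¹ - 1) • N p with he₂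
  have he₂s : e₂ =O[l] fun p => s p * (ε p * ε p) := by
    refine ((((hxks.smul hr).add he₁).sub he₀u).add ?_)
    refine (hinv.smul hNs).trans ?_
    have := (isBigO_refl s l).mul (hsε.mul (isBigO_refl ε l))
    simpa using this
  have hnew (p) (hp : 1 + ζ p ≠ 0) : (1 + ζ p)⁻¹ • (u₀ + δ p • w p + -(τ p / (k * p₀)) • q p + e₁ p) -
      u₀ = δ p • (w p - τ p • (((k * p₀)⁻¹ • D) (w p))) + e₂ p := by
    have h1 : u₀ + δ p • w p + -(τ p / (k * p₀)) • q p + e₁ p = (1 + ζ p) • u p + N p := by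
      simp only [hN, hr', hu, hxk, hζ]
      module
    rw [h1, smul_add, smul_smul, inv_mul_cancel₀ hp, one_smul]
    have h2 : N p = xk p • D (δ p • w p) + (xk p • (r p - D (δ p • w p)) + e₁ p - e₀ p • u p) := by
      simp only [hN]; module
    have h3 : xk p • D (δ p • w p) = -(δ p • τ p • (((k * p₀)⁻¹ • D) (w p))) := by
      rw [map_smul, _root_.smul_apply, hxk]
      simp only [smul_smul, ← neg_smul]
      congr 1
      ring
    simp only [he₂]
    rw [sub_smul, one_smul]
    conv_lhs => rw [show (1 + ζ p)⁻¹ • N p = ((1 + ζ p)⁻¹ • N p - N p) + N p by abel]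
    rw [smul_sub]
    nth_rewrite 2 [h2]
    rw [h3]
    rw [smul_sub (δ p)]
    simp only [hu]
    abel
  set g : α → ℂ := fun p => Complex.exp (η * (τ p * (1 + a p))) with hg
  have h1a : (fun p => 1 + a p) =O[l] fun _ => (1 : ℝ) := (c1 1).add (ha.trans hε1)
  have hh : (fun p => η * (τ p * (1 + a p))) =O[l] s := by
    have := (hτs.mul h1a).const_mul_left η
    simpa using this
  have hss : (fun p => s p * s p) =O[l] fun p => s p * ε p := (isBigO_refl s l).mul hsε
  have hg1 : (fun p => g p - 1 - η * τ p) =O[l] fun p => s p * ε p := by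
    have h1 := (isBigO_exp_sub hh hs0).trans hss
    have h2 := (hτs.mul ha).const_mul_left η
    refine (h1.add h2).congr_left fun p => ?_
    simp only [hg]; ring
  have hg2 : (fun p => g p - 1) =O[l] s := by
    have h1 : (fun p => s p * ε p) =O[l] s := by simpa using (isBigO_refl s l).mul hε1
    have h2 := (hg1.trans h1).add (hτs.const_mul_left η)
    refine h2.congr_left fun p => ?_
    ring
  have hg3 : g =O[l] fun _ => (1 : ℝ) := by
    have h2 := (hg2.trans hs1).add (c1 1)
    simpa using h2
  have k1 : (fun p => ((τ p)⁻¹ * (g p - 1 - η * τ p)) • w p) =O[l] ε := by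
    have h1 := (hτi.mul hg1).smul hw
    refine h1.congr_right fun p => ?_
    rw [← mul_assoc, inv_mul_cancel₀ (hs p).ne', one_mul, smul_eq_mul, mul_one]
  have k2 : (fun p => (g p - 1) • (((k * p₀)⁻¹ • D) (w p))) =O[l] ε := by
    have h1 := (hg2.trans hsε).smul ((((k * p₀)⁻¹ • D).isBigO_comp w l).trans hw)
    simpa using h1
  have k3 : (fun p => ((τ p)⁻¹ * (g p * (δ p)⁻¹)) • e₂ p) =O[l] ε := by
    have h1 := (hτi.mul (hg3.mul hδi)).smul he₂s
    refine h1.congr_right fun p => ?_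
    have := (hs p).ne'
    have := (hε p).ne'
    rw [smul_eq_mul]
    field_simp
  refine ((k2.sub k1).sub k3).congr' (hne.mono fun p hp => ?_) EventuallyEq.rfl
  beta_reduce
  rw [hnew p hp]
  have := hτ0 p
  have := hδ0 p
  change _ = (τ p)⁻¹ • (w p - ((δ p)⁻¹ * g p) • (δ p • (w p - τ p • (((k * p₀)⁻¹ • D) (w p))) + e₂ p)) -
    (((k * p₀)⁻¹ • D) (w p) - η • w p)
  rw [smul_add ((δ p)⁻¹ * g p), smul_smul ((δ p)⁻¹ * g p),
    show (δ p)⁻¹ * g p * δ p = g p by field_simp]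
  generalize e₂ p = x
  generalize ((k * p₀)⁻¹ • D) (w p) = y
  match_scalars
  all_goals field_simp
  all_goals ring

end Asymptotics

end ParabolicManifolds
end
-- The local form of the germ near a non-degenerate characteristic direction.
noncomputable section
namespace ParabolicManifolds
open Metric Set Asymptotics

variable {m : ℕ}

section Characteristic

variable {Φ : Cn (m + 1) → Cn (m + 1)} {k : ℕ} {V : Cn (m + 1)} {j : Fin (m + 1)}

theorem homogeneousPart_point (hV : IsNondegenerateCharacteristicDirection Φ k V) (hj : V j ≠ 0) :
    ∃ c : ℂ, c ≠ 0 ∧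
      homogeneousPart Φ (k + 1) (point j 1 (affineCoord j V)) = c • point j 1 (affineCoord j V) := by
  obtain ⟨-, ⟨c, hc⟩, hne⟩ := hV
  set v := point j 1 (affineCoord j V) with hv
  have hVv : V = V j • v := eq_smul_point j hj
  have hc0 : c ≠ 0 := by rintro rfl; exact hne (by rw [hc, zero_smul])
  refine ⟨(V j ^ (k + 1))⁻¹ * (c * V j), by positivity, ?_⟩
  have h1 : V j ^ (k + 1) • homogeneousPart Φ (k + 1) v = (c * V j) • v := by
    rw [← homogeneousPart_smul, ← hVv, hc, mul_smul, ← hVv]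
  rw [mul_smul, ← h1, smul_smul, inv_mul_cancel₀ (by positivity), one_smul]

theorem pPart_ne_zero (hV : IsNondegenerateCharacteristicDirection Φ k V) (hj : V j ≠ 0) :
    pPart Φ k j (affineCoord j V) ≠ 0 := by
  obtain ⟨c, hc0, hc⟩ := homogeneousPart_point hV hj
  rw [pPart, hc]
  simpa using hc0

theorem rMap_eq_zero (hV : IsNondegenerateCharacteristicDirection Φ k V) (hj : V j ≠ 0) :
    rMap Φ k j (affineCoord j V) = 0 := by
  obtain ⟨c, hc0, hc⟩ := homogeneousPart_point hV hj
  ext i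
  simp [rMap, qPart, pPart, hc]

theorem differentiable_pPart (Φ : Cn (m + 1) → Cn (m + 1)) (k : ℕ) (j : Fin (m + 1)) :
    Differentiable ℂ (pPart Φ k j) :=
  (EuclideanSpace.proj (𝕜 := ℂ) j).differentiable.comp
    ((differentiable_homogeneousPart Φ (k + 1)).comp (differentiable_point j 1))

theorem differentiable_rMap (Φ : Cn (m + 1) → Cn (m + 1)) (k : ℕ) (j : Fin (m + 1)) :
    Differentiable ℂ (rMap Φ k j) := by
  have hq : Differentiable ℂ (qPart Φ k j) :=
    (otherCoords j).differentiable.comp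
      ((differentiable_homogeneousPart Φ (k + 1)).comp (differentiable_point j 1))
  exact hq.sub ((differentiable_pPart Φ k j).smul differentiable_id)

end Characteristic

/-- The coordinate `x` as a function of the time `t`. -/
def xCoord (κ : ℂ) (k : ℕ) (t : ℂ) : ℂ := κ * Complex.exp (-(t / k))

/-- The point with `x = κ e^{-t/k}` and affine coordinate `u₀ + e^{-ηt} w`. -/
def sectorChart (κ : ℂ) (k : ℕ) (η : ℝ) (j : Fin (m + 1)) (u₀ : Fin m → ℂ)
    (p : ℂ × (Fin m → ℂ)) : Cn (m + 1) :=
  xCoord κ k p.1 • point j 1 (u₀ + Complex.exp (-(η * p.1)) • p.2)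

/-- The filter of the pairs `(t, w)` with `Re t → ∞`, `|Im t| < 1` and `‖w‖ < 1`. -/
def farFilter (m : ℕ) : Filter (ℂ × (Fin m → ℂ)) :=
  comap (fun p => p.1.re) atTop ⊓ 𝓟 {p | |p.1.im| < 1 ∧ p.2 ∈ ball 0 1}

theorem exists_forall_strip_of_eventually {P : ℂ × (Fin m → ℂ) → Prop}
    (h : ∀ᶠ p in farFilter m, P p) :
    ∃ T, 0 ≤ T ∧ ∀ p ∈ strip T 1 ×ˢ ball (0 : Fin m → ℂ) 1, P p := by
  rw [farFilter, eventually_inf_principal, eventually_comap] at h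
  obtain ⟨T, hT⟩ := eventually_atTop.1 h
  exact ⟨max T 0, le_max_right _ _, fun p hp =>
    hT p.1.re ((le_max_left _ _).trans hp.1.1.le) p rfl ⟨hp.1.2, hp.2⟩⟩

theorem tendsto_re_farFilter : Tendsto (fun p : ℂ × (Fin m → ℂ) => p.1.re) (farFilter m) atTop :=
  tendsto_comap.mono_left inf_le_left

theorem eventually_norm_le_one_farFilter : ∀ᶠ p in farFilter m, ‖p.2‖ ≤ 1 :=
  eventually_inf_principal.2 <| Eventually.of_forall fun p hp => by
    have := hp.2
    rw [mem_ball_zero_iff] at this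
    exact this.le

theorem tendsto_exp_farFilter {η : ℝ} (hη : 0 < η) :
    Tendsto (fun p : ℂ × (Fin m → ℂ) => Real.exp (-η * p.1.re)) (farFilter m) (𝓝 0) := by
  have := (tendsto_const_mul_exp_neg hη 1).comp (tendsto_re_farFilter (m := m))
  simpa only [one_mul, Function.comp_def] using this

theorem norm_exp_neg_mul (η : ℝ) (t : ℂ) : ‖Complex.exp (-(η * t))‖ = Real.exp (-η * t.re) := by
  simp [Complex.norm_exp]

theorem norm_xCoord (κ : ℂ) (k : ℕ) (t : ℂ) :
    ‖xCoord κ k t‖ = ‖κ‖ * Real.exp (-(1 / k : ℝ) * t.re) := by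
  rw [xCoord, norm_mul, Complex.norm_exp]
  congr 2
  rw [Complex.neg_re, div_eq_mul_inv, ← Complex.ofReal_natCast, ← Complex.ofReal_inv,
    Complex.re_mul_ofReal]
  ring

theorem xCoord_ne_zero {κ : ℂ} (hκ : κ ≠ 0) (k : ℕ) (t : ℂ) : xCoord κ k t ≠ 0 :=
  mul_ne_zero hκ (Complex.exp_ne_zero _)

theorem xCoord_pow {k : ℕ} (hk : k ≠ 0) (κ t : ℂ) :
    xCoord κ k t ^ k = κ ^ k * Complex.exp (-t) := by
  have : (k : ℂ) ≠ 0 := by exact_mod_cast hk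
  rw [xCoord, mul_pow, ← Complex.exp_nat_mul]
  congr 2
  field_simp

theorem differentiable_xCoord (κ : ℂ) (k : ℕ) : Differentiable ℂ (xCoord κ k) := by
  unfold xCoord; fun_prop

theorem differentiable_sectorChart (κ : ℂ) (k : ℕ) (η : ℝ) (j : Fin (m + 1)) (u₀ : Fin m → ℂ) :
    Differentiable ℂ (sectorChart κ k η j u₀) := by
  refine ((differentiable_xCoord κ k).comp differentiable_fst).smul
    ((differentiable_point j 1).comp ?_)
  fun_prop

/-- The normalisation of κ gives x^k = -e^{-t} / (k p₀), so that time advances by e^{-t} to first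
order. The scaling u - u₀ = e^{-ηt} w makes the quadratic part of r negligible, at the price of
replacing A by A - η. -/
theorem exists_local_form {Φ : Cn (m + 1) → Cn (m + 1)} {U : Set (Cn (m + 1))}
    (hΦ : IsTangentToIdentity Φ U) {k : ℕ} (hk : HasOrder Φ (k + 1)) {V : Cn (m + 1)}
    (hV : IsNondegenerateCharacteristicDirection Φ k V) {j : Fin (m + 1)} (hj : V j ≠ 0)
    {η : ℝ} (hη : 0 < η) (hηk : 2 * η ≤ 1 / k) {κ : ℂ}
    (hκ : -(k : ℂ) * pPart Φ k j (affineCoord j V) * κ ^ k = 1) :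
    ∃ (T C : ℝ) (a : ℂ × (Fin m → ℂ) → ℂ) (b : ℂ × (Fin m → ℂ) → (Fin m → ℂ)), 0 ≤ T ∧
      SlowSystem T 1 η C a b ∧ ∀ p ∈ strip T 1 ×ˢ ball (0 : Fin m → ℂ) 1,
        sectorChart κ k η j (affineCoord j V) p ∈ U ∧
        Φ (sectorChart κ k η j (affineCoord j V) p) =
          sectorChart κ k η j (affineCoord j V) (slowStep
            (((k : ℂ) * pPart Φ k j (affineCoord j V))⁻¹ • fderiv ℂ (rMap Φ k j) (affineCoord j V) -
              (η : ℂ) • ContinuousLinearMap.id ℂ (Fin m → ℂ)) a b p) := by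
  have hk0 : k ≠ 0 := by have := hk.1; omega
  have hkC : (k : ℂ) ≠ 0 := by exact_mod_cast hk0
  have hk1 : (1 : ℝ) ≤ k := by exact_mod_cast Nat.one_le_iff_ne_zero.2 hk0
  set u₀ := affineCoord j V with hu₀
  set p₀ := pPart Φ k j u₀ with hp₀
  have hp₀0 : p₀ ≠ 0 := pPart_ne_zero hV hj
  have hκ0 : κ ≠ 0 := by
    rintro rfl
    rw [zero_pow hk0, mul_zero] at hκ
    exact zero_ne_one hκ
  set D := fderiv ℂ (rMap Φ k j) u₀ with hD
  set X := sectorChart κ k η j u₀ with hX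
  set l := farFilter m with hl
  let s : ℂ × (Fin m → ℂ) → ℝ := fun p => Real.exp (-p.1.re)
  let ε : ℂ × (Fin m → ℂ) → ℝ := fun p => Real.exp (-η * p.1.re)
  let τ : ℂ × (Fin m → ℂ) → ℂ := fun p => Complex.exp (-p.1)
  let δ : ℂ × (Fin m → ℂ) → ℂ := fun p => Complex.exp (-(η * p.1))
  let x : ℂ × (Fin m → ℂ) → ℂ := fun p => xCoord κ k p.1
  let u : ℂ × (Fin m → ℂ) → (Fin m → ℂ) := fun p => u₀ + δ p • p.2
  let pu : ℂ × (Fin m → ℂ) → ℂ := fun p => pPart Φ k j (u p)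
  let q : ℂ × (Fin m → ℂ) → (Fin m → ℂ) := fun p => qPart Φ k j (u p)
  let ζ : ℂ × (Fin m → ℂ) → ℂ := fun p => Φ (X p) j / x p - 1
  let R : ℂ × (Fin m → ℂ) → (Fin m → ℂ) := fun p => (x p)⁻¹ • otherCoords j (Φ (X p))
  let e₀ : ℂ × (Fin m → ℂ) → ℂ := fun p => ζ p - -(τ p / (k * p₀)) * pu p
  let e₁ : ℂ × (Fin m → ℂ) → (Fin m → ℂ) := fun p => R p - (u p + -(τ p / (k * p₀)) • q p)
  -- Both a and b are defined by solving the wanted conjugacy for them; it remains to show that they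
  -- are small and holomorphic.
  let a : ℂ × (Fin m → ℂ) → ℂ := fun p => (τ p)⁻¹ * (-k * Complex.log (1 + ζ p)) - 1
  let b : ℂ × (Fin m → ℂ) → (Fin m → ℂ) := fun p =>
    (τ p)⁻¹ • (p.2 - ((δ p)⁻¹ * Complex.exp (η * (τ p * (1 + a p)))) •
      ((1 + ζ p)⁻¹ • R p - u₀)) - ((((k : ℂ) * p₀)⁻¹ • D) p.2 - (η : ℂ) • p.2)
  have hx0 (p) : x p ≠ 0 := xCoord_ne_zero hκ0 k _
  have hτ (p) : ‖τ p‖ = s p := norm_exp_neg _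
  have hδ (p) : ‖δ p‖ = ε p := norm_exp_neg_mul _ _
  have hs (p) : 0 < s p := Real.exp_pos _
  have hε (p) : 0 < ε p := Real.exp_pos _
  have hs0 : Tendsto s l (𝓝 0) := by
    simpa only [s, neg_one_mul] using tendsto_exp_farFilter (m := m) one_pos
  have hε0 : Tendsto ε l (𝓝 0) := tendsto_exp_farFilter hη
  have hre : ∀ᶠ p in l, 0 < p.1.re := tendsto_re_farFilter.eventually (eventually_gt_atTop 0)
  have hη1 : η ≤ 1 := by
    have : 1 / (k : ℝ) ≤ 1 := by rw [div_le_one (by positivity)]; exact hk1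
    linarith
  have hsε : s =O[l] ε := by
    refine IsBigO.of_bound 1 (hre.mono fun p hp => ?_)
    rw [one_mul, Real.norm_of_nonneg (hs p).le, Real.norm_of_nonneg (hε p).le]
    exact Real.exp_le_exp.2 (by nlinarith)
  have hw : (fun p : ℂ × (Fin m → ℂ) => p.2) =O[l] fun _ => (1 : ℝ) :=
    IsBigO.of_bound 1 (eventually_norm_le_one_farFilter.mono fun p hp => by simpa using hp)
  have hxk (p) : x p ^ k = -(τ p / (k * p₀)) := by
    have h1 : κ ^ k = -(k * p₀)⁻¹ := by field_simp; linear_combination -hκ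
    change xCoord κ k p.1 ^ k = _
    rw [xCoord_pow hk0, h1]
    ring
  -- the domain of the Taylor expansion
  obtain ⟨K, hK⟩ := (isCompact_closedBall u₀ 1).exists_bound_of_continuousOn
    (differentiable_point j 1).continuous.continuousOn
  obtain ⟨r, hr, C, hC⟩ := hΦ.exists_taylor hk (lt_max_of_lt_right one_pos : 0 < max K 1)
  have hxs : Tendsto x l (𝓝 0) := by
    rw [tendsto_zero_iff_norm_tendsto_zero]
    have h1 : Tendsto (fun p : ℂ × (Fin m → ℂ) => ‖κ‖ * Real.exp (-(1 / k : ℝ) * p.1.re)) l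
        (𝓝 0) := by
      simpa only [mul_zero] using
        (tendsto_exp_farFilter (m := m) (by positivity : (0 : ℝ) < 1 / k)).const_mul ‖κ‖
    exact h1.congr fun p => (norm_xCoord κ k p.1).symm
  have hxr : ∀ᶠ p in l, ‖x p‖ < r := hxs.norm.eventually (gt_mem_nhds (by simpa using hr))
  have hδw : ∀ᶠ p in l, ‖δ p • p.2‖ ≤ ε p := eventually_norm_le_one_farFilter.mono fun p hp => by
    rw [norm_smul, hδ]
    exact mul_le_of_le_one_right (hε p).le hp
  have hε1 : ∀ᶠ p in l, ε p < 1 := hε0.eventually (gt_mem_nhds one_pos)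
  have htay : ∀ᶠ p in l, X p ∈ U ∧ ‖Φ (X p) - x p • point j 1 (u p) -
      x p ^ (k + 1) • homogeneousPart Φ (k + 1) (point j 1 (u p))‖ ≤ C * ‖x p‖ ^ (k + 2) := by
    filter_upwards [hxr, hδw, hε1] with p h1 h2 h3
    refine hC (point j 1 (u p)) (le_max_of_le_left (hK _ ?_)) (x p) h1
    rw [mem_closedBall, dist_eq_norm]
    simp only [u, add_sub_cancel_left]
    linarith
  -- Here 2η ≤ 1/k is used: |x|^k is comparable to s, and the extra factor |x|, comparable to e^{-Re
  -- t / k}, must be O(ε²).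
  have hbase : (fun p => ‖x p‖ ^ (k + 1)) =O[l] fun p => s p * (ε p * ε p) := by
    refine IsBigO.of_bound (‖κ‖ ^ (k + 1)) (hre.mono fun p hp => ?_)
    rw [norm_pow, norm_norm, Real.norm_of_nonneg (by have := hs p; have := hε p; positivity)]
    change ‖xCoord κ k p.1‖ ^ (k + 1) ≤ _
    rw [norm_xCoord, mul_pow, ← Real.exp_nat_mul]
    simp only [s, ε]
    rw [← Real.exp_add, ← Real.exp_add]
    refine mul_le_mul_of_nonneg_left (Real.exp_le_exp.2 ?_) (by positivity)
    push_cast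
    have h1 : ((k : ℝ) + 1) * (-(1 / k) * p.1.re) = -p.1.re - (1 / k) * p.1.re := by
      field_simp; ring
    rw [h1]
    nlinarith
  have he₀ : e₀ =O[l] fun p => s p * (ε p * ε p) := by
    refine IsBigO.trans (IsBigO.of_bound C (htay.mono fun p hp => ?_)) hbase
    set Q := Φ (X p) - x p • point j 1 (u p) -
      x p ^ (k + 1) • homogeneousPart Φ (k + 1) (point j 1 (u p)) with hQ
    have h1 : e₀ p = Q j / x p := by
      have := hx0 p
      simp only [e₀, ζ, hQ, ← hxk, PiLp.sub_apply, PiLp.smul_apply, point_apply_self, smul_eq_mul,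
        pu, pPart]
      field_simp
      ring
    have h2 : ‖Q j‖ ≤ C * ‖x p‖ ^ (k + 2) := (PiLp.norm_apply_le Q j).trans hp.2
    have h3 := norm_pos_iff.2 (hx0 p)
    rw [h1, norm_div, norm_pow, norm_norm, div_le_iff₀ h3]
    refine h2.trans_eq (by ring)
  have he₁ : e₁ =O[l] fun p => s p * (ε p * ε p) := by
    refine IsBigO.trans (IsBigO.of_bound (‖otherCoords j‖ * C) (htay.mono fun p hp => ?_)) hbase
    set Q := Φ (X p) - x p • point j 1 (u p) -
      x p ^ (k + 1) • homogeneousPart Φ (k + 1) (point j 1 (u p)) with hQ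
    have h1 : e₁ p = (x p)⁻¹ • otherCoords j Q := by
      have := hx0 p
      ext i
      simp only [e₁, R, hQ, ← hxk, otherCoords_apply, PiLp.sub_apply, PiLp.smul_apply,
        point_apply_succAbove, smul_eq_mul, Pi.sub_apply, Pi.add_apply, Pi.smul_apply, q, qPart]
      field_simp
      ring
    have h2 : ‖otherCoords j Q‖ ≤ ‖otherCoords j‖ * (C * ‖x p‖ ^ (k + 2)) :=
      ((otherCoords j).le_opNorm Q).trans (by gcongr; exact hp.2)
    have h3 := norm_pos_iff.2 (hx0 p)
    rw [h1, norm_smul, norm_inv, norm_pow, norm_norm, inv_mul_le_iff₀ h3]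
    refine h2.trans_eq (by ring)
  have hut : Tendsto u l (𝓝 u₀) := by
    have h1 : Tendsto (fun p => δ p • p.2) l (𝓝 0) :=
      squeeze_zero_norm' hδw hε0
    simpa [u] using h1.const_add u₀
  have hδwO : (fun p => δ p • p.2) =O[l] ε := IsBigO.of_bound 1 (hδw.mono fun p hp => by
    rwa [one_mul, Real.norm_of_nonneg (hε p).le])
  have hpu : (fun p => pu p - p₀) =O[l] ε := by
    have h1 := (differentiable_pPart Φ k j u₀).isBigO_sub.comp_tendsto hut
    refine IsBigO.trans (h1.congr_right fun p => ?_) hδwO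
    simp [u]
  have hrO : (fun p => q p - pu p • (u₀ + δ p • p.2) - D (δ p • p.2)) =O[l]
      fun p => ε p * ε p := by
    obtain ⟨M, hM⟩ := (isCompact_closedBall u₀ 1).exists_bound_of_continuousOn
      (differentiable_rMap Φ k j).continuous.continuousOn
    refine IsBigO.of_bound (4 * M) ?_
    filter_upwards [hδw, hε1] with p h2 h3
    have h4 : u p ∈ ball u₀ 1 := by
      rw [mem_ball, dist_eq_norm]
      simp only [u, add_sub_cancel_left]
      linarith
    have h5 := norm_sub_sub_fderiv_le (f := rMap Φ k j) one_pos
      (differentiable_rMap Φ k j).differentiableOn (fun y hy => hM y (ball_subset_closedBall hy)) h4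
    have h6 : u p - u₀ = δ p • p.2 := by simp [u]
    have hM0 : 0 ≤ M := (norm_nonneg _).trans (hM u₀ (mem_closedBall_self zero_le_one))
    rw [rMap_eq_zero hV hj, sub_zero, h6] at h5
    refine h5.trans ?_
    rw [div_one, Real.norm_of_nonneg (mul_nonneg (hε p).le (hε p).le), ← sq]
    gcongr
  have hεε : (fun p => ε p * ε p) =O[l] ε := by
    simpa using (isBigO_refl ε l).mul (hε0.isBigO_one ℝ)
  have hζ (p) : ζ p = -(τ p / (k * p₀)) * pu p + e₀ p := by simp only [e₀]; ring
  obtain ⟨hζs, ha⟩ := isBigO_time hkC hp₀0 hτ hs hs0 hsε hε0 hζ hpu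
    (he₀.trans ((isBigO_refl s l).mul hεε))
  have hb : b =O[l] ε := by
    have h1 := isBigO_fiber (η := (η : ℂ)) hτ hs hs0 hδ hε hsε hε0 hζ hζs hw ha he₀ he₁ hrO
    refine h1.congr_left fun p => ?_
    have h2 : u₀ + δ p • p.2 + -(τ p / (k * p₀)) • q p + e₁ p = R p := by
      simp only [e₁, u]; abel
    rw [h2]
  -- conclusion
  obtain ⟨Ca, hCa⟩ := ha.bound
  obtain ⟨Cb, hCb⟩ := hb.bound
  have hζ1 : ∀ᶠ p in l, ‖ζ p‖ < 1 :=
    (hζs.trans_tendsto hs0).norm.eventually (gt_mem_nhds (by simp))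
  obtain ⟨T, hT, hP⟩ := exists_forall_strip_of_eventually (hCa.and (hCb.and (hζ1.and htay)))
  have hτd : Differentiable ℂ τ := by simp only [τ]; fun_prop
  have hδd : Differentiable ℂ δ := by simp only [δ]; fun_prop
  have hxd : Differentiable ℂ x := (differentiable_xCoord κ k).comp differentiable_fst
  have hτ0 (p) : τ p ≠ 0 := Complex.exp_ne_zero _
  have hδ0 (p) : δ p ≠ 0 := Complex.exp_ne_zero _
  have hΦX : DifferentiableOn ℂ (fun p => Φ (X p)) (strip T 1 ×ˢ ball (0 : Fin m → ℂ) 1) :=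
    hΦ.holomorphic.comp (differentiable_sectorChart κ k η j u₀).differentiableOn
      fun p hp => (hP p hp).2.2.2.1
  have hslit (p) (hp : p ∈ strip T 1 ×ˢ ball (0 : Fin m → ℂ) 1) : 1 + ζ p ∈ Complex.slitPlane :=
    Complex.mem_slitPlane_of_norm_lt_one (hP p hp).2.2.1
  have hζd : DifferentiableOn ℂ ζ (strip T 1 ×ˢ ball (0 : Fin m → ℂ) 1) := by
    simp only [ζ, div_eq_mul_inv]
    exact (((EuclideanSpace.proj (𝕜 := ℂ) j).differentiable.comp_differentiableOn hΦX).mul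
      (hxd.differentiableOn.inv fun p _ => hx0 p)).sub_const 1
  have hRd : DifferentiableOn ℂ R (strip T 1 ×ˢ ball (0 : Fin m → ℂ) 1) :=
    (hxd.differentiableOn.inv fun p _ => hx0 p).smul
      ((otherCoords j).differentiable.comp_differentiableOn hΦX)
  have had : DifferentiableOn ℂ a (strip T 1 ×ˢ ball (0 : Fin m → ℂ) 1) :=
    ((hτd.differentiableOn.inv fun p _ => hτ0 p).mul
      (((hζd.const_add 1).clog hslit).const_mul _)).sub_const 1
  have hbd : DifferentiableOn ℂ b (strip T 1 ×ˢ ball (0 : Fin m → ℂ) 1) := by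
    refine ((hτd.differentiableOn.inv fun p _ => hτ0 p).smul (differentiableOn_snd.sub
      (((hδd.differentiableOn.inv fun p _ => hδ0 p).mul
        ((hτd.differentiableOn.mul (had.const_add 1)).const_mul _).cexp).smul
        ((((hζd.const_add 1).inv fun p hp => Complex.slitPlane_ne_zero (hslit p hp)).smul
          hRd).sub_const u₀)))).sub ?_
    exact ((((k : ℂ) * p₀)⁻¹ • D).differentiable.comp differentiable_snd).differentiableOn.sub
      (differentiable_snd.const_smul (η : ℂ)).differentiableOn
  refine ⟨T, max Ca Cb, a, b, hT, ⟨had, hbd, fun p hp => ?_, fun p hp => ?_⟩, fun p hp =>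
    ⟨(hP p hp).2.2.2.1, ?_⟩⟩
  · have := (hP p hp).1
    rw [Real.norm_of_nonneg (hε p).le] at this
    exact this.trans (mul_le_mul_of_nonneg_right (le_max_left _ _) (hε p).le)
  · have := (hP p hp).2.1
    rw [Real.norm_of_nonneg (hε p).le] at this
    exact this.trans (mul_le_mul_of_nonneg_right (le_max_right _ _) (hε p).le)
  · have h1ζ : 1 + ζ p ≠ 0 := Complex.slitPlane_ne_zero (hslit p hp)
    have hzj : Φ (X p) j = x p * (1 + ζ p) := by
      have := hx0 p
      simp only [ζ]; field_simp; ring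
    have hzj0 : Φ (X p) j ≠ 0 := by rw [hzj]; exact mul_ne_zero (hx0 p) h1ζ
    have hco : affineCoord j (Φ (X p)) = (1 + ζ p)⁻¹ • R p := by
      have := hx0 p
      ext i
      simp only [affineCoord, hzj, R, Pi.smul_apply, otherCoords_apply, smul_eq_mul]
      field_simp
    set h := τ p * (1 + a p) with hh
    have hha : h = -k * Complex.log (1 + ζ p) := by
      simp only [hh, a]
      rw [add_sub_cancel, ← mul_assoc, mul_inv_cancel₀ (hτ0 p), one_mul]
    have hst : slowStep (((k : ℂ) * p₀)⁻¹ • D - (η : ℂ) • ContinuousLinearMap.id ℂ (Fin m → ℂ)) a b p =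
        (p.1 + h, ((δ p)⁻¹ * Complex.exp (η * h)) • ((1 + ζ p)⁻¹ • R p - u₀)) := by
      refine Prod.ext rfl ?_
      change p.2 - τ p • ((((k : ℂ) * p₀)⁻¹ • D - (η : ℂ) • ContinuousLinearMap.id ℂ (Fin m → ℂ)) p.2
        + b p) = _
      simp only [b]
      rw [show (((k : ℂ) * p₀)⁻¹ • D - (η : ℂ) • ContinuousLinearMap.id ℂ (Fin m → ℂ)) p.2 =
        (((k : ℂ) * p₀)⁻¹ • D) p.2 - (η : ℂ) • p.2 from rfl, add_sub_cancel, smul_smul, mul_inv_cancel₀ (hτ0 p), one_smul, sub_sub_cancel]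
    rw [hst, eq_smul_point j hzj0, hco]
    change _ = xCoord κ k (p.1 + h) • point j 1 (u₀ + Complex.exp (-(η * (p.1 + h))) •
      ((δ p)⁻¹ * Complex.exp (η * h)) • ((1 + ζ p)⁻¹ • R p - u₀))
    have e1 : Complex.exp (-(η * (p.1 + h))) * ((δ p)⁻¹ * Complex.exp (η * h)) = 1 := by
      simp only [δ]
      rw [← Complex.exp_neg, ← Complex.exp_add, ← Complex.exp_add, Complex.exp_eq_one_iff]
      exact ⟨0, by push_cast; ring⟩
    have e2 : xCoord κ k (p.1 + h) = x p * (1 + ζ p) := by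
      simp only [x, xCoord]
      rw [mul_assoc, hha, show -((p.1 + -k * Complex.log (1 + ζ p)) / k) =
        -(p.1 / k) + Complex.log (1 + ζ p) by field_simp; ring, Complex.exp_add,
        Complex.exp_log h1ζ]
    rw [smul_smul (Complex.exp (-(η * (p.1 + h)))), e1, one_smul, add_sub_cancel u₀, e2, hzj]

end ParabolicManifolds
end
-- Invariant graphs for a given rate β, their orbits, and their inclusions.
noncomputable section
namespace ParabolicManifolds
open Metric Set

variable {E : Type*} [NormedAddCommGroup E] [NormedSpace ℂ E] {n n' : ℕ}

theorem injective_chart (β : ℝ) (c : ℂ → E) {E' : Type*} [NormedAddCommGroup E'] [NormedSpace ℂ E']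
    (J : E' ≃L[ℂ] E) : Function.Injective (chart β c J) := by
  intro p q h
  have h1 : p.1 = q.1 := congrArg (fun z : ℂ × E => z.1) h
  have h2 : c p.1 + Complex.exp (-(β * p.1)) • J p.2 = c q.1 + Complex.exp (-(β * q.1)) • J q.2 :=
    congrArg (fun z : ℂ × E => z.2) h
  rw [h1] at h2
  refine Prod.ext h1 (J.injective ?_)
  exact smul_right_injective E (Complex.exp_ne_zero _) (add_left_cancel h2)

/-- The graph of `g` over a strip, in the chart around the curve `c`. -/
def graphChart (β : ℝ) (c : ℂ → E) (J : (Cn n × Cn n') ≃L[ℂ] E) (g : ℂ × Cn n → Cn n')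
    (p : ℂ × Cn n) : ℂ × E := chart β c J (graphPoint g p)

/-- The graph of `g` is an invariant manifold of `F` in the chart around the curve `c`. -/
structure InvariantGraph (F : ℂ × E → ℂ × E) (T θ η β ρ : ℝ) (c : ℂ → E)
    (J : (Cn n × Cn n') ≃L[ℂ] E) (g : ℂ × Cn n → Cn n') : Prop where
  ρ_pos : 0 < ρ
  ρ_le : ρ ≤ 1
  admissible : IsAdmissible T θ η ρ g
  norm_le : ∀ p ∈ strip T θ ×ˢ ball 0 ρ, ‖g p‖ ≤ ρ / 2
  step : ∀ T', T ≤ T' → ∀ p ∈ strip T' θ ×ˢ ball 0 (ρ / 2), ∃ p' ∈ strip T' θ ×ˢ ball 0 (ρ / 2),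
    F (graphChart β c J g p) = graphChart β c J g p' ∧ p.1.re + Real.exp (-p.1.re) / 4 ≤ p'.1.re
  unique : ∀ P : ℂ × (Cn n × Cn n'), (∀ i, ∃ Q ∈ strip T θ ×ˢ ball 0 ρ,
    F^[i] (chart β c J P) = chart β c J Q) → P.2.2 = g (P.1, P.2.1)

/-- Stated for all sufficiently small θ so that finitely many rates β can share one strip width;
this is needed to compare the graphs. -/
theorem exists_invariantGraph {T C C₁ C₂ η β m : ℝ} {B : E →L[ℂ] E} {a : ℂ × E → ℂ}
    {b : ℂ × E → E} (H : SlowSystem T (1 / 2) η C a b) (hη : 0 < η) (hη1 : η ≤ 1)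
    (hβ : 0 < β) {c : ℂ → E} (hc : DifferentiableOn ℂ c (strip T (1 / 2)))
    (hc1 : ∀ t ∈ strip T (1 / 2), ‖c t‖ ≤ C₁ * Real.exp (-η * t.re))
    (hc2 : ∀ t ∈ strip T (1 / 2), ‖residual B a b c t‖ ≤ C₂ * Real.exp (-(β + η) * t.re))
    (J : (Cn n × Cn n') ≃L[ℂ] E) {As : Cn n →L[ℂ] Cn n} {Ac : Cn n' →L[ℂ] Cn n'} (hm : 0 < m)
    (hJ : ∀ w, B (J w) = J (As w.1, Ac w.2))
    (hAs : ∀ w, (β + m) * ‖w‖ ^ 2 ≤ (inner ℂ w (As w)).re)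
    (hAc : ∀ w, (inner ℂ w (Ac w)).re ≤ (β - m) * ‖w‖ ^ 2) :
    ∀ᶠ θ in 𝓝[>] (0 : ℝ), ∃ T' ρ g, T ≤ T' ∧
      MapsTo (chart β c J) (strip T' θ ×ˢ ball 0 1) (strip T (1 / 2) ×ˢ ball (0 : E) 1) ∧
      InvariantGraph (slowStep B a b) T' θ η β ρ c J g := by
  set Bs : Cn n →L[ℂ] Cn n := As - (β : ℂ) • ContinuousLinearMap.id ℂ _ with hBs
  set Bc : Cn n' →L[ℂ] Cn n' := Ac - (β : ℂ) • ContinuousLinearMap.id ℂ _ with hBc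
  have hlin : chartLinear B β J = Bs.prodMap Bc := by
    refine ContinuousLinearMap.ext fun w => ?_
    have h1 : chartLinear B β J w = J.symm (B (J w)) - (β : ℂ) • w := rfl
    rw [h1, hJ, J.symm_apply_apply]
    rfl
  set m' := min m 1 with hm'
  have hm'0 : 0 < m' := lt_min hm one_pos
  have hin {N : ℕ} (w : Cn N) : (inner ℂ w ((β : ℂ) • w)).re = β * ‖w‖ ^ 2 := by
    rw [inner_smul_right, inner_self_eq_norm_sq_to_K]
    change ((β : ℂ) * ((‖w‖ : ℝ) : ℂ) ^ 2).re = _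
    rw [← Complex.ofReal_pow, Complex.re_mul_ofReal, Complex.ofReal_re]
  have hBs1 (w) : m' * ‖w‖ ^ 2 ≤ (inner ℂ w (Bs w)).re := by
    have h1 : Bs w = As w - (β : ℂ) • w := rfl
    rw [h1, inner_sub_right, Complex.sub_re, hin]
    nlinarith [hAs w, min_le_left m 1, sq_nonneg ‖w‖]
  have hBc1 (w) : (inner ℂ w (Bc w)).re ≤ -m' * ‖w‖ ^ 2 := by
    have h1 : Bc w = Ac w - (β : ℂ) • w := rfl
    rw [h1, inner_sub_right, Complex.sub_re, hin]
    nlinarith [hAc w, min_le_left m 1, sq_nonneg ‖w‖]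
  obtain ⟨T₁, C', hT₁, hslow, hmaps⟩ := H.exists_chart hη hη1 (by norm_num : (1 / 4 : ℝ) < 1 / 2)
    hβ J hc hc1 hc2
  have e1 := (tendsto_const_mul_exp_neg one_pos (‖Bs‖ ^ 2)).eventually
    (gt_mem_nhds (by positivity : 0 < m' / 4))
  have e2 := (tendsto_const_mul_exp_neg one_pos m').eventually (gt_mem_nhds one_pos)
  obtain ⟨T₀, h1, h2⟩ := (e1.and e2).exists
  rw [neg_one_mul] at h1 h2
  have ev (x y : ℝ) (hy : 0 < y) : ∀ᶠ θ in 𝓝[>] (0 : ℝ), θ * x < y := by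
    have h3 : Tendsto (fun θ : ℝ => θ * x) (𝓝 0) (𝓝 (0 * x)) := tendsto_id.mul_const x
    rw [zero_mul] at h3
    exact (h3.eventually (gt_mem_nhds hy)).filter_mono nhdsWithin_le_nhds
  -- The strip must be narrow compared with the ratio of the spectral gap to the norms of both
  -- blocks, as the Hermitian estimates require.
  filter_upwards [ev ‖Bs‖ (m' / 4) (by positivity), ev ‖Bc‖ (m' / 4) (by positivity),
    ev 1 (1 / 4) (by norm_num), self_mem_nhdsWithin] with θ k1 k2 k3 k4
  rw [mul_one] at k3
  have k4' : (0 : ℝ) < θ := k4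
  obtain ⟨T₂, κ, ρ, N, hT₂, hρ, hyp⟩ := hslow.exists_hyperbolicSystem (T₀ := T₀) (θ := θ)
    (μ := m' / 8) (Bs := Bs) (Bc := Bc) hη k4' k3 (by linarith) (by positivity)
    (by linarith [min_le_right m 1])
    (fun t ht w => norm_sub_exp_smul_le (by linarith) k1.le hBs1 hm'0 (by linarith) (by linarith)
      ht w)
    (fun t ht w => le_norm_sub_exp_smul (by linarith) k2.le hBc1 hm'0 (by linarith) ht w)
  obtain ⟨g, hg, hfix⟩ := hyp.exists_graph
  have hconj (P : ℂ × (Cn n × Cn n')) : slowStep B a b (chart β c J P) = chart β c J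
      (slowStep (Bs.prodMap Bc) (a ∘ chart β c J) (chartRemainder B a b β c J) P) := by
    rw [← hlin]; exact slowStep_chart B a b β c J P
  have hconj' (i : ℕ) (P : ℂ × (Cn n × Cn n')) : (slowStep B a b)^[i] (chart β c J P) = chart β c J
      ((slowStep (Bs.prodMap Bc) (a ∘ chart β c J) (chartRemainder B a b β c J))^[i] P) :=
    ((show Function.Semiconj (chart β c J) _ _ from fun P => (hconj P).symm).iterate_right i P).symm
  have hρ0 := hyp.ρ_pos
  refine ⟨T₂, ρ, g, hT₁.trans hT₂, fun p hp => hmaps ⟨strip_subset_strip hT₂ k3.le hp.1, hp.2⟩,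
    ⟨hρ0, hρ, hg, fun p hp => hyp.norm_le hg hp, fun T' hT' p hp => ?_, fun P hP => ?_⟩⟩
  · have hp' : p ∈ strip T₂ θ ×ˢ ball (0 : Cn n) ρ :=
      ⟨strip_subset_strip hT' le_rfl hp.1, ball_subset_ball (by linarith) hp.2⟩
    have hgp := hyp.graphPoint_mem hg hp'
    refine ⟨_, hyp.baseStep_mem hT' le_rfl hgp hp.1 hp.2, ?_, ?_⟩
    · rw [graphChart, hconj, hyp.slowStep_graphPoint hfix hp', graphChart]
    · exact re_step_ge hyp.θ_le hyp.κ_le_θ hp.1 (hyp.bound_a _ hgp)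
  · refine hyp.eq_graph_of_orbit hg hfix fun i => ?_
    obtain ⟨Q, hQ, h⟩ := hP i
    rw [hconj'] at h
    rwa [injective_chart β c J h]

/-- If the sequence were bounded by R, its increments would be at least e^{-R} / 4. -/
theorem tendsto_atTop_of_add_exp_le {r : ℕ → ℝ} (hr : ∀ i, r i + Real.exp (-r i) / 4 ≤ r (i + 1)) :
    Tendsto r atTop atTop := by
  have hmono : Monotone r := monotone_nat_of_le_succ fun i => by
    have := Real.exp_pos (-r i)
    linarith [hr i]
  refine tendsto_atTop_atTop_of_monotone hmono fun R => ?_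
  by_contra! h
  have h1 : ∀ i : ℕ, r 0 + i * (Real.exp (-R) / 4) ≤ r i := fun i => by
    induction i with
    | zero => simp
    | succ i ih =>
      have h2 : Real.exp (-R) ≤ Real.exp (-r i) := Real.exp_le_exp.2 (neg_le_neg (h i).le)
      push_cast
      linarith [hr i]
  obtain ⟨i, hi⟩ := exists_nat_gt ((R - r 0) / (Real.exp (-R) / 4))
  rw [div_lt_iff₀ (by positivity)] at hi
  linarith [h1 i, h i]

namespace InvariantGraph

variable {F : ℂ × E → ℂ × E} {T θ η β ρ : ℝ} {c : ℂ → E} {J : (Cn n × Cn n') ≃L[ℂ] E}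
  {g : ℂ × Cn n → Cn n'}

theorem exists_orbit (H : InvariantGraph F T θ η β ρ c J g) {T' : ℝ} (hT' : T ≤ T') {p : ℂ × Cn n}
    (hp : p ∈ strip T' θ ×ˢ ball 0 (ρ / 2)) :
    ∃ q : ℕ → ℂ × Cn n, (∀ i, q i ∈ strip T' θ ×ˢ ball 0 (ρ / 2)) ∧
      (∀ i, F^[i] (graphChart β c J g p) = graphChart β c J g (q i)) ∧
      Tendsto (fun i => (q i).1.re) atTop atTop := by
  choose! f hf hF hre using H.step T' hT'
  have hq (i : ℕ) : f^[i] p ∈ strip T' θ ×ˢ ball (0 : Cn n) (ρ / 2) := by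
    induction i with
    | zero => exact hp
    | succ i ih => rw [Function.iterate_succ_apply']; exact hf _ ih
  refine ⟨fun i => f^[i] p, hq, fun i => ?_, tendsto_atTop_of_add_exp_le fun i => ?_⟩
  · induction i with
    | zero => rfl
    | succ i ih =>
      beta_reduce at ih ⊢
      rw [Function.iterate_succ_apply', Function.iterate_succ_apply', ih, hF _ (hq i)]
  · beta_reduce
    rw [Function.iterate_succ_apply']
    exact hre _ (hq i)

theorem norm_prod_lt (H : InvariantGraph F T θ η β ρ c J g) {T' : ℝ} (hT' : T ≤ T') {p : ℂ × Cn n}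
    (hp : p ∈ strip T' θ ×ˢ ball 0 (ρ / 2)) : ‖(p.2, g p)‖ < 1 := by
  have h1 := H.norm_le p ⟨strip_subset_strip hT' le_rfl hp.1,
    ball_subset_ball (by linarith [H.ρ_pos]) hp.2⟩
  have h2 := mem_ball_zero_iff.1 hp.2
  have := H.ρ_le
  exact max_lt (by linarith) (by linarith)

/-- A graph with a larger exponent, seen in the chart of a smaller exponent, is small. -/
theorem exists_chart_eq {n₂ n₂' : ℕ} {β₂ ρ₂ : ℝ} {J₂ : (Cn n₂ × Cn n₂') ≃L[ℂ] E}
    (H : InvariantGraph F T θ η β ρ c J g) (hβ : β₂ < β) {T' : ℝ} (hT' : T ≤ T')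
    (hsmall : ‖(J₂.symm : E →L[ℂ] (Cn n₂ × Cn n₂'))‖ * ‖(J : (Cn n × Cn n') →L[ℂ] E)‖ *
      Real.exp (-(β - β₂) * T') < ρ₂) {p : ℂ × Cn n} (hp : p ∈ strip T' θ ×ˢ ball 0 (ρ / 2)) :
    ∃ Q ∈ strip T' θ ×ˢ ball (0 : Cn n₂ × Cn n₂') ρ₂, Q.1 = p.1 ∧
      graphChart β c J g p = chart β₂ c J₂ Q := by
  -- Equality of e^{-βt} J W and e^{-β₂t} J₂ W₂ determines W₂ = e^{-(β - β₂)t} J₂⁻¹ J W, which is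
  -- small far in the strip.
  refine ⟨(p.1, Complex.exp (-((β - β₂ : ℝ) * p.1)) • J₂.symm (J (p.2, g p))), ⟨hp.1, ?_⟩, rfl, ?_⟩
  · rw [mem_ball_zero_iff]
    refine lt_of_le_of_lt ?_ hsmall
    rw [norm_smul, norm_exp_neg_mul, mul_comm]
    have h1 := mul_exp_neg_le p.1.re (sub_pos.2 hβ) hp.1.1.le
    have h2 : ‖J₂.symm (J (p.2, g p))‖ ≤ ‖(J₂.symm : E →L[ℂ] (Cn n₂ × Cn n₂'))‖ *
        (‖(J : (Cn n × Cn n') →L[ℂ] E)‖ * 1) := by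
      refine ((J₂.symm : E →L[ℂ] (Cn n₂ × Cn n₂')).le_opNorm _).trans ?_
      gcongr
      refine ((J : (Cn n × Cn n') →L[ℂ] E).le_opNorm _).trans ?_
      gcongr
      exact (H.norm_prod_lt hT' hp).le
    rw [mul_one] at h2
    exact mul_le_mul h2 h1 (Real.exp_nonneg _) (by positivity)
  · refine Prod.ext rfl ?_
    simp only [graphChart, chart, graphPoint, map_smul, J₂.apply_symm_apply, smul_smul,
      ← Complex.exp_add]
    congr 3
    push_cast
    ring

/-- Uniqueness of invariant graphs: the graphs with larger exponents are contained in the graphs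
with smaller exponents. -/
theorem exists_graphChart_eq {n₂ n₂' : ℕ} {T₂ η₂ β₂ ρ₂ : ℝ} {J₂ : (Cn n₂ × Cn n₂') ≃L[ℂ] E}
    {g₂ : ℂ × Cn n₂ → Cn n₂'} (H : InvariantGraph F T θ η β ρ c J g)
    (H₂ : InvariantGraph F T₂ θ η₂ β₂ ρ₂ c J₂ g₂) (hβ : β₂ < β) {T' : ℝ} (hT' : T ≤ T')
    (hT₂ : T₂ ≤ T')
    (hsmall : ‖(J₂.symm : E →L[ℂ] (Cn n₂ × Cn n₂'))‖ * ‖(J : (Cn n × Cn n') →L[ℂ] E)‖ *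
      Real.exp (-(β - β₂) * T') < ρ₂ / 4) {p : ℂ × Cn n}
    (hp : p ∈ strip T' θ ×ˢ ball 0 (ρ / 2)) :
    ∃ q ∈ strip T' θ ×ˢ ball (0 : Cn n₂) (ρ₂ / 4),
      graphChart β c J g p = graphChart β₂ c J₂ g₂ q := by
  obtain ⟨P, hP, hP1, hPe⟩ := H.exists_chart_eq hβ hT' hsmall hp
  obtain ⟨q, hq, hqF, -⟩ := H.exists_orbit hT' hp
  have hρ₂ := H₂.ρ_pos
  -- Every iterate is again a point of the first graph, hence lies in the domain of the second
  -- chart, and uniqueness applies there.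
  have hu : P.2.2 = g₂ (P.1, P.2.1) := H₂.unique P fun i => by
    obtain ⟨Q, hQ, -, hQe⟩ := H.exists_chart_eq hβ hT' hsmall (hq i)
    refine ⟨Q, ⟨strip_subset_strip hT₂ le_rfl hQ.1, ball_subset_ball (by linarith) hQ.2⟩, ?_⟩
    rw [← hPe, hqF, hQe]
  refine ⟨(P.1, P.2.1), ⟨hP.1, ?_⟩, ?_⟩
  · have := mem_ball_zero_iff.1 hP.2
    rw [mem_ball_zero_iff]
    exact (norm_fst_le P.2).trans_lt this
  · rw [hPe, graphChart, graphPoint]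
    congr 1
    exact Prod.ext rfl (Prod.ext rfl hu)

theorem mapsTo_graphChart (H : InvariantGraph F T θ η β ρ c J g) {s : Set (ℂ × E)}
    (hs : MapsTo (chart β c J) (strip T θ ×ˢ ball 0 1) s) {T' : ℝ} (hT' : T ≤ T') :
    MapsTo (graphChart β c J g) (strip T' θ ×ˢ ball 0 (ρ / 2)) s := fun p hp =>
  hs ⟨strip_subset_strip hT' le_rfl hp.1, by
    rw [mem_ball_zero_iff]; exact H.norm_prod_lt hT' hp⟩

end InvariantGraph

end ParabolicManifolds
end
-- Sectors in logarithmic coordinates, and embeddings by left inverses.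
noncomputable section
namespace ParabolicManifolds
open Metric Set

section LeftInverse

variable {X Y : Type*} [TopologicalSpace X] [TopologicalSpace Y]

/-- The left inverse only has to be continuous at the points of the image, so logarithms and
quotients defined everywhere by convention are admissible. -/
theorem isEmbedding_domRestrict_of_leftInverse {f : X → Y} {g : Y → X} {s : Set X}
    (hf : ContinuousOn f s) (hg : ∀ x ∈ s, ContinuousAt g (f x)) (hgf : ∀ x ∈ s, g (f x) = x) :
    IsEmbedding (s.domRestrict f) := by
  refine ⟨isInducing_iff_nhds.2 fun x => le_antisymm ?_ ?_, fun x y hxy => ?_⟩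
  · exact (hf.domRestrict.tendsto x).le_comap
  · rw [nhds_subtype_eq_comap, ← tendsto_iff_comap]
    have h1 := (hg x x.2).tendsto.comp (tendsto_comap (f := s.domRestrict f) (x := 𝓝 (f x)))
    rw [hgf x x.2] at h1
    exact h1.congr fun y => hgf y y.2
  · have h1 : f x = f y := hxy
    exact Subtype.ext (by rw [← hgf x x.2, h1, hgf y y.2])

theorem injective_fderiv_of_leftInverse {X Y : Type*} [NormedAddCommGroup X] [NormedSpace ℂ X]
    [NormedAddCommGroup Y] [NormedSpace ℂ Y] {f : X → Y} {g : Y → X} {x : X}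
    (hf : DifferentiableAt ℂ f x) (hg : DifferentiableAt ℂ g (f x)) (hgf : ∀ᶠ y in 𝓝 x, g (f y) = y) :
    Function.Injective (fderiv ℂ f x) := by
  have h1 : HasFDerivAt (fun y => g (f y)) (fderiv ℂ g (f x) ∘L fderiv ℂ f x) x :=
    hg.hasFDerivAt.comp x hf.hasFDerivAt
  have h2 : HasFDerivAt (fun y => g (f y)) (ContinuousLinearMap.id ℂ X) x :=
    (hasFDerivAt_id x).congr_of_eventuallyEq hgf
  have h3 := h1.unique h2
  refine Function.LeftInverse.injective (g := fderiv ℂ g (f x)) fun v => ?_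
  exact congrArg (fun L : X →L[ℂ] X => L v) h3

end LeftInverse

section Sector

variable {n k : ℕ}

/-- The time and the parameter of a point of a sector. -/
def sectorTime (k : ℕ) (z : Cn (n + 1)) : ℂ × Cn n := (-(k * Complex.log (z 0)), tail n z)

/-- The inverse of `sectorTime`. -/
def ofTime (k : ℕ) (p : ℂ × Cn n) : Cn (n + 1) :=
  WithLp.toLp 2 (Fin.cons (Complex.exp (-(p.1 / k))) fun i => p.2 i)

@[simp] theorem ofTime_zero (p : ℂ × Cn n) : ofTime k p 0 = Complex.exp (-(p.1 / k)) := rfl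

@[simp] theorem tail_ofTime (p : ℂ × Cn n) : tail n (ofTime k p) = p.2 := rfl

theorem ofTime_sectorTime (hk : k ≠ 0) {z : Cn (n + 1)} (hz : z 0 ≠ 0) :
    ofTime k (sectorTime k z) = z := by
  have : (k : ℂ) ≠ 0 := by exact_mod_cast hk
  refine tail_injective ?_ rfl
  rw [ofTime_zero, sectorTime]
  rw [show -(-(k * Complex.log (z 0)) / k) = Complex.log (z 0) by field_simp, Complex.exp_log hz]

/-- Keeps t / k within the range where the principal logarithm inverts the exponential. -/
theorem abs_im_div_lt_pi (hk : k ≠ 0) {θ : ℝ} (hθ : θ ≤ 1) {t : ℂ} (ht : |t.im| < θ) :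
    |(-(t / k)).im| < Real.pi := by
  have hk1 : (1 : ℝ) ≤ k := by exact_mod_cast Nat.one_le_iff_ne_zero.2 hk
  rw [Complex.neg_im, abs_neg, Complex.div_natCast_im, abs_div, abs_of_nonneg (by linarith : (0 : ℝ) ≤ k)]
  refine (div_le_self (abs_nonneg _) hk1).trans_lt ?_
  linarith [Real.pi_gt_three]

theorem log_exp_neg_div (hk : k ≠ 0) {θ : ℝ} (hθ : θ ≤ 1) {t : ℂ} (ht : |t.im| < θ) :
    -(k * Complex.log (Complex.exp (-(t / k)))) = t := by
  have : (k : ℂ) ≠ 0 := by exact_mod_cast hk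
  have h1 := abs_lt.1 (abs_im_div_lt_pi hk hθ ht)
  rw [Complex.log_exp h1.1 h1.2.le]
  field_simp

theorem sectorTime_ofTime (hk : k ≠ 0) {θ : ℝ} (hθ : θ ≤ 1) {p : ℂ × Cn n} (hp : |p.1.im| < θ) :
    sectorTime k (ofTime k p) = p :=
  Prod.ext (log_exp_neg_div hk hθ hp) rfl

theorem differentiable_ofTime : Differentiable ℂ (ofTime k : ℂ × Cn n → Cn (n + 1)) := by
  refine differentiable_euclidean.2 fun i => ?_
  refine Fin.cases ?_ (fun i => ?_) i
  · simp only [ofTime_zero]; fun_prop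
  · exact (EuclideanSpace.proj (𝕜 := ℂ) i).differentiable.comp differentiable_snd

theorem differentiableAt_sectorTime {z : Cn (n + 1)} (hz : z 0 ∈ Complex.slitPlane) :
    DifferentiableAt ℂ (sectorTime k) z := by
  have h0 : DifferentiableAt ℂ (fun z : Cn (n + 1) => z 0) z :=
    (EuclideanSpace.proj (𝕜 := ℂ) (0 : Fin (n + 1))).differentiableAt
  exact ((h0.clog hz).const_mul (k : ℂ)).neg.prodMk (tail n).differentiableAt

theorem sectorTime_re (z : Cn (n + 1)) : (sectorTime k z).1.re = -(k * Real.log ‖z 0‖) := by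
  simp [sectorTime, Complex.log_re]

theorem sectorTime_im (z : Cn (n + 1)) : (sectorTime k z).1.im = -(k * (z 0).arg) := by
  simp [sectorTime, Complex.log_im]

theorem mem_coordSector_iff (hk : k ≠ 0) {T θ ρ : ℝ} {z : Cn (n + 1)} (hz : z 0 ≠ 0) :
    z ∈ coordSector n (θ / k) (Real.exp (-(T / k))) ρ ↔
      sectorTime k z ∈ strip T θ ×ˢ ball (0 : Cn n) ρ := by
  have hk0 : (0 : ℝ) < k := by exact_mod_cast Nat.pos_of_ne_zero hk
  have h1 : |(z 0).arg| < θ / k ↔ |(sectorTime k z).1.im| < θ := by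
    rw [sectorTime_im, abs_neg, abs_mul, abs_of_pos hk0, lt_div_iff₀' hk0]
  have h2 : ‖z 0‖ < Real.exp (-(T / k)) ↔ T < (sectorTime k z).1.re := by
    rw [sectorTime_re, ← Real.log_lt_iff_lt_exp (norm_pos_iff.2 hz), lt_neg, div_lt_iff₀' hk0,
      mul_neg]
  have h3 : ‖(WithLp.toLp 2 (fun i : Fin n => z i.succ) : Cn n)‖ < ρ ↔
      (sectorTime k z).2 ∈ ball (0 : Cn n) ρ := by
    rw [mem_ball_zero_iff]; rfl
  simp only [coordSector, mem_ofPred_eq, mem_prod, strip, h1, h2, h3]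
  tauto

theorem mem_slitPlane_of_mem_coordSector {θ s ρ : ℝ} (hθ : θ ≤ 1) {z : Cn (n + 1)}
    (hz : z ∈ coordSector n θ s ρ) : z 0 ∈ Complex.slitPlane := by
  rw [Complex.mem_slitPlane_iff_arg]
  refine ⟨fun h => ?_, hz.1⟩
  have := hz.2.1
  rw [h, abs_of_pos Real.pi_pos] at this
  linarith [Real.pi_gt_three]

variable {T θ ρ : ℝ}

theorem div_natCast_le_one (hk : k ≠ 0) (hθ0 : 0 ≤ θ) (hθ : θ ≤ 1) : θ / k ≤ 1 := by
  have hk1 : (1 : ℝ) ≤ k := by exact_mod_cast Nat.one_le_iff_ne_zero.2 hk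
  exact (div_le_self hθ0 hk1).trans hθ

theorem ofTime_mem_coordSector (hk : k ≠ 0) (hθ : θ ≤ 1) {p : ℂ × Cn n}
    (hp : p ∈ strip T θ ×ˢ ball (0 : Cn n) ρ) :
    ofTime k p ∈ coordSector n (θ / k) (Real.exp (-(T / k))) ρ := by
  rw [mem_coordSector_iff hk (Complex.exp_ne_zero _), sectorTime_ofTime hk hθ hp.1.2]
  exact hp

theorem mapsTo_sectorTime (hk : k ≠ 0) :
    MapsTo (sectorTime k) (coordSector n (θ / k) (Real.exp (-(T / k))) ρ)
      (strip T θ ×ˢ ball (0 : Cn n) ρ) := fun _ hz => (mem_coordSector_iff hk hz.1).1 hz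

theorem ofTime_image (hk : k ≠ 0) (hθ : θ ≤ 1) :
    ofTime k '' (strip T θ ×ˢ ball (0 : Cn n) ρ) =
      coordSector n (θ / k) (Real.exp (-(T / k))) ρ := by
  refine Subset.antisymm (image_subset_iff.2 fun p hp => ofTime_mem_coordSector hk hθ hp)
    fun z hz => ⟨_, mapsTo_sectorTime hk hz, ofTime_sectorTime hk hz.1⟩

theorem sectorTime_image (hk : k ≠ 0) (hθ : θ ≤ 1) :
    sectorTime k '' (coordSector n (θ / k) (Real.exp (-(T / k))) ρ) =
      strip T θ ×ˢ ball (0 : Cn n) ρ := by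
  rw [← ofTime_image hk hθ, image_image]
  refine (image_congr fun p hp => sectorTime_ofTime hk hθ hp.1.2).trans (image_id _)

theorem isOpen_coordSector (hk : k ≠ 0) (hθ0 : 0 ≤ θ) (hθ : θ ≤ 1) :
    IsOpen (coordSector n (θ / k) (Real.exp (-(T / k))) ρ) := by
  have h1 : coordSector n (θ / k) (Real.exp (-(T / k))) ρ =
      {z : Cn (n + 1) | z 0 ∈ Complex.slitPlane} ∩
        sectorTime k ⁻¹' (strip T θ ×ˢ ball (0 : Cn n) ρ) := by
    ext z
    refine ⟨fun hz => ⟨mem_slitPlane_of_mem_coordSector (div_natCast_le_one hk hθ0 hθ) hz,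
      mapsTo_sectorTime hk hz⟩, fun hz =>
      (mem_coordSector_iff hk (Complex.slitPlane_ne_zero hz.1)).2 hz.2⟩
  have h2 : IsOpen {z : Cn (n + 1) | z 0 ∈ Complex.slitPlane} :=
    Complex.isOpen_slitPlane.preimage (EuclideanSpace.proj (𝕜 := ℂ) (0 : Fin (n + 1))).continuous
  rw [h1]
  exact ContinuousOn.isOpen_inter_preimage
    (fun z hz => (differentiableAt_sectorTime hz).continuousAt.continuousWithinAt) h2
    ((isOpen_strip T θ).prod isOpen_ball)

theorem ofReal_mem_strip {r : ℝ} (hr : T < r) (hθ : 0 < θ) : (r : ℂ) ∈ strip T θ :=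
  ⟨by simpa using hr, by simpa using hθ⟩

theorem isConnected_coordSector (hk : k ≠ 0) (hθ0 : 0 < θ) (hθ : θ ≤ 1) (hρ : 0 < ρ) :
    IsConnected (coordSector n (θ / k) (Real.exp (-(T / k))) ρ) := by
  rw [← ofTime_image hk hθ]
  have h1 : (strip T θ ×ˢ ball (0 : Cn n) ρ).Nonempty :=
    ⟨(((T + 1 : ℝ) : ℂ), 0), ofReal_mem_strip (by linarith) hθ0, by simpa using hρ⟩
  exact ⟨h1.image _, (((convex_strip T θ).prod (convex_ball _ _)).isPreconnected).image _
    differentiable_ofTime.continuous.continuousOn⟩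

theorem zero_mem_frontier_coordSector (hk : k ≠ 0) (hθ0 : 0 < θ) (hθ : θ ≤ 1) (hρ : 0 < ρ) :
    (0 : Cn (n + 1)) ∈ frontier (coordSector n (θ / k) (Real.exp (-(T / k))) ρ) := by
  rw [(isOpen_coordSector hk hθ0.le hθ).frontier_eq]
  refine ⟨?_, fun h => h.1 rfl⟩
  have hk0 : (0 : ℝ) < k := by exact_mod_cast Nat.pos_of_ne_zero hk
  have h1 : Tendsto (fun r : ℝ => ofTime k (((r : ℝ) : ℂ), (0 : Cn n))) atTop (𝓝 0) := by
    rw [tendsto_zero_iff_norm_tendsto_zero]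
    have h2 := tendsto_const_mul_exp_neg (by positivity : (0 : ℝ) < 1 / k) 1
    refine h2.congr fun r => ?_
    have h3 := norm_sq_eq_add_norm_sq_tail (ofTime k (((r : ℝ) : ℂ), (0 : Cn n)))
    rw [ofTime_zero, tail_ofTime] at h3
    have h4 : ‖ofTime k (((r : ℝ) : ℂ), (0 : Cn n))‖ = ‖Complex.exp (-((r : ℂ) / k))‖ := by
      refine (sq_eq_sq₀ (norm_nonneg _) (norm_nonneg _)).1 ?_
      simpa using h3
    rw [h4, Complex.norm_exp, one_mul, Complex.neg_re, Complex.div_natCast_re, Complex.ofReal_re]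
    ring_nf
  refine mem_closure_of_tendsto h1 ?_
  filter_upwards [eventually_gt_atTop T] with r hr
  exact ofTime_mem_coordSector hk hθ ⟨ofReal_mem_strip hr hθ0, by simpa using hρ⟩

theorem tendsto_sectorTime_re (hk : k ≠ 0) (S : Set (Cn (n + 1))) (hS : ∀ z ∈ S, z 0 ≠ 0) :
    Tendsto (fun z => (sectorTime k z).1.re) (𝓝[S] 0) atTop := by
  have hk0 : (0 : ℝ) < k := by exact_mod_cast Nat.pos_of_ne_zero hk
  have h1 : Tendsto (fun z : Cn (n + 1) => ‖z 0‖) (𝓝[S] 0) (𝓝[≠] 0) := by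
    refine tendsto_nhdsWithin_iff.2 ⟨?_, eventually_nhdsWithin_of_forall fun z hz => ?_⟩
    · have h2 : Continuous fun z : Cn (n + 1) => ‖z 0‖ :=
        (EuclideanSpace.proj (𝕜 := ℂ) (0 : Fin (n + 1))).continuous.norm
      have h3 := (h2.tendsto 0).mono_left (nhdsWithin_le_nhds (s := S))
      simpa using h3
    · simpa using hS z hz
  have h2 := (Real.tendsto_log_nhdsNE_zero.comp h1).const_mul_atBot hk0
  refine (tendsto_neg_atBot_atTop.comp h2).congr fun z => ?_
  rw [sectorTime_re]
  rfl

end Sector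

end ParabolicManifolds
end
-- From invariant graphs to parabolic manifolds.
noncomputable section
namespace ParabolicManifolds
open Metric Set

section SectorChart

variable {m k : ℕ} {κ : ℂ} {η : ℝ} {j : Fin (m + 1)} {u₀ : Fin m → ℂ}

theorem sectorChart_apply_self (p : ℂ × (Fin m → ℂ)) :
    sectorChart κ k η j u₀ p j = xCoord κ k p.1 := by simp [sectorChart]

theorem affineCoord_sectorChart (hκ : κ ≠ 0) (p : ℂ × (Fin m → ℂ)) :
    affineCoord j (sectorChart κ k η j u₀ p) = u₀ + Complex.exp (-(η * p.1)) • p.2 :=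
  affineCoord_smul_point j (xCoord_ne_zero hκ k _) _

/-- The inverse of `sectorChart`. -/
def sectorChartInv (κ : ℂ) (k : ℕ) (η : ℝ) (j : Fin (m + 1)) (u₀ : Fin m → ℂ) (z : Cn (m + 1)) :
    ℂ × (Fin m → ℂ) :=
  (-(k * Complex.log (z j / κ)),
    Complex.exp (η * (-(k * Complex.log (z j / κ)))) • (affineCoord j z - u₀))

theorem sectorChart_div (hκ : κ ≠ 0) (p : ℂ × (Fin m → ℂ)) :
    sectorChart κ k η j u₀ p j / κ = Complex.exp (-(p.1 / k)) := by
  rw [sectorChart_apply_self, xCoord, mul_div_cancel_left₀ _ hκ]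

theorem sectorChartInv_sectorChart (hκ : κ ≠ 0) (hk : k ≠ 0) {θ : ℝ} (hθ : θ ≤ 1)
    {p : ℂ × (Fin m → ℂ)} (hp : |p.1.im| < θ) :
    sectorChartInv κ k η j u₀ (sectorChart κ k η j u₀ p) = p := by
  rw [sectorChartInv, sectorChart_div hκ, log_exp_neg_div hk hθ hp, affineCoord_sectorChart hκ,
    add_sub_cancel_left, smul_smul, ← Complex.exp_add, add_neg_cancel, Complex.exp_zero, one_smul]

theorem differentiableAt_sectorChartInv (hκ : κ ≠ 0) (hk : k ≠ 0) {θ : ℝ} (hθ : θ ≤ 1)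
    {p : ℂ × (Fin m → ℂ)} (hp : |p.1.im| < θ) :
    DifferentiableAt ℂ (sectorChartInv κ k η j u₀) (sectorChart κ k η j u₀ p) := by
  have hx : sectorChart κ k η j u₀ p j ≠ 0 := by
    rw [sectorChart_apply_self]; exact xCoord_ne_zero hκ k _
  set z := sectorChart κ k η j u₀ p with hz
  have hd (i : Fin (m + 1)) : DifferentiableAt ℂ (fun z : Cn (m + 1) => z i) z :=
    (EuclideanSpace.proj (𝕜 := ℂ) i).differentiableAt
  have hs : z j / κ ∈ Complex.slitPlane := by
    rw [hz, sectorChart_div hκ, Complex.mem_slitPlane_iff_arg]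
    have h1 := abs_lt.1 (abs_im_div_lt_pi hk hθ hp)
    refine ⟨?_, Complex.exp_ne_zero _⟩
    rw [← Complex.log_im, Complex.log_exp h1.1 h1.2.le]
    exact h1.2.ne
  have ht : DifferentiableAt ℂ (fun z : Cn (m + 1) => -((k : ℂ) * Complex.log (z j / κ))) z := by
    have h1 : DifferentiableAt ℂ (fun z : Cn (m + 1) => z j / κ) z := by
      simp only [div_eq_mul_inv]; exact (hd j).mul_const _
    have h2 : DifferentiableAt ℂ (fun z : Cn (m + 1) => (k : ℂ) * Complex.log (z j / κ)) z :=
      (h1.clog hs).const_mul _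
    exact h2.fun_neg
  have hu : DifferentiableAt ℂ (affineCoord j) z :=
    differentiableAt_pi.2 fun i => by
      simp only [affineCoord, div_eq_mul_inv]
      exact (hd _).fun_mul ((hd j).fun_inv hx)
  exact ht.prodMk ((ht.const_mul _).cexp.smul (hu.sub_const u₀))

/-- The quantity -k p₀ x^k that defines the sector is exactly e^{-t}. For |Im t| < 1/2 one has
|sin(Im t)| < 1/2 ≤ cos(Im t), which gives γ = 1; the norm in the radius compares the Euclidean norm
with the supremum norm. -/
theorem sectorChart_mem_sector {Φ : Cn (m + 1) → Cn (m + 1)} {V : Cn (m + 1)} (hk : k ≠ 0)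
    (hκ : -(k : ℂ) * pPart Φ k j (affineCoord j V) * κ ^ k = 1) (hκ0 : κ ≠ 0) (hη : 0 ≤ η)
    {θ T : ℝ} (hθ : θ ≤ 1 / 2) (hT : 0 ≤ T) {p : ℂ × (Fin m → ℂ)}
    (hp : p ∈ strip T θ ×ˢ ball 0 1) :
    sectorChart κ k η j (affineCoord j V) p ∈ sector Φ k j V 1 1
      (‖((PiLp.continuousLinearEquiv 2 ℂ fun _ : Fin m => ℂ).symm :
        (Fin m → ℂ) →L[ℂ] Cn m)‖ + 1) := by
  have h1 : -(k : ℂ) * pPart Φ k j (affineCoord j V) *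
      sectorChart κ k η j (affineCoord j V) p j ^ k = Complex.exp (-p.1) := by
    rw [sectorChart_apply_self, xCoord_pow hk, ← mul_assoc, hκ, one_mul]
  have h2 := Real.exp_pos (-p.1.re)
  refine ⟨?_, ?_, ?_⟩
  · rw [h1, re_exp_neg, im_exp_neg, abs_neg, abs_mul, abs_of_pos h2, one_mul]
    have h3 := half_le_cos (hp.1.2.le.trans (by linarith))
    have h4 : |Real.sin p.1.im| < 1 / 2 :=
      Real.abs_sin_le_abs.trans_lt (hp.1.2.trans_le hθ)
    exact mul_lt_mul_of_pos_left (by linarith) h2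
  · rw [h1, norm_exp_neg, Real.exp_lt_one_iff]
    linarith [hp.1.1]
  · rw [affineCoord_sectorChart hκ0, add_sub_cancel_left]
    set L := ((PiLp.continuousLinearEquiv 2 ℂ fun _ : Fin m => ℂ).symm :
        (Fin m → ℂ) →L[ℂ] Cn m)
    have h3 : ‖Complex.exp (-(η * p.1)) • p.2‖ ≤ 1 := by
      rw [norm_smul, norm_exp_neg_mul]
      have h4 := mem_ball_zero_iff.1 hp.2
      have h5 : Real.exp (-η * p.1.re) ≤ 1 := by
        rw [Real.exp_le_one_iff]; nlinarith [hp.1.1]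
      exact mul_le_one₀ h5 (norm_nonneg _) h4.le
    refine lt_of_le_of_lt (L.le_opNorm (Complex.exp (-(η * p.1)) • p.2)) ?_
    nlinarith [norm_nonneg L]

theorem norm_le_norm_sectorChart (p : ℂ × (Fin m → ℂ)) :
    ‖xCoord κ k p.1‖ ≤ ‖sectorChart κ k η j u₀ p‖ := by
  rw [← sectorChart_apply_self (j := j) (η := η) (u₀ := u₀) p]
  exact PiLp.norm_apply_le _ _

theorem tendsto_sectorChart {α : Type*} {l : Filter α} {p : α → ℂ × (Fin m → ℂ)} (hk : k ≠ 0)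
    (hκ : κ ≠ 0) (hη : 0 < η) (hp : ∀ᶠ i in l, ‖(p i).2‖ ≤ 1)
    (hre : Tendsto (fun i => (p i).1.re) l atTop) {V : Cn (m + 1)} (hj : V j ≠ 0)
    (hu₀ : u₀ = affineCoord j V) :
    Tendsto (fun i => sectorChart κ k η j u₀ (p i)) l (𝓝 0) ∧
      TendstoDirection (fun i => sectorChart κ k η j u₀ (p i)) l V := by
  have hk0 : (0 : ℝ) < k := by exact_mod_cast Nat.pos_of_ne_zero hk
  have h1 : Tendsto (fun i => Complex.exp (-(η * (p i).1)) • (p i).2) l (𝓝 0) := by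
    have h2 := (tendsto_const_mul_exp_neg hη 1).comp hre
    simp only [one_mul] at h2
    refine squeeze_zero_norm' (hp.mono fun i hi => ?_) h2
    rw [norm_smul, norm_exp_neg_mul]
    exact mul_le_of_le_one_right (Real.exp_nonneg _) hi
  have h3 : Tendsto (fun i => point j 1 (u₀ + Complex.exp (-(η * (p i).1)) • (p i).2)) l
      (𝓝 (point j 1 u₀)) := by
    have h4 := h1.const_add u₀
    rw [add_zero] at h4
    exact ((differentiable_point j 1).continuous.tendsto u₀).comp h4
  have h5 : Tendsto (fun i => xCoord κ k (p i).1) l (𝓝 0) := by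
    rw [tendsto_zero_iff_norm_tendsto_zero]
    exact ((tendsto_const_mul_exp_neg (by positivity : (0 : ℝ) < 1 / k) ‖κ‖).comp hre).congr
      fun i => (norm_xCoord κ k _).symm
  have h7 := h5.smul h3
  rw [zero_smul] at h7
  refine ⟨h7, fun i => V j * (xCoord κ k (p i).1)⁻¹, ?_⟩
  have h6 := h3.const_smul (V j)
  rw [hu₀, ← eq_smul_point j hj, ← hu₀] at h6
  refine h6.congr fun i => ?_
  change _ = _ • (xCoord κ k (p i).1 • _)
  rw [smul_smul, mul_assoc, inv_mul_cancel₀ (xCoord_ne_zero hκ k _), mul_one]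

end SectorChart

section Parametrization

variable {m k n n' : ℕ} {κ : ℂ} {η β : ℝ} {j : Fin (m + 1)} {u₀ : Fin m → ℂ}
  {c : ℂ → Fin m → ℂ} {J : (Cn n × Cn n') ≃L[ℂ] (Fin m → ℂ)} {g : ℂ × Cn n → Cn n'}

/-- The parametrization of the parabolic manifold of an invariant graph. -/
def parametrization (κ : ℂ) (k : ℕ) (η : ℝ) (j : Fin (m + 1)) (u₀ : Fin m → ℂ) (β : ℝ)
    (c : ℂ → Fin m → ℂ) (J : (Cn n × Cn n') ≃L[ℂ] (Fin m → ℂ)) (g : ℂ × Cn n → Cn n')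
    (z : Cn (n + 1)) : Cn (m + 1) :=
  sectorChart κ k η j u₀ (graphChart β c J g (sectorTime k z))

/-- The inverse of `graphChart`. -/
def graphChartInv (β : ℝ) (c : ℂ → Fin m → ℂ) (J : (Cn n × Cn n') ≃L[ℂ] (Fin m → ℂ))
    (p : ℂ × (Fin m → ℂ)) : ℂ × Cn n :=
  (p.1, (Complex.exp (β * p.1) • J.symm (p.2 - c p.1)).1)

theorem graphChartInv_graphChart (p : ℂ × Cn n) :
    graphChartInv β c J (graphChart β c J g p) = p := by
  refine Prod.ext rfl ?_
  simp only [graphChartInv, graphChart, chart, graphPoint, add_sub_cancel_left, map_smul,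
    J.symm_apply_apply, smul_smul, ← Complex.exp_add, add_neg_cancel, Complex.exp_zero, one_smul]

theorem differentiableAt_graphChartInv {p : ℂ × (Fin m → ℂ)} (hc : DifferentiableAt ℂ c p.1) :
    DifferentiableAt ℂ (graphChartInv (n := n) (n' := n') β c J) p := by
  have h1 : DifferentiableAt ℂ (fun p : ℂ × (Fin m → ℂ) => c p.1) p :=
    DifferentiableAt.comp p hc differentiableAt_fst
  have h2 : DifferentiableAt ℂ (fun p : ℂ × (Fin m → ℂ) => Complex.exp (β * p.1)) p := by fun_prop
  exact differentiableAt_fst.prodMk (DifferentiableAt.fst (h2.smul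
    (J.symm.differentiableAt.comp p (differentiableAt_snd.sub h1))))

theorem differentiableAt_graphChart {p : ℂ × Cn n} (hc : DifferentiableAt ℂ c p.1)
    (hg : DifferentiableAt ℂ g p) : DifferentiableAt ℂ (graphChart β c J g) p := by
  have h1 : DifferentiableAt ℂ (fun p : ℂ × Cn n => c p.1) p :=
    DifferentiableAt.comp p hc differentiableAt_fst
  have h2 : DifferentiableAt ℂ (fun p : ℂ × Cn n => Complex.exp (-(β * p.1))) p := by fun_prop
  exact differentiableAt_fst.prodMk (h1.add (h2.smul
    (J.differentiableAt.comp p (differentiableAt_snd.prodMk hg))))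

/-- The invariance and the convergence of orbits are transported from the graph by the conjugacy on
D. Convergence to [V] needs only Re t → ∞ with w bounded, because y/x - u₀ = e^{-ηt} w. -/
theorem InvariantGraph.isParabolicManifold {Φ : Cn (m + 1) → Cn (m + 1)} {U : Set (Cn (m + 1))}
    {V : Cn (m + 1)} {F : ℂ × (Fin m → ℂ) → ℂ × (Fin m → ℂ)} {T T' θ η' ρ : ℝ}
    (H : InvariantGraph F T θ η' β ρ c J g) (hk : k ≠ 0) (hκ : κ ≠ 0) (hη : 0 < η)
    (hθ0 : 0 < θ) (hθ : θ ≤ 1) (hT : T ≤ T') (hj : V j ≠ 0) (hu₀ : u₀ = affineCoord j V)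
    (hc : DifferentiableOn ℂ c (strip T θ)) {D : Set (ℂ × (Fin m → ℂ))}
    (hD : ∀ p ∈ D, ‖p.2‖ ≤ 1 ∧ sectorChart κ k η j u₀ p ∈ U ∧
      Φ (sectorChart κ k η j u₀ p) = sectorChart κ k η j u₀ (F p))
    (hmaps : MapsTo (graphChart β c J g) (strip T' θ ×ˢ ball 0 (ρ / 2)) D)
    {M : Set (Cn (m + 1))}
    (hM : M = (fun p => sectorChart κ k η j u₀ (graphChart β c J g p)) ''
      (strip T' θ ×ˢ ball 0 (ρ / 2))) :
    AttractedAlong Φ V M ∧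
    IsParabolicManifold Φ V (n + 1) (coordSector n (θ / k) (Real.exp (-(T' / k))) (ρ / 2))
      (parametrization κ k η j u₀ β c J g) M := by
  have hρ := H.ρ_pos
  set S : Set (Cn (n + 1)) := coordSector n (θ / k) (Real.exp (-(T' / k))) (ρ / 2) with hS
  have hmS : MapsTo (sectorTime k) S (strip T' θ ×ˢ ball (0 : Cn n) (ρ / 2)) := mapsTo_sectorTime hk
  have hSo : IsOpen S := isOpen_coordSector hk hθ0.le hθ
  have hsub : strip T' θ ×ˢ ball (0 : Cn n) (ρ / 2) ⊆ strip T θ ×ˢ ball 0 ρ :=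
    prod_mono (strip_subset_strip hT le_rfl) (ball_subset_ball (by linarith))
  have hgd (p) (hp : p ∈ strip T' θ ×ˢ ball (0 : Cn n) (ρ / 2)) : DifferentiableAt ℂ g p :=
    H.admissible.diff.differentiableAt
      (((isOpen_strip T θ).prod isOpen_ball).mem_nhds (hsub hp))
  have hcd (t) (ht : t ∈ strip T' θ) : DifferentiableAt ℂ c t :=
    hc.differentiableAt ((isOpen_strip T θ).mem_nhds (strip_subset_strip hT le_rfl ht))
  have hslit (z) (hz : z ∈ S) : z 0 ∈ Complex.slitPlane :=
    mem_slitPlane_of_mem_coordSector (div_natCast_le_one hk hθ0.le hθ) hz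
  have hψd (z) (hz : z ∈ S) : DifferentiableAt ℂ (parametrization κ k η j u₀ β c J g) z := by
    refine DifferentiableAt.comp z (g := sectorChart κ k η j u₀)
      (differentiable_sectorChart κ k η j u₀ _) ?_
    exact DifferentiableAt.comp z (g := graphChart β c J g) (differentiableAt_graphChart (hcd _ (hmS hz).1) (hgd _ (hmS hz)))
      (differentiableAt_sectorTime (hslit z hz))
  -- A left inverse that is holomorphic near the image yields both the immersion and the embedding
  -- property.
  let G : Cn (m + 1) → Cn (n + 1) := fun z =>
    ofTime k (graphChartInv (n := n) (n' := n') β c J (sectorChartInv κ k η j u₀ z))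
  have hGψ (z) (hz : z ∈ S) : G (parametrization κ k η j u₀ β c J g z) = z := by
    simp only [G, parametrization]
    rw [sectorChartInv_sectorChart hκ hk hθ (p := graphChart β c J g (sectorTime k z)) (hmS hz).1.2,
      graphChartInv_graphChart, ofTime_sectorTime hk hz.1]
  have hGd (z) (hz : z ∈ S) : DifferentiableAt ℂ G (parametrization κ k η j u₀ β c J g z) := by
    refine DifferentiableAt.comp _ (g := ofTime k) (differentiable_ofTime _) (DifferentiableAt.comp _
      (g := graphChartInv (n := n) (n' := n') β c J) ?_ ?_)
    · rw [parametrization, sectorChartInv_sectorChart hκ hk hθ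
        (p := graphChart β c J g (sectorTime k z)) (hmS hz).1.2]
      exact differentiableAt_graphChartInv (hcd _ (hmS hz).1)
    · exact differentiableAt_sectorChartInv hκ hk hθ
        (p := graphChart β c J g (sectorTime k z)) (hmS hz).1.2
  have hattr : AttractedAlong Φ V M := by
    intro X hX
    rw [hM] at hX
    obtain ⟨p, hp, rfl⟩ := hX
    obtain ⟨q, hq, hqF, hqre⟩ := H.exists_orbit hT hp
    have horb (i : ℕ) : Φ^[i] (sectorChart κ k η j u₀ (graphChart β c J g p)) =
        sectorChart κ k η j u₀ (graphChart β c J g (q i)) := by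
      induction i with
      | zero => have := hqF 0; simp only [Function.iterate_zero, id] at this ⊢; rw [this]
      | succ i ih =>
        rw [Function.iterate_succ_apply', ih, (hD _ (hmaps (hq i))).2.2, ← hqF (i + 1),
          Function.iterate_succ_apply', hqF i]
    simp only [horb]
    exact tendsto_sectorChart hk hκ hη (Eventually.of_forall fun i => (hD _ (hmaps (hq i))).1) hqre
      hj hu₀
  have hlim := tendsto_sectorChart (k := k) (κ := κ) (η := η) (u₀ := u₀) (l := 𝓝[S] 0)
    (p := fun z => graphChart β c J g (sectorTime k z)) hk hκ hη
    (eventually_nhdsWithin_of_forall fun z hz => (hD _ (hmaps (hmS hz))).1)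
    (tendsto_sectorTime_re hk S fun z hz => hz.1) hj hu₀
  refine ⟨hattr, hSo, isConnected_coordSector hk hθ0 hθ (by linarith),
    zero_mem_frontier_coordSector hk hθ0 hθ (by linarith),
    fun z hz => (hψd z hz).differentiableWithinAt, fun z hz => ?_, ?_, ?_, hlim.1, hlim.2, ?_,
    fun X hX => (hattr X hX).1⟩
  · refine injective_fderiv_of_leftInverse (hψd z hz) (hGd z hz) ?_
    filter_upwards [hSo.mem_nhds hz] with y hy using hGψ y hy
  · exact isEmbedding_domRestrict_of_leftInverse
      (fun z hz => (hψd z hz).continuousAt.continuousWithinAt)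
      (fun z hz => (hGd z hz).continuousAt) hGψ
  · rw [hM, ← sectorTime_image hk hθ, image_image]
    rfl
  · intro X hX
    rw [hM] at hX ⊢
    obtain ⟨p, hp, rfl⟩ := hX
    obtain ⟨p', hp', hF, -⟩ := H.step T' hT p hp
    refine ⟨p', hp', ?_⟩
    beta_reduce
    rw [(hD _ (hmaps hp)).2.2, hF]

end Parametrization

end ParabolicManifolds
end
-- Tangency at the origin.
noncomputable section
namespace ParabolicManifolds
open Metric Set

variable {m k n n' : ℕ} {κ : ℂ} {η β : ℝ} {j : Fin (m + 1)} {u₀ : Fin m → ℂ}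
  {c : ℂ → Fin m → ℂ} {J : (Cn n × Cn n') ≃L[ℂ] (Fin m → ℂ)} {g : ℂ × Cn n → Cn n'}

/-- In the fibre direction Cauchy's estimate turns the decay of g into decay of its derivative. In
the time direction the Lipschitz constant 1 is enough, since that contribution to the differential
is damped by an additional factor e^{-ηt}. -/
theorem IsAdmissible.norm_fderiv_apply_le {T θ η ρ : ℝ} (hg : IsAdmissible T θ η ρ g) (hρ : 0 < ρ)
    {p : ℂ × Cn n} (hp : p ∈ strip T θ ×ˢ ball 0 (ρ / 2)) (q : ℂ × Cn n) :
    ‖fderiv ℂ g p q‖ ≤ ‖q.1‖ + 2 * Real.exp (-η * (p.1.re - T)) * ‖q.2‖ := by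
  have hopen : IsOpen (strip T θ ×ˢ ball (0 : Cn n) ρ) := (isOpen_strip T θ).prod isOpen_ball
  have hp' : p ∈ strip T θ ×ˢ ball (0 : Cn n) ρ := ⟨hp.1, ball_subset_ball (by linarith) hp.2⟩
  have hgd := hg.diff.differentiableAt (hopen.mem_nhds hp')
  have h1 : ‖fderiv ℂ g p‖ ≤ 1 := by
    refine norm_fderiv_le_of_lip' ℂ zero_le_one ?_
    filter_upwards [hopen.mem_nhds hp'] with y hy
    rw [one_mul]
    exact hg.lip y hy p hp'
  have h2 : ‖fderiv ℂ (fun w => g (p.1, w)) p.2‖ ≤ 2 * Real.exp (-η * (p.1.re - T)) := by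
    have hb : ball p.2 (ρ / 2) ⊆ ball 0 ρ := by
      refine ball_subset_ball' ?_
      have := mem_ball.1 hp.2
      linarith
    have h3 := norm_fderiv_le_of_forall_norm_le (f := fun w => g (p.1, w)) (x := p.2)
      (C := ρ / 2 * Real.exp (-η * (p.1.re - T))) (half_pos hρ)
      (hg.diff.comp (by fun_prop) fun w hw => ⟨hp.1, hb hw⟩)
      (fun w hw => hg.bound (p.1, w) ⟨hp.1, hb hw⟩)
    refine h3.trans_eq ?_
    field_simp
  have h4 : fderiv ℂ g p (0, q.2) = fderiv ℂ (fun w => g (p.1, w)) p.2 q.2 := by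
    have h5 : HasFDerivAt (fun w : Cn n => g (p.1, w))
        (fderiv ℂ g p ∘L ContinuousLinearMap.inr ℂ ℂ (Cn n)) p.2 :=
      HasFDerivAt.comp (g := g) p.2 hgd.hasFDerivAt (hasFDerivAt_prodMk_right p.1 p.2)
    rw [h5.fderiv]
    rfl
  have h6 : q = (q.1, 0) + (0, q.2) := by simp
  conv_lhs => rw [h6, map_add, h4]
  refine (norm_add_le _ _).trans (add_le_add ?_ ?_)
  · refine ((fderiv ℂ g p).le_of_opNorm_le h1 _).trans ?_
    simp [Prod.norm_def]
  · exact ContinuousLinearMap.le_of_opNorm_le _ h2 _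

/-- The j-th coordinate of D controls |x||dt|, and the other coordinates control |z|‖dw‖ through
J⁻¹; the error occurring in the second bound is absorbed on the left because its coefficient is at
most 1/2. Thus the error is small relative to ‖D‖ itself, with no lower bound on |z| needed. -/
theorem norm_le_of_eq_smul_point_add {x z dt : ℂ} {K K₂ e₁ e₃ : ℝ} {dw : Cn n} {D : Cn (m + 1)}
    {v err : Fin m → ℂ} (hk : k ≠ 0)
    (hD : D = (-(x / k) * dt) • point j 1 u₀ + inclusionL j (v + z • J (dw, 0) + err))
    (hK : 0 ≤ K) (hK₂ : 0 ≤ K₂) (hv : ‖v‖ ≤ K₂ * (‖x‖ * ‖dt‖)) (he₁ : e₁ ≤ 1) (he₁0 : 0 ≤ e₁)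
    (he₃0 : 0 ≤ e₃)
    (herr : ‖err‖ ≤ K * e₁ * (‖x‖ * ‖dt‖) +
      ‖(J : (Cn n × Cn n') →L[ℂ] (Fin m → ℂ))‖ * e₃ * (‖z‖ * ‖dw‖))
    (he₃ : ‖(J.symm : (Fin m → ℂ) →L[ℂ] (Cn n × Cn n'))‖ *
      ‖(J : (Cn n × Cn n') →L[ℂ] (Fin m → ℂ))‖ * e₃ ≤ 1 / 2) :
    ‖err‖ ≤ (K * k * e₁ + ‖(J : (Cn n × Cn n') →L[ℂ] (Fin m → ℂ))‖ *
      (2 * ‖(J.symm : (Fin m → ℂ) →L[ℂ] (Cn n × Cn n'))‖ *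
        (‖otherCoords j‖ + ‖u₀‖ + K₂ * k + K * k)) * e₃) * ‖D‖ := by
  set j₁ := ‖(J : (Cn n × Cn n') →L[ℂ] (Fin m → ℂ))‖ with hj₁
  set j₂ := ‖(J.symm : (Fin m → ℂ) →L[ℂ] (Cn n × Cn n'))‖ with hj₂
  have hj₁0 : 0 ≤ j₁ := norm_nonneg _
  have hj₂0 : 0 ≤ j₂ := norm_nonneg _
  have hk0 : (0 : ℝ) < k := by exact_mod_cast Nat.pos_of_ne_zero hk
  have hN := norm_nonneg D
  have h1 : ‖x‖ * ‖dt‖ ≤ k * ‖D‖ := by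
    have h2 : D j = -(x / k) * dt := by simp [hD, inclusionL_apply]
    have h3 : ‖D j‖ ≤ ‖D‖ := PiLp.norm_apply_le D j
    rw [h2, norm_mul, norm_neg, norm_div, Complex.norm_natCast, div_mul_eq_mul_div,
      div_le_iff₀' hk0] at h3
    exact h3
  have hxt : 0 ≤ ‖x‖ * ‖dt‖ := by positivity
  have h4 : z • J (dw, 0) = otherCoords j D - (-(x / k) * dt) • u₀ - v - err := by
    have h5 : otherCoords j D = (-(x / k) * dt) • u₀ + (v + z • J (dw, 0) + err) := by
      ext i
      simp [hD, otherCoords_apply, inclusionL_apply]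
    rw [h5]; abel
  have h5 : ‖z‖ * ‖dw‖ ≤ j₂ * ‖z • J (dw, 0)‖ := by
    have h6 : J.symm (z • J (dw, 0)) = z • (dw, 0) := by rw [map_smul, J.symm_apply_apply]
    have h7 := (J.symm : (Fin m → ℂ) →L[ℂ] (Cn n × Cn n')).le_opNorm (z • J (dw, 0))
    have h8 : ‖((J.symm : (Fin m → ℂ) →L[ℂ] (Cn n × Cn n')) (z • J (dw, 0)))‖ = ‖z‖ * ‖dw‖ := by
      change ‖J.symm (z • J (dw, 0))‖ = _
      rw [h6, norm_smul]
      simp [Prod.norm_def]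
    rwa [h8] at h7
  have h6 : ‖(-(x / k) * dt) • u₀‖ ≤ ‖D‖ * ‖u₀‖ := by
    rw [norm_smul, norm_mul, norm_neg, norm_div, Complex.norm_natCast, div_mul_eq_mul_div]
    gcongr
    rw [div_le_iff₀' hk0]
    exact h1
  have h7 : ‖z • J (dw, 0)‖ ≤ (‖otherCoords j‖ + ‖u₀‖ + K₂ * k + K * k) * ‖D‖ +
      j₁ * e₃ * (‖z‖ * ‖dw‖) := by
    rw [h4]
    have g1 := (otherCoords j).le_opNorm D
    have g2 : ‖v‖ ≤ K₂ * (k * ‖D‖) := hv.trans (by gcongr)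
    have g3 : K * e₁ * (‖x‖ * ‖dt‖) ≤ K * 1 * (k * ‖D‖) := by gcongr
    have g4 := norm_sub_le (otherCoords j D - (-(x / k) * dt) • u₀ - v) err
    have g5 := norm_sub_le (otherCoords j D - (-(x / k) * dt) • u₀) v
    have g6 := norm_sub_le (otherCoords j D) ((-(x / k) * dt) • u₀)
    linarith
  have h8 : ‖z‖ * ‖dw‖ ≤ 2 * j₂ * (‖otherCoords j‖ + ‖u₀‖ + K₂ * k + K * k) * ‖D‖ := by
    have g1 := h5.trans (mul_le_mul_of_nonneg_left h7 hj₂0)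
    have g2 : j₂ * j₁ * e₃ * (‖z‖ * ‖dw‖) ≤ 1 / 2 * (‖z‖ * ‖dw‖) := by gcongr
    linarith
  refine herr.trans ?_
  have g1 : K * e₁ * (‖x‖ * ‖dt‖) ≤ K * e₁ * (k * ‖D‖) := by gcongr
  have g2 : j₁ * e₃ * (‖z‖ * ‖dw‖) ≤
      j₁ * e₃ * (2 * j₂ * (‖otherCoords j‖ + ‖u₀‖ + K₂ * k + K * k) * ‖D‖) := by gcongr
  linarith

theorem sectorChart_eq_add (p : ℂ × (Fin m → ℂ)) : sectorChart κ k η j u₀ p =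
    xCoord κ k p.1 • point j 1 u₀ +
      xCoord κ k p.1 • inclusionL j (Complex.exp (-(η * p.1)) • p.2) := by
  rw [sectorChart, ← smul_add, ← point_add]

theorem hasDerivAt_cexp_mul (A a t : ℂ) :
    HasDerivAt (fun t => A * Complex.exp (-(a * t))) (-a * (A * Complex.exp (-(a * t)))) t := by
  have h1 : HasDerivAt (fun t : ℂ => -(a * t)) (-(a * 1)) t := ((hasDerivAt_id t).const_mul a).neg
  have h2 := (h1.cexp).const_mul A
  refine h2.congr_deriv ?_
  ring

/-- The terms are grouped for the tangency proof: first those in the limit space, spanned by the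
direction (1, u₀) and the vectors J(w, 0), then in the last bracket the contributions of the curve c
and of the graph function g. -/
theorem fderiv_sectorChart_graphChart {p : ℂ × Cn n} (hc : DifferentiableAt ℂ c p.1)
    (hg : DifferentiableAt ℂ g p) (q : ℂ × Cn n) :
    fderiv ℂ (fun p => sectorChart κ k η j u₀ (graphChart β c J g p)) p q =
      (-(xCoord κ k p.1 / k) * q.1) • point j 1 u₀ + inclusionL j
        ((-(1 / k + η + β) * (κ * Complex.exp (-((1 / k + η + β) * p.1))) * q.1) • J (p.2, 0) +
        (κ * Complex.exp (-((1 / k + η + β) * p.1))) • J (q.2, 0) +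
        (((-(1 / k + η) * (κ * Complex.exp (-((1 / k + η) * p.1))) * q.1) • c p.1 +
          ((κ * Complex.exp (-((1 / k + η) * p.1))) * q.1) • deriv c p.1) +
          ((-(1 / k + η + β) * (κ * Complex.exp (-((1 / k + η + β) * p.1))) * q.1) • J (0, g p) +
          (κ * Complex.exp (-((1 / k + η + β) * p.1))) • J (0, fderiv ℂ g p q)))) := by
  set Ψ := fun p => sectorChart κ k η j u₀ (graphChart β c J g p) with hΨ
  have hΨd : DifferentiableAt ℂ Ψ p := DifferentiableAt.comp p (g := sectorChart κ k η j u₀)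
    (differentiable_sectorChart κ k η j u₀ _) (differentiableAt_graphChart hc hg)
  -- derivative along the line through `p` with direction `q`
  have hl : HasDerivAt (fun s : ℂ => p + s • q) q 0 := by
    simpa using ((hasDerivAt_id (0 : ℂ)).smul_const q).const_add p
  have hl0 : p + (0 : ℂ) • q = p := by simp
  have hl1 : HasDerivAt (fun s : ℂ => (p + s • q).1) q.1 0 := hl.fst
  have hl2 : HasDerivAt (fun s : ℂ => (p + s • q).2) q.2 0 := hl.snd
  have h1 : HasDerivAt (fun s : ℂ => Ψ (p + s • q)) (fderiv ℂ Ψ p q) 0 := by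
    refine HasFDerivAt.comp_hasDerivAt (0 : ℂ) (l := Ψ) ?_ hl
    rw [hl0]; exact hΨd.hasFDerivAt
  have hexp (A a : ℂ) : HasDerivAt (fun s : ℂ => A * Complex.exp (-(a * (p + s • q).1)))
      (-a * (A * Complex.exp (-(a * p.1))) * q.1) 0 := by
    refine HasDerivAt.comp (0 : ℂ) (h₂ := fun t => A * Complex.exp (-(a * t))) ?_ hl1
    rw [hl0]
    exact hasDerivAt_cexp_mul A a p.1
  have hc' : HasDerivAt (fun s : ℂ => c (p + s • q).1) (q.1 • deriv c p.1) 0 := by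
    refine HasDerivAt.scomp (0 : ℂ) (g₁ := c) ?_ hl1
    rw [hl0]; exact hc.hasDerivAt
  have hg' : HasDerivAt (fun s : ℂ => g (p + s • q)) (fderiv ℂ g p q) 0 := by
    refine HasFDerivAt.comp_hasDerivAt (0 : ℂ) (l := g) ?_ hl
    rw [hl0]; exact hg.hasFDerivAt
  have hJ : HasDerivAt (fun s : ℂ => J ((p + s • q).2, g (p + s • q))) (J (q.2, fderiv ℂ g p q)) 0 :=
    ((J : (Cn n × Cn n') →L[ℂ] (Fin m → ℂ)).hasFDerivAt).comp_hasDerivAt (0 : ℂ) (hl2.prodMk hg')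
  have h2 : HasDerivAt (fun s : ℂ => (κ * Complex.exp (-((1 / k : ℂ) * (p + s • q).1))) • point j 1 u₀ +
      inclusionL j ((κ * Complex.exp (-((1 / k + η : ℂ) * (p + s • q).1))) • c (p + s • q).1 +
        (κ * Complex.exp (-((1 / k + η + β : ℂ) * (p + s • q).1))) •
          J ((p + s • q).2, g (p + s • q)))) _ 0 :=
    ((hexp κ (1 / k)).smul_const (point j 1 u₀)).add
      (((inclusionL j).hasFDerivAt).comp_hasDerivAt (0 : ℂ)
        (((hexp κ (1 / k + η)).smul hc').add ((hexp κ (1 / k + η + β)).smul hJ)))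
  have h3 : (fun s : ℂ => Ψ (p + s • q)) = fun s : ℂ =>
      (κ * Complex.exp (-((1 / k : ℂ) * (p + s • q).1))) • point j 1 u₀ +
      inclusionL j ((κ * Complex.exp (-((1 / k + η : ℂ) * (p + s • q).1))) • c (p + s • q).1 +
        (κ * Complex.exp (-((1 / k + η + β : ℂ) * (p + s • q).1))) •
          J ((p + s • q).2, g (p + s • q))) := by
    ext1 s
    generalize p + s • q = p
    simp only [hΨ, sectorChart, graphChart, chart, graphPoint, xCoord]
    rw [point_add, smul_add, ← map_smul, smul_add, smul_add]
    simp only [smul_smul, mul_assoc, ← Complex.exp_add]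
    have e1 : -(1 / (k : ℂ) * p.1) = -(p.1 / k) := by ring
    have e2 : -((1 / (k : ℂ) + η) * p.1) = -(p.1 / k) + -(η * p.1) := by ring
    have e3 : -((1 / (k : ℂ) + η + β) * p.1) = -(p.1 / k) + (-(η * p.1) + -(β * p.1)) := by ring
    rw [e1, e2, e3]
  rw [h3] at h1
  rw [h1.unique h2]
  have hJs (a b) : J (a, b) = J (a, 0) + J (0, b) := by rw [← map_add]; simp
  simp only [zero_smul, add_zero]
  rw [hJs p.2 (g p), hJs q.2]
  congr 1
  · congr 1
    rw [xCoord]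
    have e1 : -(1 / (k : ℂ) * p.1) = -(p.1 / k) := by ring
    rw [e1]; ring
  · congr 1
    simp only [smul_add, smul_smul]
    module

theorem norm_deriv_curve_le {T₀ T' θ C η' : ℝ} (hT₀ : 0 ≤ T₀) (hη' : 0 ≤ η') (hT' : T₀ + 1 ≤ T')
    (hθ : θ < 1 / 2)
    (hc : DifferentiableOn ℂ c (strip T₀ (1 / 2)))
    (hc1 : ∀ t ∈ strip T₀ (1 / 2), ‖c t‖ ≤ C * Real.exp (-η' * t.re)) :
    ∃ K, 0 ≤ K ∧ ∀ t ∈ strip T' θ, ‖c t‖ ≤ K ∧ ‖deriv c t‖ ≤ K := by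
  set r := min 1 (1 / 2 - θ) with hr
  have hr0 : 0 < r := lt_min one_pos (by linarith)
  have hr1 : r ≤ 1 := min_le_left _ _
  have hr2 : r ≤ 1 / 2 - θ := min_le_right _ _
  have hb : ∀ t ∈ strip T₀ (1 / 2), ‖c t‖ ≤ |C| := fun t ht => by
    refine (hc1 t ht).trans ?_
    have h1 : Real.exp (-η' * t.re) ≤ 1 := by
      rw [Real.exp_le_one_iff]; nlinarith [ht.1]
    have h2 := Real.exp_pos (-η' * t.re)
    nlinarith [le_abs_self C, abs_nonneg C]
  refine ⟨|C| + 2 * |C| / r, by positivity, fun t ht => ?_⟩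
  have hsub : ball t r ⊆ strip T₀ (1 / 2) := ball_subset_strip (by linarith) (by linarith) ht
  constructor
  · have := hb t (hsub (mem_ball_self hr0))
    have h2 : 0 ≤ 2 * |C| / r := by positivity
    linarith
  · rw [norm_deriv_eq_norm_fderiv]
    have := norm_fderiv_le_of_forall_norm_le hr0 (hc.mono hsub) fun y hy => hb y (hsub hy)
    linarith [abs_nonneg C]

-- The point differs from x · (1, u₀) by |x| O(e^{-ηt}). In the differential, the terms outside W
-- carry a factor e^{-ηt} relative to |x||dt|, or the decaying fibre derivative of g relative to
-- |ζ|‖dw‖, where ζ = κ e^{-(1/k + η + β)t}.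
set_option maxHeartbeats 1000000 in
theorem InvariantGraph.isTangentAtOrigin {F : ℂ × (Fin m → ℂ) → ℂ × (Fin m → ℂ)}
    {T T₀ T' θ η' η'' ρ C : ℝ} (H : InvariantGraph F T θ η'' β ρ c J g) (hk : k ≠ 0) (hκ : κ ≠ 0)
    (hη : 0 < η) (hη'' : 0 < η'') (hβ : 0 ≤ β) (hη' : 0 ≤ η') (hθ0 : 0 < θ) (hθ : θ < 1 / 2)
    (hT : T ≤ T') (hT₀ : 0 ≤ T₀) (hT₀' : T₀ + 1 ≤ T')
    (hc : DifferentiableOn ℂ c (strip T₀ (1 / 2)))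
    (hc1 : ∀ t ∈ strip T₀ (1 / 2), ‖c t‖ ≤ C * Real.exp (-η' * t.re))
    (hmaps : ∀ p ∈ strip T' θ ×ˢ ball 0 (ρ / 2), ‖(graphChart β c J g p).2‖ ≤ 1)
    {W : Submodule ℂ (Cn (m + 1))} (hW : Module.finrank ℂ W = n + 1) (hWv : point j 1 u₀ ∈ W)
    (hWJ : ∀ w, inclusionL j (J (w, 0)) ∈ W) :
    IsTangentAtOrigin (coordSector n (θ / k) (Real.exp (-(T' / k))) (ρ / 2))
      (parametrization κ k η j u₀ β c J g) W := by
  have hρ := H.ρ_pos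
  have hk0 : (0 : ℝ) < k := by exact_mod_cast Nat.pos_of_ne_zero hk
  set S : Set (Cn (n + 1)) := coordSector n (θ / k) (Real.exp (-(T' / k))) (ρ / 2) with hS
  have hmS : MapsTo (sectorTime k) S (strip T' θ ×ˢ ball (0 : Cn n) (ρ / 2)) := mapsTo_sectorTime hk
  have hsub : strip T' θ ×ˢ ball (0 : Cn n) (ρ / 2) ⊆ strip T θ ×ˢ ball 0 ρ :=
    prod_mono (strip_subset_strip hT le_rfl) (ball_subset_ball (by linarith))
  have hgd (p) (hp : p ∈ strip T' θ ×ˢ ball (0 : Cn n) (ρ / 2)) : DifferentiableAt ℂ g p :=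
    H.admissible.diff.differentiableAt
      (((isOpen_strip T θ).prod isOpen_ball).mem_nhds (hsub hp))
  have hcd (t) (ht : t ∈ strip T' θ) : DifferentiableAt ℂ c t :=
    hc.differentiableAt ((isOpen_strip T₀ (1 / 2)).mem_nhds
      (strip_subset_strip (by linarith) hθ.le ht))
  obtain ⟨Kc, hKc0, hKc⟩ := norm_deriv_curve_le hT₀ hη' hT₀' hθ hc hc1
  set j₁ := ‖(J : (Cn n × Cn n') →L[ℂ] (Fin m → ℂ))‖ with hj₁
  set j₂ := ‖(J.symm : (Fin m → ℂ) →L[ℂ] (Cn n × Cn n'))‖ with hj₂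
  have hj₁0 : 0 ≤ j₁ := norm_nonneg _
  have hj₂0 : 0 ≤ j₂ := norm_nonneg _
  set a₁ : ℝ := 1 / k + η with ha₁
  set a₂ : ℝ := 1 / k + η + β with ha₂
  have ha₁0 : 0 ≤ a₁ := by positivity
  have ha₂0 : 0 ≤ a₂ := by positivity
  set K₂ := a₂ * j₁ with hK₂
  set K := a₁ * Kc + Kc + a₂ * j₁ + j₁ with hK
  have hK₂0 : 0 ≤ K₂ := by positivity
  have hK0 : 0 ≤ K := by positivity
  set L := 2 * j₂ * (‖otherCoords j‖ + ‖u₀‖ + K₂ * k + K * k) with hL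
  have hL0 : 0 ≤ L := by positivity
  refine ⟨hW, fun ε hε => ?_⟩
  -- the bounds on the exponentials that are needed
  have t1 := (tendsto_const_mul_exp_neg hη ‖inclusionL j‖).eventually (gt_mem_nhds hε)
  have t2 : ∀ᶠ R in atTop, j₂ * j₁ * (2 * Real.exp (-η'' * (R - T))) < 1 / 2 := by
    have := (tendsto_const_mul_exp_neg hη'' (j₂ * j₁ * (2 * Real.exp (η'' * T)))).eventually
      (gt_mem_nhds (by norm_num : (0 : ℝ) < 1 / 2))
    refine this.mono fun R hR => lt_of_eq_of_lt ?_ hR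
    rw [show -η'' * (R - T) = η'' * T + -η'' * R by ring, Real.exp_add]
    ring
  have t3 : ∀ᶠ R in atTop, ‖inclusionL j‖ * (K * k * Real.exp (-η * R) +
      j₁ * L * (2 * Real.exp (-η'' * (R - T)))) < ε := by
    have h1 := (tendsto_const_mul_exp_neg hη (‖inclusionL j‖ * (K * k))).add
      (tendsto_const_mul_exp_neg hη'' (‖inclusionL j‖ * (j₁ * L * (2 * Real.exp (η'' * T)))))
    rw [add_zero] at h1
    refine (h1.eventually (gt_mem_nhds hε)).mono fun R hR => lt_of_eq_of_lt ?_ hR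
    rw [show -η'' * (R - T) = η'' * T + -η'' * R by ring, Real.exp_add]
    ring
  obtain ⟨R, r1, r2, r3, r4⟩ := (t1.and (t2.and (t3.and (eventually_ge_atTop 0)))).exists
  -- Since |x| ≤ ‖ψ z‖, this threshold forces Re t ≥ R.
  refine ⟨‖κ‖ * Real.exp (-(1 / k : ℝ) * R), by positivity, fun z hz hzδ => ?_⟩
  set p := sectorTime k z with hp
  have hpm : p ∈ strip T' θ ×ˢ ball (0 : Cn n) (ρ / 2) := hmS hz
  have hpT : p ∈ strip T θ ×ˢ ball (0 : Cn n) (ρ / 2) := ⟨strip_subset_strip hT le_rfl hpm.1, hpm.2⟩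
  set x := xCoord κ k p.1 with hx
  have hxψ : ‖x‖ ≤ ‖parametrization κ k η j u₀ β c J g z‖ :=
    norm_le_norm_sectorChart (κ := κ) (k := k) (η := η) (j := j) (u₀ := u₀) (graphChart β c J g p)
  have hre : R ≤ p.1.re := by
    have h1 := hxψ.trans_lt hzδ
    rw [hx, norm_xCoord] at h1
    have h2 := lt_of_mul_lt_mul_left h1 (norm_nonneg κ)
    rw [Real.exp_lt_exp] at h2
    have h3 : 0 < 1 / (k : ℝ) := by positivity
    nlinarith
  have hre0 : 0 ≤ p.1.re := r4.trans hre
  have he1 : Real.exp (-η * p.1.re) ≤ Real.exp (-η * R) := mul_exp_neg_le _ hη hre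
  have he3 : Real.exp (-η'' * (p.1.re - T)) ≤ Real.exp (-η'' * (R - T)) :=
    mul_exp_neg_le _ hη'' (by linarith)
  have hι0 : 0 ≤ ‖inclusionL j‖ := norm_nonneg _
  constructor
  · have h1 : parametrization κ k η j u₀ β c J g z = x • point j 1 u₀ +
        x • inclusionL j (Complex.exp (-(η * p.1)) • (graphChart β c J g p).2) := by
      exact sectorChart_eq_add (graphChart β c J g p)
    refine (infDist_le_dist_of_mem (W.smul_mem x hWv)).trans ?_
    rw [dist_eq_norm, h1, add_sub_cancel_left, ← h1]
    rw [norm_smul]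
    have h2 : ‖Complex.exp (-(η * p.1)) • (graphChart β c J g p).2‖ ≤ Real.exp (-η * R) := by
      rw [norm_smul, norm_exp_neg_mul]
      exact (mul_le_of_le_one_right (Real.exp_nonneg _) (hmaps p hpm)).trans he1
    have h3 : ‖inclusionL j (Complex.exp (-(η * p.1)) • (graphChart β c J g p).2)‖ ≤ ε :=
      ((inclusionL j).le_opNorm _).trans ((mul_le_mul_of_nonneg_left h2 hι0).trans r1.le)
    rw [mul_comm]
    exact mul_le_mul h3 hxψ (norm_nonneg _) hε.le
  · intro t
    have hslit : z 0 ∈ Complex.slitPlane :=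
      mem_slitPlane_of_mem_coordSector (div_natCast_le_one hk hθ0.le (by linarith)) hz
    have hΨd : DifferentiableAt ℂ (fun p => sectorChart κ k η j u₀ (graphChart β c J g p)) p :=
      DifferentiableAt.comp p (g := sectorChart κ k η j u₀)
        (differentiable_sectorChart κ k η j u₀ _)
        (differentiableAt_graphChart (hcd _ hpm.1) (hgd _ hpm))
    have hchain : fderiv ℂ (parametrization κ k η j u₀ β c J g) z t =
        fderiv ℂ (fun p => sectorChart κ k η j u₀ (graphChart β c J g p)) p
          (fderiv ℂ (sectorTime k) z t) := by
      have h1 : HasFDerivAt (parametrization κ k η j u₀ β c J g) _ z :=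
        HasFDerivAt.comp (g := fun p => sectorChart κ k η j u₀ (graphChart β c J g p)) z
          hΨd.hasFDerivAt (differentiableAt_sectorTime hslit).hasFDerivAt
      rw [h1.fderiv]
      rfl
    rw [hchain]
    generalize fderiv ℂ (sectorTime k) z t = q
    have hform := fderiv_sectorChart_graphChart (κ := κ) (k := k) (η := η) (β := β) (j := j)
      (u₀ := u₀) (J := J) (hcd _ hpm.1) (hgd _ hpm) q
    set D := fderiv ℂ (fun p => sectorChart κ k η j u₀ (graphChart β c J g p)) p q with hD
    set y : ℂ := κ * Complex.exp (-((1 / k + η) * p.1)) with hy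
    set ζ : ℂ := κ * Complex.exp (-((1 / k + η + β) * p.1)) with hζ
    have hyn : ‖y‖ = ‖x‖ * Real.exp (-η * p.1.re) := by
      rw [hy, norm_mul, show ((1 / k + η) * p.1 : ℂ) = ((1 / k + η : ℝ) : ℂ) * p.1 by push_cast; rfl,
        norm_exp_neg_mul, hx, norm_xCoord, mul_assoc, ← Real.exp_add]
      congr 2; ring
    have hζn : ‖ζ‖ ≤ ‖y‖ := by
      rw [hy, hζ, norm_mul, norm_mul,
        show ((1 / k + η) * p.1 : ℂ) = ((1 / k + η : ℝ) : ℂ) * p.1 by push_cast; rfl,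
        show ((1 / k + η + β) * p.1 : ℂ) = ((1 / k + η + β : ℝ) : ℂ) * p.1 by push_cast; rfl,
        norm_exp_neg_mul, norm_exp_neg_mul]
      refine mul_le_mul_of_nonneg_left (Real.exp_le_exp.2 ?_) (norm_nonneg κ)
      nlinarith
    have he1' : Real.exp (-η * p.1.re) ≤ 1 := by rw [Real.exp_le_one_iff]; nlinarith
    have hyx : ‖y‖ ≤ ‖x‖ := by
      rw [hyn]; exact mul_le_of_le_one_right (norm_nonneg _) he1'
    have hA₁ : ‖(-(1 / k + η) : ℂ)‖ = a₁ := by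
      rw [norm_neg, show (1 / k + η : ℂ) = ((1 / k + η : ℝ) : ℂ) by push_cast; rfl,
        Complex.norm_real, Real.norm_of_nonneg ha₁0]
    have hA₂ : ‖(-(1 / k + η + β) : ℂ)‖ = a₂ := by
      rw [norm_neg, show (1 / k + η + β : ℂ) = ((1 / k + η + β : ℝ) : ℂ) by push_cast; rfl,
        Complex.norm_real, Real.norm_of_nonneg ha₂0]
    have hJ1 (w : Cn n × Cn n') : ‖J w‖ ≤ j₁ * ‖w‖ :=
      (J : (Cn n × Cn n') →L[ℂ] (Fin m → ℂ)).le_opNorm w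
    have hρ1 := H.ρ_le
    have hw1 : ‖((p.2, 0) : Cn n × Cn n')‖ ≤ 1 := by
      have := mem_ball_zero_iff.1 hpm.2
      simp only [Prod.norm_def, norm_zero]
      exact max_le (by linarith) zero_le_one
    have hg1 : ‖((0, g p) : Cn n × Cn n')‖ ≤ 1 := by
      have := H.norm_le p (hsub hpm)
      simp only [Prod.norm_def, norm_zero]
      exact max_le zero_le_one (by linarith)
    have hg2 : ‖((0, fderiv ℂ g p q) : Cn n × Cn n')‖ ≤
        ‖q.1‖ + 2 * Real.exp (-η'' * (p.1.re - T)) * ‖q.2‖ := by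
      have := H.admissible.norm_fderiv_apply_le hρ hpT q
      simp only [Prod.norm_def, norm_zero]
      exact max_le (by positivity) this
    set e₃ := 2 * Real.exp (-η'' * (p.1.re - T)) with he₃
    have he₃0 : 0 ≤ e₃ := by positivity
    have he₃R : e₃ ≤ 2 * Real.exp (-η'' * (R - T)) := by rw [he₃]; gcongr
    set v : Fin m → ℂ := (-(1 / k + η + β) * ζ * q.1) • J (p.2, 0) with hv
    set err : Fin m → ℂ := (-(1 / k + η) * y * q.1) • c p.1 + (y * q.1) • deriv c p.1 +
      ((-(1 / k + η + β) * ζ * q.1) • J (0, g p) + ζ • J (0, fderiv ℂ g p q)) with herr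
    have hvn : ‖v‖ ≤ K₂ * (‖x‖ * ‖q.1‖) := by
      rw [hv, norm_smul, norm_mul, norm_mul, hA₂]
      calc _ ≤ a₂ * ‖x‖ * ‖q.1‖ * (j₁ * 1) := by
            gcongr
            · exact hζn.trans hyx
            · exact (hJ1 _).trans (by gcongr)
        _ = _ := by rw [hK₂]; ring
    have herrn : ‖err‖ ≤ K * Real.exp (-η * p.1.re) * (‖x‖ * ‖q.1‖) + j₁ * e₃ * (‖ζ‖ * ‖q.2‖) := by
      have g1 : ‖(-(1 / k + η) * y * q.1) • c p.1‖ ≤ a₁ * ‖y‖ * ‖q.1‖ * Kc := by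
        rw [norm_smul, norm_mul, norm_mul, hA₁]
        gcongr
        exact (hKc _ hpm.1).1
      have g2 : ‖(y * q.1) • deriv c p.1‖ ≤ ‖y‖ * ‖q.1‖ * Kc := by
        rw [norm_smul, norm_mul]
        gcongr
        exact (hKc _ hpm.1).2
      have g3 : ‖(-(1 / k + η + β) * ζ * q.1) • J (0, g p)‖ ≤ a₂ * ‖y‖ * ‖q.1‖ * (j₁ * 1) := by
        rw [norm_smul, norm_mul, norm_mul, hA₂]
        gcongr
        exact (hJ1 _).trans (by gcongr)
      have g4 : ‖ζ • J (0, fderiv ℂ g p q)‖ ≤ ‖y‖ * j₁ * ‖q.1‖ + j₁ * e₃ * (‖ζ‖ * ‖q.2‖) := by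
        rw [norm_smul]
        have g5 : ‖J (0, fderiv ℂ g p q)‖ ≤ j₁ * (‖q.1‖ + e₃ * ‖q.2‖) :=
          (hJ1 _).trans (by gcongr)
        have g6 : ‖ζ‖ * (j₁ * ‖q.1‖) ≤ ‖y‖ * (j₁ * ‖q.1‖) := by gcongr
        have g7 := mul_le_mul_of_nonneg_left g5 (norm_nonneg ζ)
        linarith
      have g5 := norm_add_le ((-(1 / k + η) * y * q.1) • c p.1 + (y * q.1) • deriv c p.1)
        ((-(1 / k + η + β) * ζ * q.1) • J (0, g p) + ζ • J (0, fderiv ℂ g p q))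
      have g6 := norm_add_le ((-(1 / k + η) * y * q.1) • c p.1) ((y * q.1) • deriv c p.1)
      have g7 := norm_add_le ((-(1 / k + η + β) * ζ * q.1) • J (0, g p)) (ζ • J (0, fderiv ℂ g p q))
      have g8 : K * Real.exp (-η * p.1.re) * (‖x‖ * ‖q.1‖) = K * ‖y‖ * ‖q.1‖ := by
        rw [hyn]; ring
      rw [g8, hK]
      linarith
    have hest := norm_le_of_eq_smul_point_add hk hform hK0 hK₂0 hvn he1' (Real.exp_nonneg _) he₃0
      herrn ((mul_le_mul_of_nonneg_left he₃R (by positivity)).trans r2.le)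
    -- The vector of W to compare with is D without its error part.
    have hmem : (-(x / k) * q.1) • point j 1 u₀ + inclusionL j (v + ζ • J (q.2, 0)) ∈ W := by
      refine W.add_mem (W.smul_mem _ hWv) ?_
      rw [map_add, hv, map_smul, map_smul]
      exact W.add_mem (W.smul_mem _ (hWJ _)) (W.smul_mem _ (hWJ _))
    refine (infDist_le_dist_of_mem hmem).trans ?_
    have hdiff : D - ((-(x / k) * q.1) • point j 1 u₀ + inclusionL j (v + ζ • J (q.2, 0))) =
        inclusionL j err := by
      rw [hform, map_add (inclusionL j) (v + ζ • J (q.2, 0)) err]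
      abel
    rw [dist_eq_norm, hdiff]
    refine ((inclusionL j).le_opNorm _).trans ((mul_le_mul_of_nonneg_left hest hι0).trans ?_)
    rw [← mul_assoc]
    refine mul_le_mul_of_nonneg_right (le_trans ?_ r3.le) (norm_nonneg D)
    gcongr

end ParabolicManifolds
end
-- Directors, spectral gaps, and the dimension of the limit spaces.
noncomputable section
namespace ParabolicManifolds
open Metric Set

section Spectrum

variable {V : Type*} [AddCommGroup V] [Module ℂ V]

theorem maxGenEigenspace_eq_bot {L : Module.End ℂ V} {μ : ℂ} (h : ¬ L.HasEigenvalue μ) :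
    L.maxGenEigenspace μ = ⊥ := by
  by_contra hne
  refine h ?_
  have h1 : L.HasUnifEigenvalue μ ⊤ := hne
  exact (Module.End.hasUnifEigenvalue_iff_hasUnifEigenvalue_one (by simp)).1 h1

/-- Connects the half-plane splitting at the level b with the listed directors: the level lies in
the gap below Re λ_i, and numbers that are not eigenvalues contribute the zero space. -/
theorem biSup_maxGenEigenspace_eq {h : ℕ} {L : Module.End ℂ V} {lam : Fin h → ℂ}
    (hlam : range lam = {μ : ℂ | L.HasEigenvalue μ ∧ 0 < μ.re}) (i : Fin h) {b : ℝ} (hb0 : 0 ≤ b)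
    (hb : b < (lam i).re)
    (hgap : ∀ μ, L.HasEigenvalue μ → μ.re < (lam i).re → μ.re < b) :
    ⨆ μ ∈ {μ : ℂ | b < μ.re}, L.maxGenEigenspace μ =
      ⨆ l ∈ Finset.univ.filter (fun l => (lam i).re ≤ (lam l).re), L.maxGenEigenspace (lam l) := by
  apply le_antisymm
  · refine iSup₂_le fun μ hμ => ?_
    by_cases he : L.HasEigenvalue μ
    · have hμ' : b < μ.re := hμ
      obtain ⟨l, rfl⟩ : μ ∈ range lam := by
        rw [hlam]
        exact ⟨he, hb0.trans_lt hμ'⟩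
      refine le_iSup₂_of_le l ?_ le_rfl
      simp only [Finset.mem_filter, Finset.mem_univ, true_and]
      by_contra! hlt
      exact absurd (hgap _ he hlt) hμ'.le.not_gt
    · rw [maxGenEigenspace_eq_bot he]
      exact bot_le
  · refine iSup₂_le fun l hl => ?_
    simp only [Finset.mem_filter, Finset.mem_univ, true_and] at hl
    exact le_iSup₂_of_le (lam l) (hb.trans_le hl) le_rfl

variable [FiniteDimensional ℂ V]

/-- There are finitely many eigenvalues, so one small ϖ serves all of them and all i. -/
theorem eventually_spectral_gap (L : Module.End ℂ V) {h : ℕ} (lam : Fin h → ℂ)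
    (hpos : ∀ i, 0 < (lam i).re) :
    ∀ᶠ ϖ in 𝓝[>] (0 : ℝ), ∀ i, 0 < (lam i).re - ϖ ∧
      ∀ μ, L.HasEigenvalue μ → μ.re < (lam i).re → μ.re < (lam i).re - ϖ := by
  have key {x : ℝ} (hx : 0 < x) : ∀ᶠ ϖ in 𝓝[>] (0 : ℝ), ϖ < x :=
    mem_nhdsWithin_of_mem_nhds (Iio_mem_nhds hx)
  refine eventually_all.2 fun i => ((key (hpos i)).mono fun _ => sub_pos.2).and ?_
  have hfin : {μ | L.HasEigenvalue μ}.Finite := Module.End.finite_hasEigenvalue L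
  have : ∀ᶠ ϖ in 𝓝[>] (0 : ℝ), ∀ μ ∈ {μ | L.HasEigenvalue μ},
      μ.re < (lam i).re → μ.re < (lam i).re - ϖ := by
    refine (eventually_all_finite hfin).2 fun μ _ => ?_
    by_cases hμ : μ.re < (lam i).re
    · filter_upwards [key (sub_pos.2 hμ)] with ϖ h1 _
      linarith
    · exact Eventually.of_forall fun _ h1 => absurd h1 hμ
  exact this

theorem finrank_biSup_maxGenEigenspace {m h : ℕ} (A : Matrix (Fin m) (Fin m) ℂ) {lam : Fin h → ℂ}
    (hinj : Function.Injective lam) (s : Finset (Fin h)) :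
    Module.finrank ℂ ↥(⨆ l ∈ s, Module.End.maxGenEigenspace (Matrix.toLin' A) (lam l)) =
      ∑ l ∈ s, A.charpoly.rootMultiplicity (lam l) := by
  refine (finrank_biSup_of_iSupIndep
    ((Module.End.independent_maxGenEigenspace (Matrix.toLin' A)).comp hinj) s).trans ?_
  refine Finset.sum_congr rfl fun l _ => ?_
  rw [Function.comp_apply, LinearMap.finrank_maxGenEigenspace_eq, Matrix.charpoly_toLin']

end Spectrum

theorem finrank_maxGenEigenspace_pos {V : Type*} [AddCommGroup V] [Module ℂ V]
    [FiniteDimensional ℂ V] {L : Module.End ℂ V} {μ : ℂ} (h : L.HasEigenvalue μ) :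
    0 < Module.finrank ℂ (L.maxGenEigenspace μ) := by
  have h1 : L.HasUnifEigenvalue μ ⊤ :=
    (Module.End.hasUnifEigenvalue_iff_hasUnifEigenvalue_one (by simp)).2 h
  rw [Module.finrank_pos_iff_exists_ne_zero]
  obtain ⟨v, hv, hv0⟩ := Submodule.exists_mem_ne_zero_of_ne_bot h1
  exact ⟨⟨v, hv⟩, fun h2 => hv0 (congrArg Subtype.val h2)⟩

section Direction

variable {m : ℕ} (Φ : Cn (m + 1) → Cn (m + 1)) (k : ℕ) (j : Fin (m + 1)) {V : Cn (m + 1)}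

/-- The endomorphism given by the matrix associated to a direction, as a continuous linear map. -/
def associatedMap (V : Cn (m + 1)) : (Fin m → ℂ) →L[ℂ] (Fin m → ℂ) :=
  ((k : ℂ) * pPart Φ k j (affineCoord j V))⁻¹ • fderiv ℂ (rMap Φ k j) (affineCoord j V)

theorem toLin'_associatedMatrix (V : Cn (m + 1)) :
    Matrix.toLin' (associatedMatrix Φ k j V) =
      (associatedMap Φ k j V : (Fin m → ℂ) →ₗ[ℂ] (Fin m → ℂ)) := by
  rw [associatedMatrix, map_smul, Matrix.toLin'_toMatrix']
  rfl

theorem inclusion_injective : Function.Injective (inclusion (m := m) j) := fun y y' h => by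
  ext i
  have := congrArg (fun z : Cn (m + 1) => z (j.succAbove i)) h
  simpa [inclusion] using this

theorem finrank_span_sup_map_inclusion (hj : V j ≠ 0) (S : Submodule ℂ (Fin m → ℂ)) :
    Module.finrank ℂ ↥(Submodule.span ℂ {V} ⊔ S.map (inclusion j)) = Module.finrank ℂ S + 1 := by
  have hV : V ≠ 0 := fun h => hj (by simp [h])
  have hdisj : Submodule.span ℂ {V} ⊓ S.map (inclusion j) = ⊥ := by
    refine (Submodule.eq_bot_iff _).2 fun z hz => ?_
    obtain ⟨⟨c, rfl⟩, y, -, hy⟩ : (∃ c : ℂ, c • V = z) ∧ ∃ y ∈ S, inclusion j y = z :=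
      ⟨Submodule.mem_span_singleton.1 hz.1, hz.2⟩
    have h1 := congrArg (fun z : Cn (m + 1) => z j) hy
    have h2 : c * V j = 0 := by simpa [inclusion] using h1.symm
    rw [(mul_eq_zero.1 h2).resolve_right hj, zero_smul]
  have h1 := Submodule.finrank_sup_add_finrank_inf_eq (Submodule.span ℂ {V}) (S.map (inclusion j))
  rw [hdisj, finrank_bot, finrank_span_singleton hV,
    LinearEquiv.finrank_eq (S.equivMapOfInjective _ (inclusion_injective j)).symm] at h1
  omega

theorem point_mem_span (hj : V j ≠ 0) : point j 1 (affineCoord j V) ∈ Submodule.span ℂ {V} := by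
  refine Submodule.mem_span_singleton.2 ⟨(V j)⁻¹, ?_⟩
  refine (congrArg ((V j)⁻¹ • ·) (eq_smul_point j hj)).trans ?_
  beta_reduce
  rw [smul_smul, inv_mul_cancel₀ hj, one_smul]

theorem iSup_directorSpace {h : ℕ} (lam : Fin h → ℂ) (i : Fin h) (V : Cn (m + 1)) :
    ⨆ l : Fin h, ⨆ _ : (lam i).re ≤ (lam l).re, directorSpace Φ k j V (lam l) =
      (⨆ l ∈ Finset.univ.filter (fun l => (lam i).re ≤ (lam l).re),
        Module.End.maxGenEigenspace (Matrix.toLin' (associatedMatrix Φ k j V)) (lam l)).map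
          (inclusion j) := by
  simp only [Submodule.map_iSup, Finset.mem_filter, Finset.mem_univ, true_and]
  rfl

end Direction

theorem re_inner_sub_smul {n : ℕ} (L : Cn n →L[ℂ] Cn n) (a : ℝ) (w : Cn n) :
    (inner ℂ w ((L - (a : ℂ) • ContinuousLinearMap.id ℂ (Cn n)) w)).re =
      (inner ℂ w (L w)).re - a * ‖w‖ ^ 2 := by
  have e : (L - (a : ℂ) • ContinuousLinearMap.id ℂ (Cn n)) w = L w - (a : ℂ) • w := rfl
  rw [e, inner_sub_right, inner_smul_right, inner_self_eq_norm_sq_to_K, Complex.sub_re]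
  congr 1
  change ((a : ℂ) * ((‖w‖ : ℝ) : ℂ) ^ 2).re = _
  rw [← Complex.ofReal_pow, ← Complex.ofReal_mul, Complex.ofReal_re]

/-- An invariant splitting of the space at a spectral gap of the associated matrix. -/
theorem exists_director_splitting {m h : ℕ} (Φ : Cn (m + 1) → Cn (m + 1)) (k : ℕ)
    (j : Fin (m + 1)) {V : Cn (m + 1)} (hj : V j ≠ 0) {lam : Fin h → ℂ}
    (hlam : range lam = {μ : ℂ | IsDirector Φ k j V μ ∧ 0 < μ.re})
    (hinj : Function.Injective lam) (i : Fin h) {η β : ℝ} (hη : 0 ≤ η) (hβ : 0 < β)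
    (hb : β + η < (lam i).re)
    (hgap : ∀ μ, IsDirector Φ k j V μ → μ.re < (lam i).re → μ.re < β + η) :
    ∃ (n n' : ℕ) (J : (Cn n × Cn n') ≃L[ℂ] (Fin m → ℂ)) (As : Cn n →L[ℂ] Cn n)
      (Ac : Cn n' →L[ℂ] Cn n') (a : ℝ), 0 < a ∧
      (∀ w, (associatedMap Φ k j V - (η : ℂ) • ContinuousLinearMap.id ℂ (Fin m → ℂ)) (J w) =
        J (As w.1, Ac w.2)) ∧
      (∀ w, (β + a) * ‖w‖ ^ 2 ≤ (inner ℂ w (As w)).re) ∧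
      (∀ w, (inner ℂ w (Ac w)).re ≤ (β - a) * ‖w‖ ^ 2) ∧
      n = ∑ l with (lam i).re ≤ (lam l).re, algMult Φ k j V (lam l) ∧ 0 < n ∧
      Module.finrank ℂ ↥(Submodule.span ℂ {V} ⊔ ⨆ l : Fin h, ⨆ _ : (lam i).re ≤ (lam l).re,
        directorSpace Φ k j V (lam l)) = n + 1 ∧
      ∀ w, inclusionL j (J (w, 0)) ∈ Submodule.span ℂ {V} ⊔ ⨆ l : Fin h,
        ⨆ _ : (lam i).re ≤ (lam l).re, directorSpace Φ k j V (lam l) := by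
  set L : Module.End ℂ (Fin m → ℂ) := Matrix.toLin' (associatedMatrix Φ k j V) with hL
  have hne (μ) (hμ : L.HasEigenvalue μ) : μ.re ≠ β + η := by
    intro he
    rcases lt_or_ge μ.re (lam i).re with h1 | h1
    · exact (hgap μ hμ h1).ne he
    · linarith
  obtain ⟨n, n', J, As, Ac, a, ha, hJ, hAs, hAc, hn, hJs⟩ := exists_splitting L (β + η) hne
  have hsup := biSup_maxGenEigenspace_eq (L := L) hlam i (by positivity) hb hgap
  rw [hsup] at hn
  simp only [hsup] at hJs
  have hn' : n = ∑ l with (lam i).re ≤ (lam l).re, algMult Φ k j V (lam l) := by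
    rw [hn, finrank_biSup_maxGenEigenspace _ hinj]
    rfl
  refine ⟨n, n', J, As - (η : ℂ) • ContinuousLinearMap.id ℂ _,
    Ac - (η : ℂ) • ContinuousLinearMap.id ℂ _, a, ha, fun w => ?_, fun w => ?_, fun w => ?_,
    hn', ?_, ?_, fun w => ?_⟩
  · have e1 : (associatedMap Φ k j V - (η : ℂ) • ContinuousLinearMap.id ℂ (Fin m → ℂ)) (J w) =
        L (J w) - (η : ℂ) • J w := by
      rw [hL, toLin'_associatedMatrix]
      rfl
    rw [e1, hJ, ← map_smul, ← map_sub]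
    rfl
  · rw [re_inner_sub_smul]
    linarith [hAs w]
  · rw [re_inner_sub_smul]
    linarith [hAc w]
  · have hi : L.HasEigenvalue (lam i) := by
      have : lam i ∈ range lam := mem_range_self i
      rw [hlam] at this
      exact this.1
    rw [hn]
    refine (finrank_maxGenEigenspace_pos hi).trans_le (Submodule.finrank_mono ?_)
    exact le_iSup₂_of_le i (by simp) le_rfl
  · rw [iSup_directorSpace, finrank_span_sup_map_inclusion j hj, hn]
  · rw [iSup_directorSpace]
    exact Submodule.mem_sup_right (Submodule.mem_map_of_mem (hJs w))

/-- Supplies the scale κ for which -k p₀ x^k becomes e^{-t}. -/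
theorem exists_pow_eq_of_ne_zero {k : ℕ} (hk : k ≠ 0) {p₀ : ℂ} (hp₀ : p₀ ≠ 0) :
    ∃ κ : ℂ, κ ≠ 0 ∧ -(k : ℂ) * p₀ * κ ^ k = 1 := by
  have hk' : (k : ℂ) ≠ 0 := Nat.cast_ne_zero.2 hk
  obtain ⟨κ, hκ⟩ := IsAlgClosed.exists_pow_nat_eq (-(k * p₀)⁻¹) (Nat.pos_of_ne_zero hk)
  refine ⟨κ, fun h0 => ?_, ?_⟩
  · rw [h0, zero_pow hk] at hκ
    exact neg_ne_zero.2 (inv_ne_zero (mul_ne_zero hk' hp₀)) hκ.symm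
  · rw [hκ]
    field_simp

end ParabolicManifolds
end
-- Invariant graphs for all rates simultaneously, around one common curve.
noncomputable section
namespace ParabolicManifolds
open Metric Set

/-- The inclusions require one curve c, one strip width θ and one starting abscissa T' for all
rates; the last conclusion is the smallness that puts each graph into the charts with smaller
exponents. -/
theorem SlowSystem.exists_invariantGraphs {E : Type*} [NormedAddCommGroup E] [NormedSpace ℂ E]
    [FiniteDimensional ℂ E] {T η C : ℝ} {a : ℂ × E → ℂ} {b : ℂ × E → E} (B : E →L[ℂ] E)
    (H : SlowSystem T 1 η C a b) (hT : 0 ≤ T) (hη : 0 < η) (hη1 : η ≤ 1)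
    {h : ℕ} {β m : Fin h → ℝ} (hβ : ∀ i, 0 < β i) {n n' : Fin h → ℕ}
    (J : ∀ i, (Cn (n i) × Cn (n' i)) ≃L[ℂ] E) {As : ∀ i, Cn (n i) →L[ℂ] Cn (n i)}
    {Ac : ∀ i, Cn (n' i) →L[ℂ] Cn (n' i)} (hm : ∀ i, 0 < m i)
    (hJ : ∀ i w, B (J i w) = J i (As i w.1, Ac i w.2))
    (hAs : ∀ i w, (β i + m i) * ‖w‖ ^ 2 ≤ (inner ℂ w (As i w)).re)
    (hAc : ∀ i w, (inner ℂ w (Ac i w)).re ≤ (β i - m i) * ‖w‖ ^ 2) :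
    ∃ (θ T₀ T' C₁ : ℝ) (c : ℂ → E) (τ ρ : Fin h → ℝ) (g : ∀ i, ℂ × Cn (n i) → Cn (n' i)),
      0 < θ ∧ θ < 1 / 2 ∧ T ≤ T₀ ∧ T₀ + 1 ≤ T' ∧ DifferentiableOn ℂ c (strip T₀ (1 / 2)) ∧
      (∀ t ∈ strip T₀ (1 / 2), ‖c t‖ ≤ C₁ * Real.exp (-(η / 2) * t.re)) ∧
      (∀ i, T₀ ≤ τ i ∧ τ i ≤ T' ∧
        MapsTo (chart (β i) c (J i)) (strip (τ i) θ ×ˢ ball 0 1)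
          (strip T₀ (1 / 2) ×ˢ ball (0 : E) 1) ∧
        InvariantGraph (slowStep B a b) (τ i) θ (η / 2) (β i) (ρ i) c (J i) (g i)) ∧
      ∀ i l, β l < β i → ‖((J l).symm : E →L[ℂ] (Cn (n l) × Cn (n' l)))‖ *
        ‖((J i) : (Cn (n i) × Cn (n' i)) →L[ℂ] E)‖ * Real.exp (-(β i - β l) * T') < ρ l / 4 := by
  have hη2 : 0 < η / 2 := by positivity
  -- After N corrections the residual has rate η + N η/2, which is at least β_i + η/2 for every i.
  obtain ⟨N, hN⟩ : ∃ N : ℕ, ∀ i, β i ≤ N * (η / 2) := by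
    have h1 : ∀ᶠ N : ℕ in atTop, ∀ i, β i ≤ N * (η / 2) :=
      eventually_all.2 fun i => ((tendsto_natCast_atTop_atTop (R := ℝ)).atTop_mul_const
        hη2).eventually_ge_atTop (β i)
    exact h1.exists
  obtain ⟨T₀, c, C₁, C₂, hT₀, hc, hc1, hc2⟩ := H.exists_curve B hη hη1 N (1 / 2) (by norm_num)
  -- The curve decays only at the rate η/2, so the system is also considered with this rate.
  have H' : SlowSystem T₀ (1 / 2) (η / 2) |C| a b :=
    (H.mono_rate hT (half_le_self hη.le)).mono hT₀ (by norm_num)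
  have hres (i) (t : ℂ) (ht : t ∈ strip T₀ (1 / 2)) :
      ‖residual B a b c t‖ ≤ |C₂| * Real.exp (-(β i + η / 2) * t.re) := by
    have ht0 : 0 ≤ t.re := (hT.trans hT₀).trans ht.1.le
    refine (hc2 t ht).trans (mul_le_mul (le_abs_self _) (Real.exp_le_exp.2 ?_)
      (Real.exp_pos _).le (abs_nonneg _))
    nlinarith [mul_nonneg (by linarith [hN i] : 0 ≤ η + N * (η / 2) - (β i + η / 2)) ht0]
  have hex : ∀ᶠ θ in 𝓝[>] (0 : ℝ), ∀ i, ∃ (τ ρ : ℝ) (g : ℂ × Cn (n i) → Cn (n' i)), T₀ ≤ τ ∧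
      MapsTo (chart (β i) c (J i)) (strip τ θ ×ˢ ball 0 1)
        (strip T₀ (1 / 2) ×ˢ ball (0 : E) 1) ∧
      InvariantGraph (slowStep B a b) τ θ (η / 2) (β i) ρ c (J i) g :=
    eventually_all.2 fun i => exists_invariantGraph H' hη2 (by linarith) (hβ i) hc hc1 (hres i)
      (J i) (hm i) (hJ i) (hAs i) (hAc i)
  have hθ2 : ∀ᶠ θ in 𝓝[>] (0 : ℝ), θ < 1 / 2 :=
    mem_nhdsWithin_of_mem_nhds (Iio_mem_nhds (by norm_num))
  obtain ⟨θ, ⟨hθ, hθ2⟩, hθ0⟩ := ((hex.and hθ2).and self_mem_nhdsWithin).exists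
  choose τ ρ g hτ hmaps hg using hθ
  have hT' : ∀ᶠ T' in atTop, T₀ + 1 ≤ T' ∧ (∀ i, τ i ≤ T') ∧ ∀ i l, β l < β i →
      ‖((J l).symm : E →L[ℂ] (Cn (n l) × Cn (n' l)))‖ *
        ‖((J i) : (Cn (n i) × Cn (n' i)) →L[ℂ] E)‖ * Real.exp (-(β i - β l) * T') < ρ l / 4 := by
    refine (eventually_ge_atTop _).and ((eventually_all.2 fun i => eventually_ge_atTop _).and
      (eventually_all.2 fun i => eventually_all.2 fun l => ?_))
    by_cases hil : β l < β i
    · have hρ := (hg l).ρ_pos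
      have := (tendsto_const_mul_exp_neg (sub_pos.2 hil)
        (‖((J l).symm : E →L[ℂ] (Cn (n l) × Cn (n' l)))‖ *
          ‖((J i) : (Cn (n i) × Cn (n' i)) →L[ℂ] E)‖)).eventually
            (gt_mem_nhds (by positivity : 0 < ρ l / 4))
      exact this.mono fun _ h1 _ => h1
    · exact Eventually.of_forall fun _ h1 => absurd h1 hil
  obtain ⟨T', hT1, hT2, hT3⟩ := hT'.exists
  exact ⟨θ, T₀, T', C₁, c, τ, ρ, g, hθ0, hθ2, hT₀, hT1, hc, hc1,
    fun i => ⟨hτ i, hT2 i, hmaps i, hg i⟩, hT3⟩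

/-- The union of the graphs is strictly increasing as the rate decreases. -/
theorem InvariantGraph.image_ssubset {m k n₁ n₁' n₂ n₂' : ℕ} {κ : ℂ} {η : ℝ} {j : Fin (m + 1)}
    {u₀ : Fin m → ℂ} {F : ℂ × (Fin m → ℂ) → ℂ × (Fin m → ℂ)}
    {T₁ T₂ T' θ η₁ η₂ β₁ β₂ ρ₁ ρ₂ : ℝ} {c : ℂ → Fin m → ℂ}
    {J₁ : (Cn n₁ × Cn n₁') ≃L[ℂ] (Fin m → ℂ)} {J₂ : (Cn n₂ × Cn n₂') ≃L[ℂ] (Fin m → ℂ)}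
    {g₁ : ℂ × Cn n₁ → Cn n₁'} {g₂ : ℂ × Cn n₂ → Cn n₂'}
    (H₁ : InvariantGraph F T₁ θ η₁ β₁ ρ₁ c J₁ g₁) (H₂ : InvariantGraph F T₂ θ η₂ β₂ ρ₂ c J₂ g₂)
    (hβ : β₂ < β₁) (hT₁ : T₁ ≤ T') (hT₂ : T₂ ≤ T')
    (hsmall : ‖(J₂.symm : (Fin m → ℂ) →L[ℂ] (Cn n₂ × Cn n₂'))‖ *
      ‖(J₁ : (Cn n₁ × Cn n₁') →L[ℂ] (Fin m → ℂ))‖ * Real.exp (-(β₁ - β₂) * T') < ρ₂ / 4)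
    (hκ : κ ≠ 0) (hk : k ≠ 0) (hθ0 : 0 < θ) (hθ : θ ≤ 1) (hn : 0 < n₂) :
    (fun p => sectorChart κ k η j u₀ (graphChart β₁ c J₁ g₁ p)) ''
        (strip T' θ ×ˢ ball 0 (ρ₁ / 2)) ⊂
      (fun p => sectorChart κ k η j u₀ (graphChart β₂ c J₂ g₂ p)) ''
        (strip T' θ ×ˢ ball 0 (ρ₂ / 2)) := by
  have hρ := H₂.ρ_pos
  have hle {p} (hp : p ∈ strip T' θ ×ˢ ball (0 : Cn n₁) (ρ₁ / 2)) :=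
    H₁.exists_graphChart_eq H₂ hβ hT₁ hT₂ hsmall hp
  refine (ssubset_iff_of_subset ?_).2 ?_
  · rintro _ ⟨p, hp, rfl⟩
    obtain ⟨q, hq, e⟩ := hle hp
    exact ⟨q, ⟨hq.1, ball_subset_ball (by linarith) hq.2⟩,
      (congrArg (sectorChart κ k η j u₀) e).symm⟩
  · have : Nonempty (Fin n₂) := ⟨⟨0, hn⟩⟩
    -- Points of the smaller graph have fibre coordinate of norm less than ρ₂/4 in the second chart.
    -- A point with norm exactly ρ₂/4, available because n₂ > 0, shows that the inclusion is strict.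
    obtain ⟨w, hw⟩ := exists_norm_eq (Cn n₂) (by positivity : 0 ≤ ρ₂ / 4)
    have ht : (((T' + 1 : ℝ) : ℂ)) ∈ strip T' θ := by
      refine ⟨?_, ?_⟩
      · rw [Complex.ofReal_re]; linarith
      · rw [Complex.ofReal_im, abs_zero]; exact hθ0
    refine ⟨_, ⟨(((T' + 1 : ℝ) : ℂ), w), ⟨ht, ?_⟩, rfl⟩, ?_⟩
    · rw [mem_ball_zero_iff, hw]; linarith
    · rintro ⟨p, hp, e⟩
      obtain ⟨q, hq, eq⟩ := hle hp
      beta_reduce at e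
      rw [eq] at e
      have e1 := congrArg (sectorChartInv κ k η j u₀) e
      rw [sectorChartInv_sectorChart (p := graphChart β₂ c J₂ g₂ q) hκ hk hθ hq.1.2,
        sectorChartInv_sectorChart (p := graphChart β₂ c J₂ g₂ (((T' + 1 : ℝ) : ℂ), w)) hκ hk hθ
          ht.2] at e1
      have e2 := congrArg (graphChartInv (n := n₂) (n' := n₂') β₂ c J₂) e1
      rw [graphChartInv_graphChart, graphChartInv_graphChart] at e2
      have h1 := hq.2
      rw [mem_ball_zero_iff, e2] at h1
      exact h1.ne hw

end ParabolicManifolds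
end

/-! ### The increasing sequence of parabolic manifolds. -/

open ParabolicManifolds in
theorem corollary8p9 {m : ℕ} (Φ : Cn (m + 1) → Cn (m + 1)) (U : Set (Cn (m + 1)))
    (hΦ : IsTangentToIdentity Φ U) (k : ℕ) (hk : HasOrder Φ (k + 1))
    (V : Cn (m + 1)) (hV : IsNondegenerateCharacteristicDirection Φ k V)
    (j : Fin (m + 1)) (hj : V j ≠ 0)
    (h : ℕ) (lam : Fin h → ℂ)
    (hlam : Set.range lam = {μ : ℂ | IsDirector Φ k j V μ ∧ 0 < μ.re})
    (hanti : StrictAnti fun i => (lam i).re) :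
    ∃ γ > (0 : ℝ), ∃ s > (0 : ℝ), ∃ ρ > (0 : ℝ), ∃ M : Fin h → Set (Cn (m + 1)),
      StrictMono M ∧
      ∀ i : Fin h,
        M i ⊆ U ∩ sector Φ k j V γ s ρ ∧
        AttractedAlong Φ V (M i) ∧
        ∃ n : ℕ, n = ∑ l with (lam i).re ≤ (lam l).re, algMult Φ k j V (lam l) ∧
          ∃ θ > (0 : ℝ), k * θ < Real.pi / 2 ∧ ∃ s' > (0 : ℝ), ∃ ρ' > (0 : ℝ),
            ∃ ψ : Cn (n + 1) → Cn (m + 1),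
              IsParabolicManifold Φ V (n + 1) (coordSector n θ s' ρ') ψ (M i) ∧
              IsTangentAtOrigin (coordSector n θ s' ρ') ψ
                (Submodule.span ℂ {V} ⊔
                  ⨆ l : Fin h, ⨆ _ : (lam i).re ≤ (lam l).re,
                    directorSpace Φ k j V (lam l)) := by
  have hk0 : k ≠ 0 := by have := hk.1; omega
  have hkpos : (0 : ℝ) < k := by positivity
  have hk1 : (1 : ℝ) ≤ k := by exact_mod_cast Nat.one_le_iff_ne_zero.2 hk0
  have hpos (i) : 0 < (lam i).re := by
    have : lam i ∈ Set.range lam := Set.mem_range_self i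
    rw [hlam] at this
    exact this.2
  have hinj : Function.Injective lam := fun i l e => hanti.injective (congrArg Complex.re e)
  -- For every i the interval [Re λ_i - ϖ, Re λ_i) contains no real part of a director.
  obtain ⟨ϖ, hϖ, hϖ0⟩ := ((eventually_spectral_gap (Matrix.toLin' (associatedMatrix Φ k j V)) lam
    hpos).and self_mem_nhdsWithin).exists
  -- The bound 2η ≤ 1/k is needed for the local form, and the rates β_i = Re λ_i - ϖ - η must be
  -- positive.
  obtain ⟨η, ⟨hηk, hηβ⟩, hη⟩ : ∃ η : ℝ, (2 * η ≤ 1 / k ∧ ∀ i, 0 < (lam i).re - ϖ - η) ∧ 0 < η := by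
    have key {x : ℝ} (hx : 0 < x) : ∀ᶠ η in 𝓝[>] (0 : ℝ), η < x :=
      mem_nhdsWithin_of_mem_nhds (Iio_mem_nhds hx)
    have e1 : ∀ᶠ η : ℝ in 𝓝[>] (0 : ℝ), 2 * η ≤ 1 / k :=
      (key (by positivity : 0 < 1 / (k : ℝ) / 2)).mono fun η h1 => by linarith
    have e2 : ∀ᶠ η in 𝓝[>] (0 : ℝ), ∀ i, 0 < (lam i).re - ϖ - η :=
      Filter.eventually_all.2 fun i => (key (hϖ i).1).mono fun η h1 => by linarith
    exact ((e1.and e2).and self_mem_nhdsWithin).exists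
  have hη1 : η ≤ 1 := by
    have : 1 / (k : ℝ) ≤ 1 := by rw [div_le_one hkpos]; exact hk1
    linarith
  obtain ⟨κ, hκ0, hκ⟩ := exists_pow_eq_of_ne_zero hk0 (pPart_ne_zero hV hj)
  obtain ⟨T, C, a, b, hT, H, hconj⟩ := exists_local_form hΦ hk hV hj hη hηk hκ
  have hϖ0' : 0 < ϖ := hϖ0
  -- The splitting is at the level β_i + η = Re λ_i - ϖ of A(V), that is, at the level β_i of B =
  -- A(V) - η.
  choose n n' J As Ac e he hJ hAs hAc hn hn0 hfin hmem using fun i =>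
    exists_director_splitting Φ k j hj hlam hinj i hη.le (hηβ i) (by linarith)
      fun μ hμ hlt => by linarith [(hϖ i).2 μ hμ hlt]
  obtain ⟨θ, T₀, T', C₁, c, τ, ρ, g, hθ0, hθ2, hT₀, hT', hc, hc1, hg, hsmall⟩ :=
    H.exists_invariantGraphs _ hT hη hη1 hηβ J he hJ hAs hAc
  have hθ1 : θ ≤ 1 := by linarith
  have hT₀0 : 0 ≤ T₀ := hT.trans hT₀
  have hD : ∀ p ∈ strip T₀ (1 / 2) ×ˢ Metric.ball (0 : Fin m → ℂ) 1, ‖p.2‖ ≤ 1 ∧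
      sectorChart κ k η j (affineCoord j V) p ∈ U ∧
        Φ (sectorChart κ k η j (affineCoord j V) p) = sectorChart κ k η j (affineCoord j V)
          (slowStep (associatedMap Φ k j V - (η : ℂ) • ContinuousLinearMap.id ℂ (Fin m → ℂ))
            a b p) := fun p hp =>
    ⟨(mem_ball_zero_iff.1 hp.2).le, hconj p ⟨strip_subset_strip hT₀ (by norm_num) hp.1, hp.2⟩⟩
  have hmaps (i) := (hg i).2.2.2.mapsTo_graphChart (hg i).2.2.1 (hg i).2.1
  -- All the M_i are images of graphs over the same half strip; γ = s = 1 because the strip has |Im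
  -- t| < 1/2 and Re t > 0.
  refine ⟨1, one_pos, 1, one_pos,
    ‖((PiLp.continuousLinearEquiv 2 ℂ fun _ : Fin m => ℂ).symm : (Fin m → ℂ) →L[ℂ] Cn m)‖ + 1,
    by positivity, fun i =>
    (fun p => sectorChart κ k η j (affineCoord j V)
      (graphChart ((lam i).re - ϖ - η) c (J i) (g i) p)) ''
      (strip T' θ ×ˢ Metric.ball 0 (ρ i / 2)), fun i l hil => ?_, fun i => ⟨?_, ?_⟩⟩
  · have hβ := sub_lt_sub_right (sub_lt_sub_right (hanti hil) ϖ) η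
    exact (hg i).2.2.2.image_ssubset (hg l).2.2.2 hβ (hg i).2.1 (hg l).2.1 (hsmall i l hβ)
      hκ0 hk0 hθ0 hθ1 (hn0 l)
  · rintro _ ⟨p, hp, rfl⟩
    have h1 := hmaps i hp
    exact ⟨(hD _ h1).2.1, sectorChart_mem_sector hk0 hκ hκ0 hη.le le_rfl hT₀0 h1⟩
  · have hpar := (hg i).2.2.2.isParabolicManifold hk0 hκ0 hη hθ0 hθ1 (hg i).2.1 hj rfl
      (hc.mono (strip_subset_strip (hg i).1 hθ2.le)) hD (hmaps i) rfl
    refine ⟨hpar.1, n i, hn i, θ / k, by positivity, ?_, _, Real.exp_pos _, _,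
      half_pos (hg i).2.2.2.ρ_pos, _, hpar.2, ?_⟩
    · rw [mul_div_cancel₀ _ hkpos.ne']
      linarith [Real.pi_gt_three]
    · exact (hg i).2.2.2.isTangentAtOrigin hk0 hκ0 hη (by positivity) (hηβ i).le
        (by positivity) hθ0 hθ2 (hg i).2.1 hT₀0 hT' hc hc1
        (fun p hp => (hD _ (hmaps i hp)).1) (hfin i)
        (Submodule.mem_sup_left (point_mem_span j hj)) (hmem i)
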